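/- Let $N\in\mathbb N$, $T>0$, $\alpha\in(0,1)$. Let $H:\mathbb R^N\times\mathbb R^N\to\mathbb R$ be continuous and $\mathbb Z^N$-periodic in its first variable, with $\lim_{r\to\infty}\inf\{H(y,p): y\in\mathbb R^N,\ |p|\ge r\}=\infty$, and assume that there is $C_H>0$ such that $|H(x,p)-H(y,q)|\le C_H(|x-y|+|p-q|)$ and $H(x,p)\ge C_H^{-1}|p|-C_H$ for all $x,y,p,q\in\mathbb R^N$. Let $u_0:\mathbb R^N\to\mathbb R$ be bounded and Lipschitz continuous. For $t\in(0,T]$ and $0\le a<b\le t$ put $$J[f](t)=\frac{f(t)-f(0)}{t^\alpha\,\Gamma(1-\alpha)},\qquad K_{(a,b)}[f](t)=\frac{\alpha}{\Gamma(1-\alpha)}\int_a^b\frac{f(t)-f(t-\tau)}{\tau^{\alpha+1}}\,d\tau,$$ and for functions $f$ of $(x,t)$ let $J[f](x,t)$, $K_{(a,b)}[f](x,t)$ be these expressions for $f(x,\cdot)$. For a function $F:\mathbb R^N\times\mathbb R^N\to\mathbb R$, a viscosity subsolution of $\partial_t^\alpha w+F(x,Dw)=0$, $w(\cdot,0)=u_0$,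 is an upper semicontinuous $w:\mathbb R^N\times[0,T]\to\mathbb R$ with $w(\cdot,0)\le u_0$ such that $J[\varphi](x_1,t_1)+K_{(0,t_1)}[\varphi](x_1,t_1)+F(x_1,D\varphi(x_1,t_1))\le 0$ whenever $\varphi\in C^1(\mathbb R^N\times(0,T])\cap C(\mathbb R^N\times[0,T])$ and $w-\varphi$ attains its maximum over $\mathbb R^N\times[0,T]$ at $(x_1,t_1)$ with $t_1\in(0,T]$. Supersolutions are defined symmetrically (lower semicontinuous, minimum, reversed inequalities), and a viscosity solution is a bounded continuous function that is both. Viscosity solutions of stationary equations are continuous and are defined as usual, by $C^1$ test functions touching at local extrema. For $p\in\mathbb R^N$ let $\overline H(p)$ be the unique constant for which $H(y,p+Dv)=\overline H(p)$ has a continuous $\mathbb Z^N$-periodic viscosity solution $v$. Let $u^\varepsilon$ ($\varepsilon>0$) be the viscosity solution of $\partial_t^\alpha u^\varepsilon+H(x/\varepsilon,Du^\varepsilon)=0$, $u^\varepsilon(\cdot,0)=u_0$; let $\overline u$ be the viscosity solution of $\partial_t^\alpha\overline u+\overline H(D\overline u)=0$, $\overline u(\cdot,0)=u_0$; and for $\lambda>0$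 and $P\in\mathbb R^N$ let $v^\lambda(\cdot,P)$ be the bounded viscosity solution of $\lambda v^\lambda+H(y,P+Dv^\lambda)=0$ in $\mathbb R^N$. Let $\theta,\beta\in(0,1)$. For $\varepsilon>0$, $\delta\in(0,1)$, $R>0$ and $\lambda=\varepsilon^\theta$, define on $\mathbb R^{2N}\times[0,T]$ $$\Phi(x,y,t)=u^\varepsilon(x,t)-\overline u(y,t)-\varepsilon v^{\lambda}\Big(\frac x\varepsilon,\frac{x-y}{\varepsilon^\beta}\Big)-\frac{|x-y|^2}{2\varepsilon^\beta}-\frac{\delta|y|^2}{2}-\frac{Rt^\alpha}{\Gamma(1+\alpha)}.$$ Then there is $\varepsilon_0\in(0,1)$ such that for each $\nu\in(0,1)$ there is a constant $C>0$, independent of $\varepsilon$, $\delta$, $R$ and of the maximum point below, with the following property. For all $\varepsilon\in(0,\varepsilon_0)$, $\delta\in(0,1)$ with $\delta^{1/2}<\lambda$, and $R>0$: if $\Phi$ attains its maximum over $\mathbb R^{2N}\times[0,T]$ at $(\hat x,\hat y,\hat t)$ with $\hat t\in(0,T]$, then $$J[u^\varepsilon](\hat x,\hat t)-J[\overline u](\hat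 y,\hat t)+K_{(0,\hat t)}[u^\varepsilon](\hat x,\hat t)-K_{(0,\hat t)}[\overline u](\hat y,\hat t)\le C\Big(\varepsilon^{\theta-\frac{\beta(1-\nu)}{2-\nu}}+\varepsilon^{1-\theta-\beta}\Big).$$ Here the difference of the two $K$-terms is understood as $K_{(0,\hat t)}[u^\varepsilon(\hat x,\cdot)-\overline u(\hat y,\cdot)](\hat t)$, whose integral converges absolutely (this is part of the assertion); it equals the difference of the two terms whenever these converge separately, so that the inequality then also holds literally. -/

import Mathlib

open Set Filter Topology MeasureTheory

noncomputable section

namespace TFHJ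

/-- The Euclidean space of dimension `N`. -/
abbrev Space (N : ℕ) : Type := EuclideanSpace ℝ (Fin N)

/-- The vector of `Space N` with integer coordinates `k`. -/
def latticeVec {N : ℕ} (k : Fin N → ℤ) : Space N := WithLp.toLp 2 (fun i => (k i : ℝ))

/-! ### The two parts of the Caputo derivative -/

/-- `J[f](t) = (f(t) - f(0)) / (t ^ α Γ(1 - α))`. -/
def J (α : ℝ) (f : ℝ → ℝ) (t : ℝ) : ℝ :=
  (f t - f 0) / (t ^ α * Real.Gamma (1 - α))

/-- `K_{(a,b)}[f](t) = α / Γ(1 - α) * ∫_a^b (f(t) - f(t - τ)) / τ ^ (α + 1) dτ`. -/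
def K (α a b : ℝ) (f : ℝ → ℝ) (t : ℝ) : ℝ :=
  α / Real.Gamma (1 - α) * ∫ τ in a..b, (f t - f (t - τ)) / τ ^ (α + 1)

/-- The integral in `K_{(a,b)}[f](t)` converges (absolutely). -/
def KExists (α a b : ℝ) (f : ℝ → ℝ) (t : ℝ) : Prop :=
  IntervalIntegrable (fun τ => (f t - f (t - τ)) / τ ^ (α + 1)) volume a b

/-! ### Viscosity solutions of the time-fractional problem

The problem is `∂_t^α u + F(x, Du) = 0` in `Space N × (0, T)` with `u(·, 0) = u₀`. -/

/-- Test functions: of class `C¹` on `Space N × (0, T]`, continuous on `Space N × [0, T]`. -/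
def IsTest {N : ℕ} (T : ℝ) (φ : Space N → ℝ → ℝ) : Prop :=
  ContDiffOn ℝ 1 (Function.uncurry φ) (univ ×ˢ Ioc 0 T) ∧
    ContinuousOn (Function.uncurry φ) (univ ×ˢ Icc 0 T)

/-- Viscosity subsolutions; the gradient is the one in the space variable. -/
def IsSubsolution {N : ℕ} (α T : ℝ) (F : Space N → Space N → ℝ) (u₀ : Space N → ℝ)
    (u : Space N → ℝ → ℝ) : Prop :=
  UpperSemicontinuousOn (Function.uncurry u) (univ ×ˢ Icc 0 T) ∧
  (∀ x, u x 0 ≤ u₀ x) ∧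
  ∀ φ : Space N → ℝ → ℝ, IsTest T φ → ∀ x₁ : Space N, ∀ t₁ ∈ Ioc 0 T,
    (∀ x, ∀ t ∈ Icc 0 T, u x t - φ x t ≤ u x₁ t₁ - φ x₁ t₁) →
      J α (φ x₁) t₁ + K α 0 t₁ (φ x₁) t₁ + F x₁ (gradient (fun x => φ x t₁) x₁) ≤ 0

/-- Viscosity supersolutions. -/
def IsSupersolution {N : ℕ} (α T : ℝ) (F : Space N → Space N → ℝ) (u₀ : Space N → ℝ)
    (u : Space N → ℝ → ℝ) : Prop :=
  LowerSemicontinuousOn (Function.uncurry u) (univ ×ˢ Icc 0 T) ∧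
  (∀ x, u₀ x ≤ u x 0) ∧
  ∀ φ : Space N → ℝ → ℝ, IsTest T φ → ∀ x₁ : Space N, ∀ t₁ ∈ Ioc 0 T,
    (∀ x, ∀ t ∈ Icc 0 T, u x₁ t₁ - φ x₁ t₁ ≤ u x t - φ x t) →
      0 ≤ J α (φ x₁) t₁ + K α 0 t₁ (φ x₁) t₁ + F x₁ (gradient (fun x => φ x t₁) x₁)

/-- Viscosity solutions, in the class of bounded functions, in which they are unique. -/
def IsSolution {N : ℕ} (α T : ℝ) (F : Space N → Space N → ℝ) (u₀ : Space N → ℝ)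
    (u : Space N → ℝ → ℝ) : Prop :=
  ContinuousOn (Function.uncurry u) (univ ×ˢ Icc 0 T) ∧
  (∃ M : ℝ, ∀ x, ∀ t ∈ Icc 0 T, |u x t| ≤ M) ∧
  IsSubsolution α T F u₀ u ∧ IsSupersolution α T F u₀ u

/-! ### Stationary problems -/

/-- Continuous viscosity solutions of `G(y, v(y), Dv(y)) = 0` in the whole space. -/
def IsStationarySolution {N : ℕ} (G : Space N → ℝ → Space N → ℝ) (v : Space N → ℝ) : Prop :=
  Continuous v ∧
  (∀ φ : Space N → ℝ, ContDiff ℝ 1 φ → ∀ y, IsLocalMax (fun z => v z - φ z) y →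
    G y (v y) (gradient φ y) ≤ 0) ∧
  (∀ φ : Space N → ℝ, ContDiff ℝ 1 φ → ∀ y, IsLocalMin (fun z => v z - φ z) y →
    0 ≤ G y (v y) (gradient φ y))

/-- The cell problem `H(y, p + Dv) = c` on the torus has a continuous viscosity solution. -/
def CellSolvable {N : ℕ} (H : Space N → Space N → ℝ) (p : Space N) (c : ℝ) : Prop :=
  ∃ v : Space N → ℝ, (∀ y (k : Fin N → ℤ), v (y + latticeVec k) = v y) ∧
    IsStationarySolution (fun y _ q => H y (p + q) - c) v

/-- The effective Hamiltonian at `p`: the constant for which the cell problem is solvable. -/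
def effectiveHamiltonian {N : ℕ} (H : Space N → Space N → ℝ) (p : Space N) : ℝ :=
  Classical.epsilon (CellSolvable H p)

/-- `v` is the bounded viscosity solution of `l v + H(y, P + Dv) = 0` in the whole space. -/
def IsDiscountedSolution {N : ℕ} (H : Space N → Space N → ℝ) (l : ℝ) (P : Space N)
    (v : Space N → ℝ) : Prop :=
  (∃ M : ℝ, ∀ y, |v y| ≤ M) ∧
    IsStationarySolution (fun y r q => l * r + H y (P + q)) v

/-! ### The data and the auxiliary function -/

/-- Assumptions on the Hamiltonian and the initial value. -/
structure Assumptions {N : ℕ} (H : Space N → Space N → ℝ) (u₀ : Space N → ℝ) : Prop where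
  continuous : Continuous (Function.uncurry H)
  coercive : ∀ M : ℝ, ∃ r : ℝ, ∀ y p : Space N, r ≤ ‖p‖ → M ≤ H y p
  periodic : ∀ (y p : Space N) (k : Fin N → ℤ), H (y + latticeVec k) p = H y p
  initial_lipschitz : ∃ L : NNReal, LipschitzWith L u₀
  initial_bounded : ∃ M : ℝ, ∀ x, |u₀ x| ≤ M
  lipschitz : ∃ C > 0, ∀ x y p q : Space N, |H x p - H y q| ≤ C * (‖x - y‖ + ‖p - q‖)
  linear_growth : ∃ C > 0, ∀ x p : Space N, C⁻¹ * ‖p‖ - C ≤ H x p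

/-- The function `Φ(x, y, t)`, for `w = u^ε`, `ubar` and `v = v^λ` (a function of `(y, P)`). -/
def Phi {N : ℕ} (α ε β δ R : ℝ) (w ubar : Space N → ℝ → ℝ) (v : Space N → Space N → ℝ)
    (x y : Space N) (t : ℝ) : ℝ :=
  w x t - ubar y t - ε * v (ε⁻¹ • x) ((ε ^ β)⁻¹ • (x - y)) - ‖x - y‖ ^ 2 / (2 * ε ^ β)
    - δ * ‖y‖ ^ 2 / 2 - R * t ^ α / Real.Gamma (1 + α)

end TFHJ

end

namespace TFHJ

/-! Write `X = ε ^ θ` for the discount, `Y = ε ^ (1 - θ - β)`, `q = ε ^ β`, so that `ε = Y * q * X`,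
and `P = q⁻¹ • (x₁ - y₁)`. Comparison for the discounted problem gives `X * |v(·, P) - v(·, Q)| ≤ C
* ‖P - Q‖`. Hence the second argument of the corrector can be frozen at `P` in `Phi`, at the price
of a cone `C * Y * ‖x - y - (x₁ - y₁)‖`. The point then still maximizes a function in which the
corrector depends on `x` alone, and the cone perturbs each gradient by at most `C * Y`.

The frozen corrector is merely Lipschitz and the solutions merely continuous, so neither may enter a
test function. The variables are therefore doubled in time and a third space variable `z` is given
to the corrector, with penalties of weight `n`. At a maximum of the doubled function the subsolution
inequality for `u ε`, the supersolution inequality for `ubar` and the one for the corrector can be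
combined (`caputo_sub_le_of_max`). The corrector inequality and the Lipschitz continuity of `H`
replace the oscillating Hamiltonian by `-X * v`, which differs from the effective Hamiltonian at `P`
by at most `X` times a multiple of `1 + ‖P‖` (`abs_discounted_add_le`).

Two uses of Fatou's lemma handle the nonlocal term. In `TestsSub.caputo_le`, test functions that
tend to the solution in time, with increments bounded below by a multiple of `-τ`, put the solution
itself into the Caputo derivative. In `caputo_sub_le`, the limit `n → ∞` uses a one-sided bound on
the difference of the time increments: shifting both times back by `τ` leaves `t - s` unchanged.
This also gives the absolute convergence of the integral for the difference, although neither
integral need converge separately in the limit.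

It remains to bound `P` and `δ * ‖y₁‖`. The function `ubar` inherits the Lipschitz constant of the
initial value, by comparison with a spatial shift; the first order condition in `y` then bounds `P -
δ • y₁`. Comparing `Phi` with its value at the origin and using `δ ≤ X ^ 2` gives `δ * ‖y₁‖ ≤ D * X
+ C * Y`. The total error is a multiple of `X + Y`, and `X` is at most the first power in the claim.
-/

/-! ### Fatou's lemma and the convergence of fractional integrals -/

/-- A form of Fatou's lemma: an a.e. limit of functions that are bounded below by an integrable
function and have bounded integrals is integrable, and its integral is bounded by the limit of the
bounds. -/
lemma integrable_and_integral_le_of_tendsto {X : Type*} [MeasurableSpace X] {μ : Measure X}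
    {f : ℕ → X → ℝ} {g h : X → ℝ} {c : ℕ → ℝ} {C : ℝ}
    (hf : ∀ᶠ n in atTop, Integrable (f n) μ) (hh : Integrable h μ)
    (hlow : ∀ᶠ n in atTop, ∀ᵐ x ∂μ, -h x ≤ f n x)
    (hlim : ∀ᵐ x ∂μ, Tendsto (fun n => f n x) atTop (𝓝 (g x)))
    (hc : ∀ᶠ n in atTop, ∫ x, f n x ∂μ ≤ c n) (hcC : Tendsto c atTop (𝓝 C)) :
    Integrable g μ ∧ ∫ x, g x ∂μ ≤ C := by
  obtain ⟨n₀, hn₀⟩ := eventually_atTop.1 (hf.and (hlow.and hc))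
  -- Dropping `n₀` terms makes the eventual hypotheses hold for every index; adding `h` makes the
  -- functions nonnegative, as Fatou's lemma for `lintegral` requires.
  set F : ℕ → X → ℝ := fun n x => f (n + n₀) x + h x with hF
  have hFi : ∀ n, Integrable (F n) μ := fun n => (hn₀ (n + n₀) (by lia)).1.add hh
  have hF0 : ∀ n, 0 ≤ᵐ[μ] F n := fun n => by
    filter_upwards [(hn₀ (n + n₀) (by lia)).2.1] with x hx
    simp only [hF, Pi.zero_apply]; linarith
  have hFint : ∀ n, ∫ x, F n x ∂μ ≤ c (n + n₀) + ∫ x, h x ∂μ := fun n => by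
    rw [hF, integral_add (hn₀ (n + n₀) (by lia)).1 hh]
    linarith [(hn₀ (n + n₀) (by lia)).2.2]
  have hclim : Tendsto (fun n => c (n + n₀) + ∫ x, h x ∂μ) atTop (𝓝 (C + ∫ x, h x ∂μ)) :=
    ((tendsto_add_atTop_iff_nat n₀).2 hcC).add_const _
  have hClow : 0 ≤ C + ∫ x, h x ∂μ :=
    ge_of_tendsto' hclim fun n => (integral_nonneg_of_ae (hF0 n)).trans (hFint n)
  have hFlim : ∀ᵐ x ∂μ, Tendsto (fun n => F n x) atTop (𝓝 (g x + h x)) := by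
    filter_upwards [hlim] with x hx
    exact ((tendsto_add_atTop_iff_nat n₀).2 hx).add_const _
  have hGm : AEStronglyMeasurable (fun x => g x + h x) μ :=
    aestronglyMeasurable_of_tendsto_ae _ (fun n => (hFi n).aestronglyMeasurable) hFlim
  have hG0 : 0 ≤ᵐ[μ] fun x => g x + h x := by
    filter_upwards [hFlim, ae_all_iff.2 hF0] with x hx hx0
    exact ge_of_tendsto' hx hx0
  have hlint : ∫⁻ x, ENNReal.ofReal (g x + h x) ∂μ ≤ ENNReal.ofReal (C + ∫ x, h x ∂μ) := by
    calc ∫⁻ x, ENNReal.ofReal (g x + h x) ∂μ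
        = ∫⁻ x, liminf (fun n => ENNReal.ofReal (F n x)) atTop ∂μ := by
          refine lintegral_congr_ae ?_
          filter_upwards [hFlim] with x hx
          exact ((ENNReal.continuous_ofReal.tendsto _).comp hx).liminf_eq.symm
      _ ≤ liminf (fun n => ∫⁻ x, ENNReal.ofReal (F n x) ∂μ) atTop :=
          lintegral_liminf_le' fun n => (hFi n).aestronglyMeasurable.aemeasurable.ennreal_ofReal
      _ ≤ liminf (fun n => ENNReal.ofReal (c (n + n₀) + ∫ x, h x ∂μ)) atTop := by
          refine liminf_le_liminf (Eventually.of_forall fun n => ?_)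
          rw [← ofReal_integral_eq_lintegral_ofReal (hFi n) (hF0 n)]
          exact ENNReal.ofReal_le_ofReal (hFint n)
      _ = ENNReal.ofReal (C + ∫ x, h x ∂μ) :=
          ((ENNReal.continuous_ofReal.tendsto _).comp hclim).liminf_eq
  have hGi : Integrable (fun x => g x + h x) μ :=
    ⟨hGm, (hasFiniteIntegral_iff_ofReal hG0).2 (hlint.trans_lt ENNReal.ofReal_lt_top)⟩
  have hgi : Integrable g μ := by
    have := hGi.sub hh
    refine this.congr (Eventually.of_forall fun x => ?_)
    simp
  refine ⟨hgi, ?_⟩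
  have h1 : ∫ x, (g x + h x) ∂μ ≤ C + ∫ x, h x ∂μ := by
    rw [integral_eq_lintegral_of_nonneg_ae hG0 hGm]
    exact ENNReal.toReal_le_of_le_ofReal hClow hlint
  rw [integral_add hgi hh] at h1
  linarith

lemma integrableOn_rpow_neg {α : ℝ} (hα : α < 1) {t : ℝ} (ht : 0 ≤ t) :
    IntegrableOn (fun τ : ℝ => τ ^ (-α)) (Ioc 0 t) := by
  rw [← intervalIntegrable_iff_integrableOn_Ioc_of_le ht]
  exact intervalIntegral.intervalIntegrable_rpow' (by linarith)

lemma mul_div_rpow_add_one {α τ : ℝ} (hτ : 0 < τ) (c : ℝ) :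
    c * τ / τ ^ (α + 1) = c * τ ^ (-α) := by
  rw [Real.rpow_add hτ, Real.rpow_one, Real.rpow_neg hτ.le]
  have := (Real.rpow_pos_of_pos hτ α).ne'
  field_simp

/-- A linear bound on the increments reduces the kernel to `τ ^ (-α)`, which is integrable at `0`
because `α < 1`. -/
lemma KExists_of_abs_sub_le {α t C : ℝ} (hα : α < 1) (ht : 0 ≤ t) {f : ℝ → ℝ}
    (hf : ContinuousOn f (Icc 0 t)) (hC : ∀ τ ∈ Icc 0 t, |f t - f (t - τ)| ≤ C * τ) :
    KExists α 0 t f t := by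
  rw [KExists, intervalIntegrable_iff_integrableOn_Ioc_of_le ht]
  refine Integrable.mono' ((integrableOn_rpow_neg hα ht).const_mul C) ?_ ?_
  · refine ContinuousOn.aestronglyMeasurable (ContinuousOn.div ?_ ?_ ?_) measurableSet_Ioc
    · refine continuousOn_const.sub (hf.comp (by fun_prop) ?_)
      intro τ hτ
      exact ⟨by linarith [hτ.2], by linarith [hτ.1]⟩
    · exact continuousOn_id.rpow_const fun τ hτ => Or.inl hτ.1.ne'
    · exact fun τ hτ => (Real.rpow_pos_of_pos hτ.1 _).ne'
  · refine (ae_restrict_iff' measurableSet_Ioc).2 (Eventually.of_forall fun τ hτ => ?_)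
    rw [Real.norm_eq_abs, abs_div, abs_of_pos (Real.rpow_pos_of_pos hτ.1 _),
      ← mul_div_rpow_add_one hτ.1]
    exact div_le_div_of_nonneg_right (hC τ ⟨hτ.1.le, hτ.2⟩) (Real.rpow_pos_of_pos hτ.1 _).le

/-- A function that is `C¹` on `(0, T]` and continuous on `[0, T]` has increments of linear size. -/
lemma exists_abs_sub_le_mul {T t : ℝ} (ht : t ∈ Ioc 0 T) {f : ℝ → ℝ}
    (hf : ContinuousOn f (Icc 0 T)) (hf1 : ContDiffOn ℝ 1 f (Ioc 0 T)) :
    ∃ C, 0 ≤ C ∧ ∀ τ ∈ Icc 0 t, |f t - f (t - τ)| ≤ C * τ := by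
  obtain ⟨Kc, s, hs, hL⟩ := (hf1 t ht).exists_lipschitzOnWith (convex_Ioc 0 T)
  obtain ⟨r, hr, hrs⟩ := Metric.mem_nhdsWithin_iff.1 hs
  obtain ⟨M, hM⟩ := isCompact_Icc.exists_bound_of_continuousOn hf
  have hM0 : 0 ≤ M := (norm_nonneg _).trans (hM t ⟨ht.1.le, ht.2⟩)
  set ρ := min r t with hρ
  have hρ0 : 0 < ρ := lt_min hr ht.1
  have hmem : ∀ τ, 0 ≤ τ → τ < ρ → t - τ ∈ s := fun τ h0 h1 => by
    refine hrs ⟨?_, ?_, by linarith [ht.2]⟩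
    · rw [Metric.mem_ball, Real.dist_eq, show t - τ - t = -τ by ring, abs_neg, abs_of_nonneg h0]
      exact h1.trans_le (min_le_left _ _)
    · linarith [min_le_right r t]
  -- `Kc` serves for `τ < ρ`, by the local Lipschitz bound at `t`; for `τ ≥ ρ` the sup bound `2 * M`
  -- is itself at most a multiple of `τ`.
  refine ⟨Kc + 2 * M / ρ, by positivity, fun τ hτ => ?_⟩
  rcases lt_or_ge τ ρ with h | h
  · have h1 := hL.dist_le_mul t (by simpa using hmem 0 le_rfl hρ0) (t - τ) (hmem τ hτ.1 h)
    rw [Real.dist_eq, Real.dist_eq, show t - (t - τ) = τ by ring, abs_of_nonneg hτ.1] at h1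
    have : 0 ≤ 2 * M / ρ * τ := by have := hτ.1; positivity
    linarith
  · have h1 := hM t ⟨ht.1.le, ht.2⟩
    have h2 := hM (t - τ) ⟨by linarith [hτ.2], by linarith [hτ.1, ht.2]⟩
    rw [Real.norm_eq_abs] at h1 h2
    have h3 : 2 * M ≤ 2 * M / ρ * τ := by
      rw [div_mul_eq_mul_div, le_div_iff₀ hρ0]
      exact mul_le_mul_of_nonneg_left h (by linarith)
    have h4 : 0 ≤ (Kc : ℝ) * τ := mul_nonneg Kc.2 hτ.1
    have := abs_sub (f t) (f (t - τ))
    linarith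

/-- A large multiple of `‖x - x₁‖ ^ 2` brings a function below its values on the line `x = x₁`. -/
lemma exists_sub_sq_le {E : Type*} [NormedAddCommGroup E] [ProperSpace E] {T B η : ℝ} {x₁ : E}
    {D : E → ℝ → ℝ} (hD : ContinuousOn (Function.uncurry D) (univ ×ˢ Icc 0 T))
    (hB : ∀ x, ∀ t ∈ Icc 0 T, D x t ≤ B) (hη : 0 < η) :
    ∃ A, 0 ≤ A ∧ ∀ x, ∀ t ∈ Icc 0 T, D x t - A * ‖x - x₁‖ ^ 2 ≤ D x₁ t + η := by
  have hcomp : IsCompact (Metric.closedBall x₁ 1 ×ˢ Icc (0 : ℝ) T) :=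
    (isCompact_closedBall x₁ 1).prod isCompact_Icc
  have hD' := hD.mono (prod_mono (subset_univ (Metric.closedBall x₁ 1)) Subset.rfl)
  obtain ⟨r, hr, hrD⟩ := Metric.uniformContinuousOn_iff.1
    (hcomp.uniformContinuousOn_of_continuous hD') η hη
  obtain ⟨M, hM⟩ := hcomp.exists_bound_of_continuousOn hD'
  set ρ := min r 1 with hρ
  have hρ0 : 0 < ρ := lt_min hr one_pos
  -- Within distance `ρ` of `x₁` uniform continuity suffices; farther away the quadratic term
  -- exceeds `|B| + |M|`.
  refine ⟨(|B| + |M|) / ρ ^ 2, by positivity, fun x t ht => ?_⟩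
  have hx1 : x₁ ∈ Metric.closedBall x₁ 1 := Metric.mem_closedBall_self zero_le_one
  rcases lt_or_ge ‖x - x₁‖ ρ with h | h
  · have h1 := hrD (x, t) ⟨by
      rw [Metric.mem_closedBall, dist_eq_norm]; exact h.le.trans (min_le_right _ _), ht⟩
      (x₁, t) ⟨hx1, ht⟩ (by
        rw [Prod.dist_eq, dist_self, dist_eq_norm, max_eq_left (norm_nonneg _)]
        exact h.trans_le (min_le_left _ _))
    rw [Real.dist_eq] at h1
    simp only [Function.uncurry] at h1
    have := (abs_lt.1 h1).2
    have : 0 ≤ (|B| + |M|) / ρ ^ 2 * ‖x - x₁‖ ^ 2 := by positivity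
    linarith
  · have h1 : |B| + |M| ≤ (|B| + |M|) / ρ ^ 2 * ‖x - x₁‖ ^ 2 := by
      rw [div_mul_eq_mul_div, le_div_iff₀ (by positivity)]
      gcongr
    have h2 := hM (x₁, t) ⟨hx1, ht⟩
    rw [Real.norm_eq_abs] at h2
    have h3 := (abs_le.1 h2).1
    simp only [Function.uncurry] at h3
    linarith [hB x t ht, le_abs_self B, le_abs_self M]

/-! ### Test function clauses, sign changes and gradients -/

/-- The test function clause of `IsSubsolution`. -/
def TestsSub {N : ℕ} (α T : ℝ) (F : Space N → Space N → ℝ) (u : Space N → ℝ → ℝ) : Prop :=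
  ∀ φ : Space N → ℝ → ℝ, IsTest T φ → ∀ x₁ : Space N, ∀ t₁ ∈ Ioc 0 T,
    (∀ x, ∀ t ∈ Icc 0 T, u x t - φ x t ≤ u x₁ t₁ - φ x₁ t₁) →
      J α (φ x₁) t₁ + K α 0 t₁ (φ x₁) t₁ + F x₁ (gradient (fun x => φ x t₁) x₁) ≤ 0

/-- The test function clause of `IsSupersolution`. -/
def TestsSuper {N : ℕ} (α T : ℝ) (F : Space N → Space N → ℝ) (u : Space N → ℝ → ℝ) : Prop :=
  ∀ φ : Space N → ℝ → ℝ, IsTest T φ → ∀ x₁ : Space N, ∀ t₁ ∈ Ioc 0 T,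
    (∀ x, ∀ t ∈ Icc 0 T, u x₁ t₁ - φ x₁ t₁ ≤ u x t - φ x t) →
      0 ≤ J α (φ x₁) t₁ + K α 0 t₁ (φ x₁) t₁ + F x₁ (gradient (fun x => φ x t₁) x₁)

lemma J_neg (α : ℝ) (f : ℝ → ℝ) (t : ℝ) : J α (fun s => -f s) t = -J α f t := by
  simp only [J]; ring

lemma K_neg (α a b : ℝ) (f : ℝ → ℝ) (t : ℝ) : K α a b (fun s => -f s) t = -K α a b f t := by
  simp only [K]
  rw [← mul_neg, ← intervalIntegral.integral_neg]
  congr 2; ext τ; ring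

lemma gradient_neg {N : ℕ} (f : Space N → ℝ) (x : Space N) :
    gradient (fun y => -f y) x = -gradient f x := by
  simp only [gradient]
  rw [show (fun y => -f y) = -f from rfl, fderiv_neg, map_neg]

/-- Lets every statement about supersolutions be deduced from the one for subsolutions. -/
lemma TestsSuper.neg {N : ℕ} {α T : ℝ} {G : Space N → Space N → ℝ} {w : Space N → ℝ → ℝ}
    (hw : TestsSuper α T G w) : TestsSub α T (fun x p => -G x (-p)) (fun x t => -w x t) := by
  intro φ hφ x₁ t₁ ht₁ hmax
  have h := hw (fun x t => -φ x t) ⟨hφ.1.neg, hφ.2.neg⟩ x₁ t₁ ht₁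
    fun x t ht => by linarith [hmax x t ht]
  rw [J_neg, K_neg, gradient_neg (fun x => φ x t₁)] at h
  linarith

lemma hasGradientAt_norm_sub_sq {N : ℕ} (c x : Space N) :
    HasGradientAt (fun z => ‖z - c‖ ^ 2) ((2 : ℝ) • (x - c)) x := by
  rw [hasGradientAt_iff_hasFDerivAt]
  refine ((hasFDerivAt_id x).sub_const c).norm_sq.congr_fderiv ?_
  ext v
  simp

lemma HasGradientAt.add' {N : ℕ} {f g : Space N → ℝ} {a b x : Space N} (hf : HasGradientAt f a x)
    (hg : HasGradientAt g b x) : HasGradientAt (fun z => f z + g z) (a + b) x := by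
  rw [hasGradientAt_iff_hasFDerivAt] at *
  rw [map_add]
  exact hf.add hg

lemma HasGradientAt.const_mul' {N : ℕ} {f : Space N → ℝ} {a x : Space N} (c : ℝ)
    (hf : HasGradientAt f a x) : HasGradientAt (fun z => c * f z) (c • a) x := by
  rw [hasGradientAt_iff_hasFDerivAt] at *
  rw [map_smul]
  exact hf.const_mul c

/-! ### The solution itself in the Caputo derivative -/

/-- At a maximum point of `u - φ`, for a subsolution `u` and a test function `φ` with separated
variables, the test function may be replaced by `u` in the Caputo derivative. -/
lemma TestsSub.caputo_le {N : ℕ} {α T : ℝ} {F : Space N → Space N → ℝ} {u : Space N → ℝ → ℝ}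
    (hu : TestsSub α T F u) (hα : α ∈ Ioo (0 : ℝ) 1)
    (hcont : ContinuousOn (Function.uncurry u) (univ ×ˢ Icc 0 T))
    {ξ : Space N → ℝ} (hξ : ContDiff ℝ 1 ξ) {γ : ℝ → ℝ} (hγ : ContinuousOn γ (Icc 0 T))
    (hγ1 : ContDiffOn ℝ 1 γ (Ioc 0 T)) {x₁ : Space N} {t₁ : ℝ} (ht₁ : t₁ ∈ Ioc 0 T)
    (hmax : ∀ x, ∀ t ∈ Icc 0 T, u x t - ξ x - γ t ≤ u x₁ t₁ - ξ x₁ - γ t₁) :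
    KExists α 0 t₁ (u x₁) t₁ ∧
      J α (u x₁) t₁ + K α 0 t₁ (u x₁) t₁ + F x₁ (gradient ξ x₁) ≤ 0 := by
  have hT : 0 < T := ht₁.1.trans_le ht₁.2
  have hΓ : 0 < Real.Gamma (1 - α) := Real.Gamma_pos_of_pos (by linarith [hα.2])
  have hux : ContinuousOn (u x₁) (Icc 0 T) :=
    hcont.comp (f := fun t => (x₁, t)) (by fun_prop) fun t ht => ⟨mem_univ _, ht⟩
  -- Up to a constant `γ + f` is `u x₁`, while `f ≤ 0` and `f t₁ = 0`. The plan is to test with `γ +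
  -- h k`, where the smooth `h k` tend to `f` away from `t₁`.
  set f : ℝ → ℝ := fun t => u x₁ t - γ t - (u x₁ t₁ - γ t₁) with hf
  have hfc : ContinuousOn f (Icc 0 T) := (hux.sub hγ).sub continuousOn_const
  have hf0 : ∀ t ∈ Icc 0 T, f t ≤ 0 := fun t ht => by
    simp only [hf]; linarith [hmax x₁ t ht]
  obtain ⟨Mγ, hMγ⟩ := isCompact_Icc.exists_bound_of_continuousOn hγ
  set κ : ℕ → ℝ := fun k => (k : ℝ) + 1 with hκ
  have hκ0 : ∀ k, 0 < κ k := fun k => by positivity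
  set η : ℕ → ℝ := fun k => (κ k ^ 2)⁻¹ with hη
  have hη0 : ∀ k, 0 < η k := fun k => inv_pos.2 (pow_pos (hκ0 k) 2)
  have hκt : Tendsto κ atTop atTop := tendsto_natCast_atTop_atTop.atTop_add tendsto_const_nhds
  have hηt : Tendsto η atTop (𝓝 0) :=
    tendsto_inv_atTop_zero.comp ((tendsto_pow_atTop two_ne_zero).comp hκt)
  -- The shift by `2 * η k` places `p k` between `f + η k` and `f + 3 * η k`: above `f` with room
  -- for the error in `hA`, and at most `3 * η k`.
  have hp : ∀ k, ∃ p : Polynomial ℝ, ∀ t ∈ Icc 0 T, |p.eval t - (f t + 2 * η k)| < η k :=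
    fun k => exists_polynomial_near_of_continuousOn 0 T _ (hfc.add continuousOn_const) _ (hη0 k)
  choose p hp using hp
  have hA : ∀ k, ∃ A, 0 ≤ A ∧ ∀ x, ∀ t ∈ Icc 0 T,
      u x t - ξ x - A * ‖x - x₁‖ ^ 2 ≤ u x₁ t - ξ x₁ + η k := fun k => by
    refine exists_sub_sq_le (D := fun x t => u x t - ξ x) (B := u x₁ t₁ - ξ x₁ - γ t₁ + Mγ)
      ?_ ?_ (hη0 k)
    · exact hcont.sub ((hξ.continuous.comp continuous_fst).continuousOn)
    · intro x t ht
      have := (abs_le.1 (hMγ t ht)).2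
      linarith [hmax x t ht]
  choose A hA0 hA using hA
  -- The cutoff vanishes at `t₁`, so contact there is exact, and tends to `1` elsewhere. Since `η k
  -- = (κ k ^ 2)⁻¹`, its quadratic bound cancels `η k` and gives `h k t ≤ 3 * (t - t₁) ^ 2`
  -- uniformly in `k`.
  set χ : ℕ → ℝ → ℝ := fun k t => κ k ^ 2 * (t - t₁) ^ 2 / (1 + κ k ^ 2 * (t - t₁) ^ 2) with hχ
  have hden : ∀ k t, 0 < 1 + κ k ^ 2 * (t - t₁) ^ 2 := fun k t => by positivity
  have hχ0 : ∀ k t, 0 ≤ χ k t := fun k t => by positivity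
  have hχ1 : ∀ k t, χ k t ≤ 1 := fun k t => by
    rw [hχ, div_le_one (hden k t)]; linarith
  have hχ2 : ∀ k t, χ k t ≤ κ k ^ 2 * (t - t₁) ^ 2 := fun k t =>
    div_le_self (by positivity) (by have : 0 ≤ κ k ^ 2 * (t - t₁) ^ 2 := by positivity
                                    linarith)
  have hχt : ∀ t, t ≠ t₁ → Tendsto (fun k => χ k t) atTop (𝓝 1) := fun t ht => by
    have hpos : 0 < (t - t₁) ^ 2 := by have := sub_ne_zero.2 ht; positivity
    have h1 : Tendsto (fun k => 1 + κ k ^ 2 * (t - t₁) ^ 2) atTop atTop :=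
      tendsto_atTop_add_const_left _ _
        (((tendsto_pow_atTop two_ne_zero).comp hκt).atTop_mul_const hpos)
    have h2 : Tendsto (fun k => 1 - (1 + κ k ^ 2 * (t - t₁) ^ 2)⁻¹) atTop (𝓝 (1 - 0)) :=
      tendsto_const_nhds.sub (tendsto_inv_atTop_zero.comp h1)
    rw [sub_zero] at h2
    refine h2.congr fun k => ?_
    have := (hden k t).ne'
    simp only [hχ]
    field_simp
    ring
  set h : ℕ → ℝ → ℝ := fun k t => χ k t * (p k).eval t with hh
  have hht₁ : ∀ k, h k t₁ = 0 := fun k => by simp [hh, hχ]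
  have hhsm : ∀ k, ContDiff ℝ 1 (h k) := fun k => by
    refine ContDiff.mul (ContDiff.div ?_ ?_ fun t => (hden k t).ne') ?_
    · fun_prop
    · fun_prop
    · exact (p k).contDiff_aeval 1
  have hhlim : ∀ t ∈ Icc 0 T, t ≠ t₁ → Tendsto (fun k => h k t) atTop (𝓝 (f t)) :=
    fun t ht htt => by
    have h1 : Tendsto (fun k => (p k).eval t) atTop (𝓝 (f t)) := by
      rw [tendsto_iff_dist_tendsto_zero]
      have h3 : Tendsto (fun k => 3 * η k) atTop (𝓝 0) := by simpa using hηt.const_mul 3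
      refine squeeze_zero (fun _ => dist_nonneg) (fun k => ?_) h3
      have := abs_lt.1 (hp k t ht)
      rw [Real.dist_eq, abs_le]
      constructor <;> linarith [hη0 k, this.1, this.2]
    simpa using (hχt t htt).mul h1
  have hhlow : ∀ k, ∀ t ∈ Icc 0 T, h k t ≤ 3 * (t - t₁) ^ 2 := fun k t ht => by
    have h1 : (p k).eval t ≤ 3 * η k := by
      have := abs_lt.1 (hp k t ht); linarith [hf0 t ht, this.2]
    calc h k t ≤ χ k t * (3 * η k) := mul_le_mul_of_nonneg_left h1 (hχ0 k t)
      _ ≤ κ k ^ 2 * (t - t₁) ^ 2 * (3 * η k) :=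
          mul_le_mul_of_nonneg_right (hχ2 k t) (by linarith [hη0 k])
      _ = 3 * (t - t₁) ^ 2 := by
          have := (hκ0 k).ne'
          simp only [hη]; field_simp
  -- the viscosity inequalities
  set Γt : ℕ → ℝ → ℝ := fun k t => γ t + h k t with hΓt
  have hΓtc : ∀ k, ContinuousOn (Γt k) (Icc 0 T) := fun k =>
    hγ.add (hhsm k).continuous.continuousOn
  have hΓt1 : ∀ k, ContDiffOn ℝ 1 (Γt k) (Ioc 0 T) := fun k => hγ1.add (hhsm k).contDiffOn
  have hJshift : ∀ (c : ℝ) (g : ℝ → ℝ), J α (fun s => c + g s) t₁ = J α g t₁ := fun c g => by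
    simp only [J]; ring
  have hKshift : ∀ (c : ℝ) (g : ℝ → ℝ), K α 0 t₁ (fun s => c + g s) t₁ = K α 0 t₁ g t₁ :=
    fun c g => by
    simp only [K]
    congr 2; ext τ; congr 1; ring
  have hvisc : ∀ k, J α (Γt k) t₁ + K α 0 t₁ (Γt k) t₁ + F x₁ (gradient ξ x₁) ≤ 0 := fun k => by
    have hsp : ContDiff ℝ 1 (fun x : Space N => ξ x + A k * ‖x - x₁‖ ^ 2) :=
      hξ.add (contDiff_const.mul ((contDiff_id.sub contDiff_const).norm_sq ℝ))
    have key := hu (fun x t => (ξ x + A k * ‖x - x₁‖ ^ 2) + Γt k t) ⟨?_, ?_⟩ x₁ t₁ ht₁ ?_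
    · rw [hJshift, hKshift] at key
      have hg : gradient (fun x => ξ x + A k * ‖x - x₁‖ ^ 2 + Γt k t₁) x₁ = gradient ξ x₁ := by
        have h1 := HasGradientAt.add' ((hξ.differentiable (by norm_num)) x₁).hasGradientAt
          (HasGradientAt.const_mul' (A k) (hasGradientAt_norm_sub_sq x₁ x₁))
        have h2 := HasGradientAt.add' h1 (hasGradientAt_const x₁ (Γt k t₁))
        simpa using h2.gradient
      rwa [hg] at key
    · exact (hsp.comp contDiff_fst).contDiffOn.add
        ((hΓt1 k).comp contDiff_snd.contDiffOn fun z hz => hz.2)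
    · exact (hsp.continuous.comp continuous_fst).continuousOn.add
        ((hΓtc k).comp continuous_snd.continuousOn fun z hz => hz.2)
    · intro x t ht
      have e1 := hA k x t ht
      have e2 := hmax x t ht
      have e3 : 0 ≤ A k * ‖x - x₁‖ ^ 2 := mul_nonneg (hA0 k) (by positivity)
      -- Contact from above amounts to `m ≤ h k t`. As `m ≤ 0`, `m ≤ p k` and `0 ≤ χ k ≤ 1`, one has
      -- `m ≤ χ k * m ≤ χ k * p k`.
      set m := u x t - ξ x - A k * ‖x - x₁‖ ^ 2 - γ t - (u x₁ t₁ - ξ x₁ - γ t₁) with hm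
      have m0 : m ≤ 0 := by linarith
      have mf : m ≤ f t + η k := by simp only [hm, hf]; linarith
      have mp : m ≤ (p k).eval t := by
        have := (abs_lt.1 (hp k t ht)).1; linarith
      have mh : m ≤ h k t := by
        have h1 := mul_le_mul_of_nonneg_left mp (hχ0 k t)
        have h2 := mul_le_mul_of_nonpos_right (hχ1 k t) m0
        simp only [hh]; linarith
      simp only [hΓt, sub_self, norm_zero, hht₁]
      linarith
  -- passage to the limit
  obtain ⟨C, hC0, hC⟩ := exists_abs_sub_le_mul ht₁ hγ hγ1
  have hmem : ∀ τ ∈ Icc 0 t₁, t₁ - τ ∈ Icc 0 T := fun τ hτ =>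
    ⟨by linarith [hτ.2], by linarith [hτ.1, ht₁.2]⟩
  have hIoc : ∀ g : ℝ → ℝ, KExists α 0 t₁ g t₁ ↔ Integrable
      (fun τ => (g t₁ - g (t₁ - τ)) / τ ^ (α + 1)) (volume.restrict (Ioc 0 t₁)) := fun g => by
    rw [KExists, intervalIntegrable_iff_integrableOn_Ioc_of_le ht₁.1.le, IntegrableOn]
  have hKIoc : ∀ g : ℝ → ℝ, K α 0 t₁ g t₁ = α / Real.Gamma (1 - α) *
      ∫ τ in Ioc 0 t₁, (g t₁ - g (t₁ - τ)) / τ ^ (α + 1) := fun g => by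
    rw [K, intervalIntegral.integral_of_le ht₁.1.le]
  have hJlim : Tendsto (fun k => J α (Γt k) t₁) atTop (𝓝 (J α (u x₁) t₁)) := by
    have h0 := hhlim 0 ⟨le_rfl, hT.le⟩ ht₁.1.ne
    have h1 : Tendsto (fun k => (γ t₁ + 0 - (γ 0 + h k 0)) / (t₁ ^ α * Real.Gamma (1 - α))) atTop
        (𝓝 ((γ t₁ + 0 - (γ 0 + f 0)) / (t₁ ^ α * Real.Gamma (1 - α)))) :=
      ((tendsto_const_nhds.sub (tendsto_const_nhds.add h0))).div_const _
    convert h1 using 2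
    · simp only [J, hΓt, hht₁]
    · simp only [J, hf]; congr 1; ring
  -- The increments of `γ` are at least `-C * τ` and those of `h k` at least `-3 * τ ^ 2`, which
  -- gives the integrable minorant; the viscosity inequalities bound the integrals from above.
  have hfatou := integrable_and_integral_le_of_tendsto (μ := volume.restrict (Ioc 0 t₁))
    (f := fun k τ => (Γt k t₁ - Γt k (t₁ - τ)) / τ ^ (α + 1))
    (g := fun τ => (u x₁ t₁ - u x₁ (t₁ - τ)) / τ ^ (α + 1))
    (h := fun τ => (C + 3 * T) * τ ^ (-α))
    (c := fun k => (Real.Gamma (1 - α) / α) * -(J α (Γt k) t₁ + F x₁ (gradient ξ x₁)))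
    (C := (Real.Gamma (1 - α) / α) * -(J α (u x₁) t₁ + F x₁ (gradient ξ x₁)))
    (Eventually.of_forall fun k => ?_)
    ((integrableOn_rpow_neg hα.2 ht₁.1.le).const_mul _)
    (Eventually.of_forall fun k => (ae_restrict_iff' measurableSet_Ioc).2
      (Eventually.of_forall fun τ hτ => ?_))
    ((ae_restrict_iff' measurableSet_Ioc).2 (Eventually.of_forall fun τ hτ => ?_))
    (Eventually.of_forall fun k => ?_) ?_
  · refine ⟨(hIoc _).2 hfatou.1, ?_⟩
    rw [hKIoc]
    have h1 := mul_le_mul_of_nonneg_left hfatou.2 (div_pos hα.1 hΓ).le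
    have h2 : α / Real.Gamma (1 - α) * (Real.Gamma (1 - α) / α *
        -(J α (u x₁) t₁ + F x₁ (gradient ξ x₁))) = -(J α (u x₁) t₁ + F x₁ (gradient ξ x₁)) := by
      have := hα.1.ne'; have := hΓ.ne'; field_simp
    rw [h2] at h1
    linarith
  · obtain ⟨C', -, hC'⟩ := exists_abs_sub_le_mul ht₁ (hΓtc k) (hΓt1 k)
    exact (hIoc _).1 (KExists_of_abs_sub_le hα.2 ht₁.1.le
      ((hΓtc k).mono (Icc_subset_Icc le_rfl ht₁.2)) hC')
  · rw [← mul_div_rpow_add_one hτ.1, ← neg_div]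
    refine div_le_div_of_nonneg_right ?_ (Real.rpow_pos_of_pos hτ.1 _).le
    have e1 := (abs_le.1 (hC τ ⟨hτ.1.le, hτ.2⟩)).1
    have e2 := hhlow k (t₁ - τ) (hmem τ ⟨hτ.1.le, hτ.2⟩)
    have e3 : 3 * (t₁ - τ - t₁) ^ 2 ≤ 3 * T * τ := by nlinarith [hτ.1, hτ.2, ht₁.2]
    simp only [hΓt, hht₁]
    linarith
  · have h1 := hhlim (t₁ - τ) (hmem τ ⟨hτ.1.le, hτ.2⟩) (by linarith [hτ.1])
    have h2 : Tendsto (fun k => (γ t₁ + 0 - (γ (t₁ - τ) + h k (t₁ - τ))) / τ ^ (α + 1)) atTop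
        (𝓝 ((γ t₁ + 0 - (γ (t₁ - τ) + f (t₁ - τ))) / τ ^ (α + 1))) :=
      ((tendsto_const_nhds.sub (tendsto_const_nhds.add h1))).div_const _
    convert h2 using 2
    · simp only [hΓt, hht₁]
    · simp only [hf]; congr 1; ring
  · have h1 := hvisc k
    rw [hKIoc] at h1
    have h2 := mul_le_mul_of_nonneg_left
      (show α / Real.Gamma (1 - α) * ∫ τ in Ioc 0 t₁, (Γt k t₁ - Γt k (t₁ - τ)) / τ ^ (α + 1) ≤
        -(J α (Γt k) t₁ + F x₁ (gradient ξ x₁)) by linarith) (div_pos hΓ hα.1).le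
    refine le_trans (le_of_eq ?_) h2
    have := hα.1.ne'; have := hΓ.ne'; field_simp
  · exact ((hJlim.add_const _).neg).const_mul _

/-! ### Doubling of variables -/

/-- Points that almost maximize `A - n B` over a compact set concentrate, as `n → ∞`, at the only
maximum point of `A` on the zero set of `B`. -/
lemma tendsto_of_penalized {X : Type*} [TopologicalSpace X] {S : Set X} (hS : IsCompact S)
    {A B : X → ℝ} (hA : ContinuousOn A S) (hB : ContinuousOn B S) (hB0 : ∀ ξ ∈ S, 0 ≤ B ξ)
    {ξ₀ : X} (huniq : ∀ ξ ∈ S, B ξ = 0 → A ξ₀ ≤ A ξ → ξ = ξ₀)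
    {ξ : ℕ → X} (hξ : ∀ n, ξ n ∈ S) {κ : ℝ}
    (h : ∀ n : ℕ, A ξ₀ - κ * ((n : ℝ) + 1)⁻¹ ≤ A (ξ n) - ((n : ℝ) + 1) * B (ξ n)) :
    Tendsto ξ atTop (𝓝 ξ₀) := by
  -- By compactness it suffices to identify cluster points. At such a point `B` vanishes because it
  -- is at most a bounded quantity over `n + 1` along the sequence, and `A` is at least `A ξ₀`
  -- because the penalty may be dropped.
  refine hS.tendsto_nhds_of_unique_mapClusterPt (Eventually.of_forall hξ) fun y hy hcl => ?_
  obtain ⟨U, hU, hUy⟩ := mapClusterPt_iff_ultrafilter.1 hcl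
  have hUw : Tendsto ξ U (𝓝[S] y) :=
    tendsto_nhdsWithin_iff.2 ⟨hUy, Eventually.of_forall hξ⟩
  have hAy : Tendsto (fun n => A (ξ n)) U (𝓝 (A y)) := (hA y hy).tendsto.comp hUw
  have hBy : Tendsto (fun n => B (ξ n)) U (𝓝 (B y)) := (hB y hy).tendsto.comp hUw
  have hinv : Tendsto (fun n : ℕ => ((n : ℝ) + 1)⁻¹) U (𝓝 0) :=
    (tendsto_inv_atTop_zero.comp
      (tendsto_natCast_atTop_atTop.atTop_add tendsto_const_nhds)).mono_left hU
  have hpos : ∀ n : ℕ, 0 < (n : ℝ) + 1 := fun n => by positivity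
  have h1 : A ξ₀ - κ * 0 ≤ A y := by
    refine le_of_tendsto_of_tendsto' (tendsto_const_nhds.sub (hinv.const_mul κ)) hAy fun n => ?_
    have := mul_nonneg (hpos n).le (hB0 _ (hξ n))
    linarith [h n]
  have h2 : B y ≤ (A y - A ξ₀ + κ * 0) * 0 := by
    refine le_of_tendsto_of_tendsto' hBy
      (((hAy.sub_const (A ξ₀)).add (hinv.const_mul κ)).mul hinv) fun n => ?_
    rw [← div_eq_mul_inv, le_div_iff₀ (hpos n)]
    linarith [h n]
  exact huniq y hy (le_antisymm (by simpa using h2) (hB0 y hy)) (by simpa using h1)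

/-- A smooth approximation of the distance to `c`. -/
noncomputable def smoothDist {N : ℕ} (d : ℝ) (c x : Space N) : ℝ := √(‖x - c‖ ^ 2 + d ^ 2)

lemma norm_sub_le_smoothDist {N : ℕ} (d : ℝ) (c x : Space N) : ‖x - c‖ ≤ smoothDist d c x :=
  Real.le_sqrt_of_sq_le (by have := sq_nonneg d; linarith)

lemma smoothDist_self {N : ℕ} {d : ℝ} (hd : 0 ≤ d) (c : Space N) : smoothDist d c c = d := by
  simp [smoothDist, Real.sqrt_sq hd]

lemma smoothDist_pos {N : ℕ} {d : ℝ} (hd : 0 < d) (c x : Space N) : 0 < smoothDist d c x :=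
  Real.sqrt_pos.2 (by positivity)

lemma contDiff_smoothDist {N : ℕ} {d : ℝ} (hd : 0 < d) (c : Space N) :
    ContDiff ℝ 1 (smoothDist d c) :=
  (((contDiff_id.sub contDiff_const).norm_sq ℝ).add contDiff_const).sqrt
    fun x => (by positivity : (0 : ℝ) < ‖x - c‖ ^ 2 + d ^ 2).ne'

lemma hasGradientAt_smoothDist {N : ℕ} {d : ℝ} (hd : 0 < d) (c x : Space N) :
    HasGradientAt (smoothDist d c) ((smoothDist d c x)⁻¹ • (x - c)) x := by
  have h := hasGradientAt_norm_sub_sq c x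
  rw [hasGradientAt_iff_hasFDerivAt] at *
  have h2 := (h.add_const (d ^ 2)).sqrt
    (by positivity : (0 : ℝ) < ‖x - c‖ ^ 2 + d ^ 2).ne'
  refine h2.congr_fderiv ?_
  rw [← map_smul, smul_smul]
  congr 2
  have := (smoothDist_pos hd c x).ne'
  simp only [smoothDist] at this ⊢
  field_simp

lemma norm_inv_smoothDist_smul_le {N : ℕ} {d : ℝ} (hd : 0 < d) (c x : Space N) :
    ‖(smoothDist d c x)⁻¹ • (x - c)‖ ≤ 1 := by
  have h := smoothDist_pos hd c x
  rw [norm_smul, norm_inv, Real.norm_eq_abs, abs_of_pos h, inv_mul_le_one₀ h]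
  exact norm_sub_le_smoothDist d c x

/-- The function of the doubling of variables argument. -/
noncomputable def doubled {N : ℕ} (u w : Space N → ℝ → ℝ) (V : Space N → ℝ) (g : ℝ → ℝ) (κ a b : ℝ)
    (h x₀ y₀ : Space N) (t₀ n : ℝ) (x y z : Space N) (t s : ℝ) : ℝ :=
  u x t - w y s - V z - κ * smoothDist n⁻¹ (y + (x₀ - y₀)) x - a / 2 * ‖x - y - h‖ ^ 2
    - b / 2 * ‖y‖ ^ 2 - g t - n / 2 * ‖x - z‖ ^ 2 - n / 2 * (t - s) ^ 2
    - (‖x - x₀‖ ^ 2 + ‖y - y₀‖ ^ 2 + (t - t₀) ^ 2) / 2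

-- The last, quadratic term of `doubled` makes `(x₀, y₀, t₀)` the strict maximum of the undoubled
-- function and confines the competitors to a compact set; the penalties of weight `n` then force
-- the maximizers to converge to it. Replacing the norm by `smoothDist` only lowers the function,
-- and by no more than `κ / n` at the limit point.
set_option maxHeartbeats 1000000 in
lemma exists_doubled_maxima {N : ℕ} {T M κ a b t₀ : ℝ} {u w : Space N → ℝ → ℝ} {V : Space N → ℝ}
    {g : ℝ → ℝ} {h x₀ y₀ : Space N} (hκ : 0 ≤ κ) (ha : 0 ≤ a) (hb : 0 ≤ b)
    (hu : ContinuousOn (Function.uncurry u) (univ ×ˢ Icc 0 T))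
    (huM : ∀ x, ∀ t ∈ Icc 0 T, |u x t| ≤ M)
    (hw : ContinuousOn (Function.uncurry w) (univ ×ˢ Icc 0 T))
    (hwM : ∀ x, ∀ t ∈ Icc 0 T, |w x t| ≤ M)
    (hV : Continuous V) (hVM : ∀ x, |V x| ≤ M)
    (hg : ContinuousOn g (Icc 0 T)) (hgM : ∀ t ∈ Icc 0 T, |g t| ≤ M) (ht₀ : t₀ ∈ Icc 0 T)
    (hmax : ∀ x y, ∀ t ∈ Icc 0 T,
      u x t - w y t - V x - κ * ‖x - y - (x₀ - y₀)‖ - a / 2 * ‖x - y - h‖ ^ 2 - b / 2 * ‖y‖ ^ 2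
        - g t ≤ u x₀ t₀ - w y₀ t₀ - V x₀ - a / 2 * ‖x₀ - y₀ - h‖ ^ 2 - b / 2 * ‖y₀‖ ^ 2 - g t₀) :
    ∃ (x y z : ℕ → Space N) (t s : ℕ → ℝ), (∀ n, t n ∈ Icc 0 T) ∧ (∀ n, s n ∈ Icc 0 T) ∧
      Tendsto x atTop (𝓝 x₀) ∧ Tendsto y atTop (𝓝 y₀) ∧ Tendsto z atTop (𝓝 x₀) ∧
      Tendsto t atTop (𝓝 t₀) ∧ Tendsto s atTop (𝓝 t₀) ∧
      ∀ n : ℕ, ∀ x' y' z', ∀ t' ∈ Icc 0 T, ∀ s' ∈ Icc 0 T,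
        doubled u w V g κ a b h x₀ y₀ t₀ (n + 1) x' y' z' t' s' ≤
          doubled u w V g κ a b h x₀ y₀ t₀ (n + 1) (x n) (y n) (z n) (t n) (s n) := by
  have hpos : ∀ n : ℕ, 0 < (n : ℝ) + 1 := fun n => by positivity
  have hM0 : 0 ≤ M := (abs_nonneg _).trans (hVM x₀)
  -- Each of `u`, `w`, `V`, `g` varies by at most `2 * M`; the other terms are what the function
  -- loses at the base point `ξ₀`. Half the squared distances of a better competitor is thus at most
  -- `c₀`.
  set c₀ : ℝ := 8 * M + κ + a / 2 * ‖x₀ - y₀ - h‖ ^ 2 + b / 2 * ‖y₀‖ ^ 2 with hc₀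
  have hc₀0 : 0 ≤ c₀ := by positivity
  set ρ := √(2 * c₀) with hρ
  have hρ0 : 0 ≤ ρ := Real.sqrt_nonneg _
  have hρ2 : ρ ^ 2 = 2 * c₀ := Real.sq_sqrt (by positivity)
  set Z := Space N × Space N × Space N × ℝ × ℝ
  set S : Set Z := Metric.closedBall x₀ ρ ×ˢ Metric.closedBall y₀ ρ ×ˢ
    Metric.closedBall x₀ (2 * ρ) ×ˢ Icc 0 T ×ˢ Icc 0 T with hS
  have hSc : IsCompact S := (isCompact_closedBall _ _).prod ((isCompact_closedBall _ _).prod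
    ((isCompact_closedBall _ _).prod (isCompact_Icc.prod isCompact_Icc)))
  set ξ₀ : Z := (x₀, y₀, x₀, t₀, t₀) with hξ₀
  have hξ₀S : ξ₀ ∈ S := ⟨Metric.mem_closedBall_self hρ0, Metric.mem_closedBall_self hρ0,
    Metric.mem_closedBall_self (by linarith), ht₀, ht₀⟩
  set A : Z → ℝ := fun ξ => u ξ.1 ξ.2.2.2.1 - w ξ.2.1 ξ.2.2.2.2 - V ξ.2.2.1
    - κ * ‖ξ.1 - ξ.2.1 - (x₀ - y₀)‖ - a / 2 * ‖ξ.1 - ξ.2.1 - h‖ ^ 2 - b / 2 * ‖ξ.2.1‖ ^ 2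
    - g ξ.2.2.2.1 - (‖ξ.1 - x₀‖ ^ 2 + ‖ξ.2.1 - y₀‖ ^ 2 + (ξ.2.2.2.1 - t₀) ^ 2) / 2 with hA
  set B : Z → ℝ := fun ξ => ‖ξ.1 - ξ.2.2.1‖ ^ 2 / 2 + (ξ.2.2.2.1 - ξ.2.2.2.2) ^ 2 / 2 with hB
  set Ψ : ℕ → Z → ℝ := fun n ξ =>
    doubled u w V g κ a b h x₀ y₀ t₀ (n + 1) ξ.1 ξ.2.1 ξ.2.2.1 ξ.2.2.2.1 ξ.2.2.2.2 with hΨ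
  have huc : ContinuousOn (fun ξ : Z => u ξ.1 ξ.2.2.2.1) S :=
    hu.comp (f := fun ξ : Z => (ξ.1, ξ.2.2.2.1)) (by fun_prop)
      fun ξ hξ => ⟨mem_univ _, hξ.2.2.2.1⟩
  have hwc : ContinuousOn (fun ξ : Z => w ξ.2.1 ξ.2.2.2.2) S :=
    hw.comp (f := fun ξ : Z => (ξ.2.1, ξ.2.2.2.2)) (by fun_prop)
      fun ξ hξ => ⟨mem_univ _, hξ.2.2.2.2⟩
  have hgc : ContinuousOn (fun ξ : Z => g ξ.2.2.2.1) S :=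
    hg.comp (f := fun ξ : Z => ξ.2.2.2.1) (by fun_prop) fun ξ hξ => hξ.2.2.2.1
  have hVc : ContinuousOn (fun ξ : Z => V ξ.2.2.1) S :=
    (hV.comp (f := fun ξ : Z => ξ.2.2.1) (by fun_prop)).continuousOn
  have hAc : ContinuousOn A S := by
    refine ((((((huc.sub hwc).sub hVc).sub ?_).sub ?_).sub ?_).sub hgc).sub ?_ <;> fun_prop
  have hBc : ContinuousOn B S := by fun_prop
  have hΨc : ∀ n, ContinuousOn (Ψ n) S := fun n => by
    simp only [hΨ, doubled, smoothDist]
    refine ((((((((huc.sub hwc).sub hVc).sub ?_).sub ?_).sub ?_).sub hgc).sub ?_).sub ?_).sub ?_ <;>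
      fun_prop
  have hB0 : ∀ ξ, 0 ≤ B ξ := fun ξ => by positivity
  have hΨle : ∀ n ξ, Ψ n ξ ≤ A ξ - ((n : ℝ) + 1) * B ξ := fun n ξ => by
    have h1 := norm_sub_le_smoothDist ((n : ℝ) + 1)⁻¹ (ξ.2.1 + (x₀ - y₀)) ξ.1
    rw [← sub_sub] at h1
    have h2 := mul_le_mul_of_nonneg_left h1 hκ
    simp only [hΨ, doubled, hA, hB]
    linarith
  have hΨ₀ : ∀ n, Ψ n ξ₀ = A ξ₀ - κ * ((n : ℝ) + 1)⁻¹ := fun n => by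
    have h1 := smoothDist_self (inv_pos.2 (hpos n)).le x₀
    simp only [hΨ, doubled, hA, hξ₀, add_sub_cancel, h1, sub_self, norm_zero]
    ring
  have hA₀ : A ξ₀ = u x₀ t₀ - w y₀ t₀ - V x₀ - a / 2 * ‖x₀ - y₀ - h‖ ^ 2 - b / 2 * ‖y₀‖ ^ 2
      - g t₀ := by
    simp only [hA, hξ₀, sub_self, norm_zero]; ring
  -- Anything at least as good as `ξ₀` lies in `S`, so a maximum over `S` is global. The radius `2 *
  -- ρ` for `z` comes from `‖z - x‖ ≤ ρ` and `‖x - x₀‖ ≤ ρ`.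
  have hout : ∀ n (ξ : Z), ξ.2.2.2.1 ∈ Icc 0 T → ξ.2.2.2.2 ∈ Icc 0 T → Ψ n ξ₀ ≤ Ψ n ξ →
      ξ ∈ S := fun n ξ ht hs hle => by
    have e1 := abs_le.1 (huM x₀ t₀ ht₀)
    have e2 := abs_le.1 (hwM y₀ t₀ ht₀)
    have e3 := abs_le.1 (hVM x₀)
    have e4 := abs_le.1 (hgM t₀ ht₀)
    have f1 := abs_le.1 (huM ξ.1 _ ht)
    have f2 := abs_le.1 (hwM ξ.2.1 _ hs)
    have f3 := abs_le.1 (hVM ξ.2.2.1)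
    have f4 := abs_le.1 (hgM _ ht)
    have hn : ((n : ℝ) + 1)⁻¹ ≤ 1 := inv_le_one_of_one_le₀ (by linarith [n.cast_nonneg (α := ℝ)])
    have hn' : κ * ((n : ℝ) + 1)⁻¹ ≤ κ := mul_le_of_le_one_right hκ hn
    have h1 : Ψ n ξ₀ ≤ A ξ - ((n : ℝ) + 1) * B ξ := hle.trans (hΨle n ξ)
    rw [hΨ₀, hA₀] at h1
    have h2 : B ξ ≤ ((n : ℝ) + 1) * B ξ :=
      le_mul_of_one_le_left (hB0 ξ) (by linarith [n.cast_nonneg (α := ℝ)])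
    have g1 : 0 ≤ κ * ‖ξ.1 - ξ.2.1 - (x₀ - y₀)‖ := by positivity
    have g2 : 0 ≤ a / 2 * ‖ξ.1 - ξ.2.1 - h‖ ^ 2 := by positivity
    have g3 : 0 ≤ b / 2 * ‖ξ.2.1‖ ^ 2 := by positivity
    have g4 : 0 ≤ (ξ.2.2.2.1 - t₀) ^ 2 := by positivity
    have g5 : 0 ≤ (ξ.2.2.2.1 - ξ.2.2.2.2) ^ 2 := by positivity
    have h3 : ‖ξ.1 - x₀‖ ^ 2 + ‖ξ.2.1 - y₀‖ ^ 2 + ‖ξ.1 - ξ.2.2.1‖ ^ 2 ≤ ρ ^ 2 := by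
      rw [hρ2]
      simp only [hA, hB] at h1 h2
      linarith
    have k1 : ‖ξ.1 - x₀‖ ≤ ρ := by
      refine (sq_le_sq₀ (norm_nonneg _) hρ0).1 ?_
      linarith [sq_nonneg ‖ξ.2.1 - y₀‖, sq_nonneg ‖ξ.1 - ξ.2.2.1‖]
    have k2 : ‖ξ.2.1 - y₀‖ ≤ ρ := by
      refine (sq_le_sq₀ (norm_nonneg _) hρ0).1 ?_
      linarith [sq_nonneg ‖ξ.1 - x₀‖, sq_nonneg ‖ξ.1 - ξ.2.2.1‖]
    have k3 : ‖ξ.1 - ξ.2.2.1‖ ≤ ρ := by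
      refine (sq_le_sq₀ (norm_nonneg _) hρ0).1 ?_
      linarith [sq_nonneg ‖ξ.1 - x₀‖, sq_nonneg ‖ξ.2.1 - y₀‖]
    refine ⟨by rwa [Metric.mem_closedBall, dist_eq_norm], by
      rwa [Metric.mem_closedBall, dist_eq_norm], ?_, ht, hs⟩
    rw [Metric.mem_closedBall, dist_eq_norm]
    have := norm_sub_le_norm_sub_add_norm_sub ξ.2.2.1 ξ.1 x₀
    rw [norm_sub_rev ξ.2.2.1 ξ.1] at this
    linarith
  have hex : ∀ n, ∃ ξ ∈ S, IsMaxOn (Ψ n) S ξ := fun n =>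
    hSc.exists_isMaxOn ⟨ξ₀, hξ₀S⟩ (hΨc n)
  choose ξ hξS hξmax using hex
  have hlim : Tendsto ξ atTop (𝓝 ξ₀) := by
    refine tendsto_of_penalized hSc hAc hBc (fun ξ _ => hB0 ξ) ?_ hξS (κ := κ) fun n => ?_
    · rintro ⟨x, y, z, t, s⟩ hmem hBz hAle
      simp only [hB] at hBz
      have q1 : ‖x - z‖ ^ 2 = 0 := by
        linarith [sq_nonneg ‖x - z‖, sq_nonneg (t - s)]
      have q2 : (t - s) ^ 2 = 0 := by
        linarith [sq_nonneg ‖x - z‖, sq_nonneg (t - s)]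
      obtain rfl : x = z := sub_eq_zero.1 (norm_eq_zero.1 (pow_eq_zero_iff two_ne_zero |>.1 q1))
      obtain rfl : t = s := sub_eq_zero.1 (pow_eq_zero_iff two_ne_zero |>.1 q2)
      rw [hA₀] at hAle
      simp only [hA] at hAle
      have q3 := hmax x y t hmem.2.2.2.1
      have r1 : ‖x - x₀‖ ^ 2 = 0 := by
        linarith [sq_nonneg ‖x - x₀‖, sq_nonneg ‖y - y₀‖, sq_nonneg (t - t₀)]
      have r2 : ‖y - y₀‖ ^ 2 = 0 := by
        linarith [sq_nonneg ‖x - x₀‖, sq_nonneg ‖y - y₀‖, sq_nonneg (t - t₀)]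
      have r3 : (t - t₀) ^ 2 = 0 := by
        linarith [sq_nonneg ‖x - x₀‖, sq_nonneg ‖y - y₀‖, sq_nonneg (t - t₀)]
      rw [sub_eq_zero.1 (norm_eq_zero.1 (pow_eq_zero_iff two_ne_zero |>.1 r1)),
        sub_eq_zero.1 (norm_eq_zero.1 (pow_eq_zero_iff two_ne_zero |>.1 r2)),
        sub_eq_zero.1 (pow_eq_zero_iff two_ne_zero |>.1 r3)]
    · exact (hΨ₀ n).ge.trans ((isMaxOn_iff.1 (hξmax n) ξ₀ hξ₀S).trans (hΨle n (ξ n)))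
  refine ⟨fun n => (ξ n).1, fun n => (ξ n).2.1, fun n => (ξ n).2.2.1, fun n => (ξ n).2.2.2.1,
    fun n => (ξ n).2.2.2.2, fun n => (hξS n).2.2.2.1, fun n => (hξS n).2.2.2.2,
    (continuous_fst.tendsto _).comp hlim, ((continuous_fst.comp continuous_snd).tendsto _).comp hlim,
    ((continuous_fst.comp (continuous_snd.comp continuous_snd)).tendsto _).comp hlim,
    ((continuous_fst.comp (continuous_snd.comp (continuous_snd.comp continuous_snd))).tendsto _).comp
      hlim,
    ((continuous_snd.comp (continuous_snd.comp (continuous_snd.comp continuous_snd))).tendsto _).comp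
      hlim, fun n x' y' z' t' ht' s' hs' => ?_⟩
  by_cases hcase : Ψ n ξ₀ ≤ Ψ n (x', y', z', t', s')
  · exact isMaxOn_iff.1 (hξmax n) (x', y', z', t', s') (hout n (x', y', z', t', s') ht' hs' hcase)
  · exact (not_le.1 hcase).le.trans (isMaxOn_iff.1 (hξmax n) ξ₀ hξ₀S)

lemma tendsto_of_continuousOn_uncurry {N : ℕ} {T : ℝ} {u : Space N → ℝ → ℝ}
    (hu : ContinuousOn (Function.uncurry u) (univ ×ˢ Icc 0 T)) {x : ℕ → Space N} {t : ℕ → ℝ}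
    {x₀ : Space N} {t₀ : ℝ} (hx : Tendsto x atTop (𝓝 x₀)) (ht : Tendsto t atTop (𝓝 t₀))
    (hmem : ∀ᶠ n in atTop, t n ∈ Icc 0 T) (ht₀ : t₀ ∈ Icc 0 T) :
    Tendsto (fun n => u (x n) (t n)) atTop (𝓝 (u x₀ t₀)) :=
  ((hu (x₀, t₀) ⟨mem_univ _, ht₀⟩).tendsto).comp
    (tendsto_nhdsWithin_iff.2 ⟨hx.prodMk_nhds ht, hmem.mono fun _ h => ⟨mem_univ _, h⟩⟩)

lemma gradient_penalty_left {N : ℕ} {d : ℝ} (hd : 0 < d) (κ a b : ℝ) (c₁ c₂ c₃ c₄ x : Space N) :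
    gradient (fun x => κ * smoothDist d c₁ x + a / 2 * ‖x - c₂‖ ^ 2 + b / 2 * ‖x - c₃‖ ^ 2
      + 1 / 2 * ‖x - c₄‖ ^ 2) x =
    κ • ((smoothDist d c₁ x)⁻¹ • (x - c₁)) + a • (x - c₂) + b • (x - c₃) + (x - c₄) := by
  have h := HasGradientAt.add' (HasGradientAt.add' (HasGradientAt.add'
    (HasGradientAt.const_mul' κ (hasGradientAt_smoothDist hd c₁ x))
    (HasGradientAt.const_mul' (a / 2) (hasGradientAt_norm_sub_sq c₂ x)))
    (HasGradientAt.const_mul' (b / 2) (hasGradientAt_norm_sub_sq c₃ x)))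
    (HasGradientAt.const_mul' (1 / 2) (hasGradientAt_norm_sub_sq c₄ x))
  rw [h.gradient]
  simp only [smul_smul]
  rw [show a / 2 * 2 = a by ring, show b / 2 * 2 = b by ring, show (1 / 2 * 2 : ℝ) = 1 by norm_num,
    one_smul]

lemma contDiff_penalty {N : ℕ} {d : ℝ} (hd : 0 < d) (κ a b : ℝ) (c₁ c₂ c₃ c₄ : Space N) :
    ContDiff ℝ 1 (fun x => κ * smoothDist d c₁ x + a / 2 * ‖x - c₂‖ ^ 2 + b / 2 * ‖x - c₃‖ ^ 2
      + 1 / 2 * ‖x - c₄‖ ^ 2) := by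
  have h : ∀ c : Space N, ContDiff ℝ 1 (fun x => ‖x - c‖ ^ 2) := fun c =>
    (contDiff_id.sub contDiff_const).norm_sq ℝ
  exact (((contDiff_const.mul (contDiff_smoothDist hd c₁)).add (contDiff_const.mul (h c₂))).add
    (contDiff_const.mul (h c₃))).add (contDiff_const.mul (h c₄))

lemma penalty_continuousOn_contDiffOn {T : ℝ} {g : ℝ → ℝ} (hg : ContinuousOn g (Icc 0 T))
    (hg1 : ContDiffOn ℝ 1 g (Ioc 0 T)) (n s t₀ : ℝ) :
    ContinuousOn (fun t => g t + n / 2 * (t - s) ^ 2 + 1 / 2 * (t - t₀) ^ 2) (Icc 0 T) ∧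
    ContDiffOn ℝ 1 (fun t => g t + n / 2 * (t - s) ^ 2 + 1 / 2 * (t - t₀) ^ 2) (Ioc 0 T) := by
  constructor
  · exact (hg.add (by fun_prop)).add (by fun_prop)
  · refine (hg1.add (ContDiff.contDiffOn ?_)).add (ContDiff.contDiffOn ?_) <;> fun_prop

/-! ### Limit of the nonlocal terms and the inequality at a maximum -/

/-- The increments, as a function on `(0, ∞)`, whose integral defines `K`. -/
noncomputable def increment (α t : ℝ) (f : ℝ → ℝ) : ℝ → ℝ :=
  (Ioc 0 t).indicator fun τ => (f t - f (t - τ)) / τ ^ (α + 1)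

lemma integrable_increment_iff {α t T : ℝ} (ht : t ∈ Ioc 0 T) (f : ℝ → ℝ) :
    Integrable (increment α t f) (volume.restrict (Ioc 0 T)) ↔ KExists α 0 t f t := by
  rw [increment, integrable_indicator_iff measurableSet_Ioc, KExists,
    intervalIntegrable_iff_integrableOn_Ioc_of_le ht.1.le, IntegrableOn, IntegrableOn,
    Measure.restrict_restrict measurableSet_Ioc,
    inter_eq_self_of_subset_left (Ioc_subset_Ioc_right ht.2)]

lemma integral_increment {α t T : ℝ} (ht : t ∈ Ioc 0 T) (f : ℝ → ℝ) :
    α / Real.Gamma (1 - α) * ∫ τ in Ioc 0 T, increment α t f τ = K α 0 t f t := by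
  rw [increment, setIntegral_indicator measurableSet_Ioc,
    inter_eq_self_of_subset_right (Ioc_subset_Ioc_right ht.2), K,
    intervalIntegral.integral_of_le ht.1.le]

/-- The limit in the doubling of variables. -/
lemma caputo_sub_le {N : ℕ} {α T M B₀ C : ℝ} (hα : α ∈ Ioo (0 : ℝ) 1) {u w : Space N → ℝ → ℝ}
    (hu : ContinuousOn (Function.uncurry u) (univ ×ˢ Icc 0 T))
    (huM : ∀ x, ∀ t ∈ Icc 0 T, |u x t| ≤ M)
    (hw : ContinuousOn (Function.uncurry w) (univ ×ˢ Icc 0 T))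
    (hwM : ∀ x, ∀ t ∈ Icc 0 T, |w x t| ≤ M)
    {x y : ℕ → Space N} {t s : ℕ → ℝ} {x₀ y₀ : Space N} {t₀ : ℝ} (ht₀ : t₀ ∈ Ioc 0 T)
    (hx : Tendsto x atTop (𝓝 x₀)) (hy : Tendsto y atTop (𝓝 y₀))
    (ht : Tendsto t atTop (𝓝 t₀)) (hs : Tendsto s atTop (𝓝 t₀))
    (htm : ∀ n, t n ∈ Icc 0 T) (hsm : ∀ n, s n ∈ Icc 0 T) (hB₀ : 0 ≤ B₀)
    (hincr : ∀ n, ∀ τ, 0 ≤ τ → τ ≤ t n → τ ≤ s n →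
      -(B₀ * τ) ≤ u (x n) (t n) - u (x n) (t n - τ) - (w (y n) (s n) - w (y n) (s n - τ)))
    (hKu : ∀ᶠ n in atTop, KExists α 0 (t n) (u (x n)) (t n))
    (hKw : ∀ᶠ n in atTop, KExists α 0 (s n) (w (y n)) (s n))
    {c : ℕ → ℝ} (hle : ∀ᶠ n in atTop, J α (u (x n)) (t n) + K α 0 (t n) (u (x n)) (t n)
      - (J α (w (y n)) (s n) + K α 0 (s n) (w (y n)) (s n)) ≤ c n)
    (hc : Tendsto c atTop (𝓝 C)) :
    KExists α 0 t₀ (fun r => u x₀ r - w y₀ r) t₀ ∧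
      J α (u x₀) t₀ - J α (w y₀) t₀ + K α 0 t₀ (fun r => u x₀ r - w y₀ r) t₀ ≤ C := by
  have hΓ : 0 < Real.Gamma (1 - α) := Real.Gamma_pos_of_pos (by linarith [hα.2])
  have ht₀' : t₀ ∈ Icc 0 T := ⟨ht₀.1.le, ht₀.2⟩
  have hM0 : 0 ≤ M := (abs_nonneg _).trans (huM x₀ t₀ ht₀')
  have h0T : (0 : ℝ) ∈ Icc 0 T := ⟨le_rfl, ht₀.1.le.trans ht₀.2⟩
  have htp : ∀ᶠ n in atTop, t₀ / 2 < t n := ht.eventually (lt_mem_nhds (by linarith [ht₀.1]))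
  have hsp : ∀ᶠ n in atTop, t₀ / 2 < s n := hs.eventually (lt_mem_nhds (by linarith [ht₀.1]))
  have htI : ∀ᶠ n in atTop, t n ∈ Ioc 0 T := htp.mono fun n h => ⟨by linarith [ht₀.1], (htm n).2⟩
  have hsI : ∀ᶠ n in atTop, s n ∈ Ioc 0 T := hsp.mono fun n h => ⟨by linarith [ht₀.1], (hsm n).2⟩
  have hJ : ∀ {f : Space N → ℝ → ℝ} {z : ℕ → Space N} {z₀ : Space N} {r : ℕ → ℝ},
      ContinuousOn (Function.uncurry f) (univ ×ˢ Icc 0 T) → Tendsto z atTop (𝓝 z₀) →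
      Tendsto r atTop (𝓝 t₀) → (∀ n, r n ∈ Icc 0 T) →
      Tendsto (fun n => J α (f (z n)) (r n)) atTop (𝓝 (J α (f z₀) t₀)) :=
    fun {f z z₀ r} hf hz hr hm => by
    have h1 := tendsto_of_continuousOn_uncurry hf hz hr (Eventually.of_forall hm) ht₀'
    have h2 := tendsto_of_continuousOn_uncurry hf hz (tendsto_const_nhds (x := (0 : ℝ)))
      (Eventually.of_forall fun _ => h0T) h0T
    have h3 : Tendsto (fun n => r n ^ α * Real.Gamma (1 - α)) atTop
        (𝓝 (t₀ ^ α * Real.Gamma (1 - α))) :=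
      (hr.rpow_const (Or.inl ht₀.1.ne')).mul_const _
    have h4 : t₀ ^ α * Real.Gamma (1 - α) ≠ 0 := (mul_pos (Real.rpow_pos_of_pos ht₀.1 _) hΓ).ne'
    exact (h1.sub h2).div h3 h4
  have hJlim := (hJ hu hx ht htm).sub (hJ hw hy hs hsm)
  have hlim1 : ∀ {f : Space N → ℝ → ℝ} {z : ℕ → Space N} {z₀ : Space N} {r : ℕ → ℝ},
      ContinuousOn (Function.uncurry f) (univ ×ˢ Icc 0 T) → Tendsto z atTop (𝓝 z₀) →
      Tendsto r atTop (𝓝 t₀) → (∀ n, r n ∈ Icc 0 T) → ∀ τ : ℝ, 0 < τ → τ ≠ t₀ →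
      Tendsto (fun n => increment α (r n) (f (z n)) τ) atTop (𝓝 (increment α t₀ (f z₀) τ)) :=
    fun {f z z₀ r} hf hz hr hm τ hτ hτt => by
    rcases lt_or_gt_of_ne hτt with h | h
    · have hev : ∀ᶠ n in atTop, τ < r n := hr.eventually (lt_mem_nhds h)
      have h1 := tendsto_of_continuousOn_uncurry hf hz hr (Eventually.of_forall hm) ht₀'
      have h2 := tendsto_of_continuousOn_uncurry hf hz (hr.sub_const τ)
        (hev.mono fun n hn => ⟨by linarith, by linarith [(hm n).2]⟩)
        ⟨by linarith, by linarith [ht₀.2]⟩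
      have h3 := (h1.sub h2).div_const (τ ^ (α + 1))
      have e0 : increment α t₀ (f z₀) τ = (f z₀ t₀ - f z₀ (t₀ - τ)) / τ ^ (α + 1) :=
        indicator_of_mem (show τ ∈ Ioc 0 t₀ from ⟨hτ, h.le⟩) _
      rw [e0]
      refine h3.congr' (hev.mono fun n hn => ?_)
      have e1 : increment α (r n) (f (z n)) τ =
          (f (z n) (r n) - f (z n) (r n - τ)) / τ ^ (α + 1) :=
        indicator_of_mem (show τ ∈ Ioc 0 (r n) from ⟨hτ, hn.le⟩) _
      exact e1.symm
    · have hev : ∀ᶠ n in atTop, r n < τ := hr.eventually (gt_mem_nhds h)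
      have e0 : increment α t₀ (f z₀) τ = 0 :=
        indicator_of_notMem (fun hmem => absurd hmem.2 (not_le.2 h)) _
      rw [e0]
      refine tendsto_const_nhds.congr' (hev.mono fun n hn => ?_)
      have e1 : increment α (r n) (f (z n)) τ = 0 :=
        indicator_of_notMem (fun hmem => absurd hmem.2 (not_le.2 hn)) _
      exact e1.symm
  -- For `τ` below both times `hincr` gives the minorant. If `τ` lies between `t n` and `s n`, only
  -- one increment is left; it is bounded by `2 * M`, hence by `4 * M / t₀ * τ`, since there `τ > t₀
  -- / 2`.
  have hfatou := integrable_and_integral_le_of_tendsto (μ := volume.restrict (Ioc 0 T))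
    (f := fun n τ => increment α (t n) (u (x n)) τ - increment α (s n) (w (y n)) τ)
    (g := fun τ => increment α t₀ (u x₀) τ - increment α t₀ (w y₀) τ)
    (h := fun τ => (B₀ + 4 * M / t₀) * τ ^ (-α))
    (c := fun n => (Real.Gamma (1 - α) / α) *
      (c n - (J α (u (x n)) (t n) - J α (w (y n)) (s n))))
    (C := (Real.Gamma (1 - α) / α) * (C - (J α (u x₀) t₀ - J α (w y₀) t₀)))
    ?_ ((integrableOn_rpow_neg hα.2 h0T.2).const_mul _) ?_ ?_ ?_ ((hc.sub hJlim).const_mul _)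
  · have hinc : (fun τ => increment α t₀ (u x₀) τ - increment α t₀ (w y₀) τ) =
        increment α t₀ (fun r => u x₀ r - w y₀ r) := by
      ext τ
      simp only [increment, indicator]
      split_ifs
      · ring
      · ring
    rw [hinc] at hfatou
    refine ⟨(integrable_increment_iff ht₀ _).1 hfatou.1, ?_⟩
    rw [← integral_increment ht₀]
    have h1 := mul_le_mul_of_nonneg_left hfatou.2 (div_pos hα.1 hΓ).le
    have h2 : ∀ X, α / Real.Gamma (1 - α) * (Real.Gamma (1 - α) / α * X) = X := fun X => by
      have := hα.1.ne'; have := hΓ.ne'; field_simp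
    rw [h2] at h1
    linarith
  · filter_upwards [hKu, hKw, htI, hsI] with n h1 h2 h3 h4
    exact ((integrable_increment_iff h3 _).2 h1).sub ((integrable_increment_iff h4 _).2 h2)
  · filter_upwards [htp, hsp] with n h1 h2
    refine (ae_restrict_iff' measurableSet_Ioc).2 (Eventually.of_forall fun τ hτ => ?_)
    have hτp := Real.rpow_pos_of_pos hτ.1 (α + 1)
    rw [← mul_div_rpow_add_one hτ.1, ← neg_div]
    have e0 : 0 ≤ 4 * M / t₀ * τ := by have := ht₀.1; have := hτ.1; positivity
    have e1 : 0 ≤ B₀ * τ := mul_nonneg hB₀ hτ.1.le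
    have ebig : t₀ / 2 < τ → 2 * M ≤ 4 * M / t₀ * τ := fun h => by
      rw [div_mul_eq_mul_div, le_div_iff₀ ht₀.1]
      have := mul_le_mul_of_nonneg_left h.le hM0
      linarith
    by_cases k1 : τ ≤ t n
    · by_cases k2 : τ ≤ s n
      · rw [increment, increment, indicator_of_mem (show τ ∈ Ioc 0 (t n) from ⟨hτ.1, k1⟩),
          indicator_of_mem (show τ ∈ Ioc 0 (s n) from ⟨hτ.1, k2⟩), ← sub_div]
        refine div_le_div_of_nonneg_right ?_ hτp.le
        linarith [hincr n τ hτ.1.le k1 k2]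
      · rw [increment, increment, indicator_of_mem (show τ ∈ Ioc 0 (t n) from ⟨hτ.1, k1⟩),
          indicator_of_notMem (fun hmem => k2 hmem.2), sub_zero]
        refine div_le_div_of_nonneg_right ?_ hτp.le
        have f1 := abs_le.1 (huM (x n) (t n) (htm n))
        have f2 := abs_le.1 (huM (x n) (t n - τ) ⟨by linarith, by linarith [hτ.1, (htm n).2]⟩)
        linarith [ebig (by linarith [not_le.1 k2]), f1.1, f2.2]
    · by_cases k2 : τ ≤ s n
      · rw [increment, increment, indicator_of_notMem (fun hmem => k1 hmem.2),
          indicator_of_mem (show τ ∈ Ioc 0 (s n) from ⟨hτ.1, k2⟩), zero_sub, ← neg_div]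
        refine div_le_div_of_nonneg_right ?_ hτp.le
        have f1 := abs_le.1 (hwM (y n) (s n) (hsm n))
        have f2 := abs_le.1 (hwM (y n) (s n - τ) ⟨by linarith, by linarith [hτ.1, (hsm n).2]⟩)
        linarith [ebig (by linarith [not_le.1 k1]), f1.2, f2.1]
      · rw [increment, increment, indicator_of_notMem (fun hmem => k1 hmem.2),
          indicator_of_notMem (fun hmem => k2 hmem.2), sub_zero]
        exact div_nonpos_of_nonpos_of_nonneg (by linarith) hτp.le
  -- The indicators of `(0, t n]` and `(0, s n]` need not converge at the endpoint `t₀`, a null set.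
  · have hne : ∀ᵐ τ ∂(volume.restrict (Ioc 0 T)), τ ≠ t₀ :=
      ae_restrict_of_ae (Measure.ae_ne volume t₀)
    filter_upwards [hne, ae_restrict_mem measurableSet_Ioc] with τ h1 h2
    exact (hlim1 hu hx ht htm τ h2.1 h1).sub (hlim1 hw hy hs hsm τ h2.1 h1)
  · filter_upwards [hKu, hKw, htI, hsI, hle] with n h1 h2 h3 h4 h5
    rw [integral_sub ((integrable_increment_iff h3 _).2 h1) ((integrable_increment_iff h4 _).2 h2)]
    rw [← integral_increment h3, ← integral_increment h4] at h5
    set I₁ := ∫ τ in Ioc 0 T, increment α (t n) (u (x n)) τ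
    set I₂ := ∫ τ in Ioc 0 T, increment α (s n) (w (y n)) τ
    have h6 : α / Real.Gamma (1 - α) * (I₁ - I₂) ≤
        c n - (J α (u (x n)) (t n) - J α (w (y n)) (s n)) := by linarith
    have h7 := mul_le_mul_of_nonneg_left h6 (div_pos hΓ hα.1).le
    refine le_trans (le_of_eq ?_) h7
    have := hα.1.ne'; have := hΓ.ne'; field_simp

/-- The difference of a subsolution and a supersolution at a maximum point of
`u(x, t) - w(y, t) - V(x) - κ |x - y - (x₀ - y₀)| - a |x - y - h|² / 2 - b |y|² / 2 - g(t)`. -/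
theorem caputo_sub_le_of_max {N : ℕ} {α T M κ a b m B₁ B₂ t₀ : ℝ} (hα : α ∈ Ioo (0 : ℝ) 1)
    {u w : Space N → ℝ → ℝ} {V : Space N → ℝ} {g : ℝ → ℝ} {h x₀ y₀ : Space N}
    {F G : Space N → Space N → ℝ} (hκ : 0 ≤ κ) (ha : 0 ≤ a) (hb : 0 ≤ b) (hB₂ : 0 ≤ B₂)
    (hu : ContinuousOn (Function.uncurry u) (univ ×ˢ Icc 0 T))
    (huM : ∀ x, ∀ t ∈ Icc 0 T, |u x t| ≤ M)
    (hw : ContinuousOn (Function.uncurry w) (univ ×ˢ Icc 0 T))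
    (hwM : ∀ x, ∀ t ∈ Icc 0 T, |w x t| ≤ M)
    (hV : Continuous V) (hVM : ∀ x, |V x| ≤ M)
    (hg : ContinuousOn g (Icc 0 T)) (hg1 : ContDiffOn ℝ 1 g (Ioc 0 T))
    (hgmono : MonotoneOn g (Icc 0 T)) (hgM : ∀ t ∈ Icc 0 T, |g t| ≤ M)
    (hsub : TestsSub α T F u) (hsup : TestsSuper α T G w) (ht₀ : t₀ ∈ Ioc 0 T)
    (hmax : ∀ x y, ∀ t ∈ Icc 0 T,
      u x t - w y t - V x - κ * ‖x - y - (x₀ - y₀)‖ - a / 2 * ‖x - y - h‖ ^ 2 - b / 2 * ‖y‖ ^ 2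
        - g t ≤ u x₀ t₀ - w y₀ t₀ - V x₀ - a / 2 * ‖x₀ - y₀ - h‖ ^ 2 - b / 2 * ‖y₀‖ ^ 2 - g t₀)
    (hFG : ∀ c > 0, ∀ x y z p p', (∀ z', V z + c / 2 * ‖x - z‖ ^ 2 ≤ V z' + c / 2 * ‖x - z'‖ ^ 2) →
      G y p' - F x (c • (x - z) + p) ≤ m + B₁ * (‖x - x₀‖ + ‖y - y₀‖ + ‖z - x₀‖)
        + B₂ * (‖p - a • (x₀ - y₀ - h)‖ + ‖p' - (a • (x₀ - y₀ - h) - b • y₀)‖)) :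
    KExists α 0 t₀ (fun r => u x₀ r - w y₀ r) t₀ ∧
      J α (u x₀) t₀ - J α (w y₀) t₀ + K α 0 t₀ (fun r => u x₀ r - w y₀ r) t₀
        ≤ m + 2 * B₂ * κ := by
  have ht₀' : t₀ ∈ Icc 0 T := ⟨ht₀.1.le, ht₀.2⟩
  have hT : 0 < T := ht₀.1.trans_le ht₀.2
  obtain ⟨x, y, z, t, s, htm, hsm, hx, hy, hz, ht, hs, hΨ⟩ :=
    exists_doubled_maxima hκ ha hb hu huM hw hwM hV hVM hg hgM ht₀' hmax
  have hpos : ∀ n : ℕ, 0 < (n : ℝ) + 1 := fun n => by positivity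
  have htI : ∀ᶠ n in atTop, t n ∈ Ioc 0 T :=
    (ht.eventually (lt_mem_nhds ht₀.1)).mono fun n h => ⟨h, (htm n).2⟩
  have hsI : ∀ᶠ n in atTop, s n ∈ Ioc 0 T :=
    (hs.eventually (lt_mem_nhds ht₀.1)).mono fun n h => ⟨h, (hsm n).2⟩
  set P := a • (x₀ - y₀ - h) with hP
  have hsubn : ∀ n, t n ∈ Ioc 0 T → KExists α 0 (t n) (u (x n)) (t n) ∧
      J α (u (x n)) (t n) + K α 0 (t n) (u (x n)) (t n) + F (x n) (((n : ℝ) + 1) • (x n - z n) +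
        (κ • ((smoothDist ((n : ℝ) + 1)⁻¹ (y n + (x₀ - y₀)) (x n))⁻¹ • (x n - (y n + (x₀ - y₀))))
          + a • (x n - y n - h) + (x n - x₀))) ≤ 0 := fun n htn => by
    have htest := penalty_continuousOn_contDiffOn hg hg1 ((n : ℝ) + 1) (s n) t₀
    have key := hsub.caputo_le hα hu (contDiff_penalty (inv_pos.2 (hpos n)) κ a ((n : ℝ) + 1)
      (y n + (x₀ - y₀)) (y n + h) (z n) x₀) htest.1 htest.2 (x₁ := x n) htn ?_
    · rw [gradient_penalty_left (inv_pos.2 (hpos n))] at key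
      refine ⟨key.1, ?_⟩
      convert key.2 using 3
      rw [sub_sub (x n) (y n) h]
      abel
    · intro x' t' ht'
      have := hΨ n x' (y n) (z n) t' ht' (s n) (hsm n)
      simp only [doubled, sub_sub _ (y n) h] at this
      linarith
  have hsupn : ∀ n, s n ∈ Ioc 0 T → KExists α 0 (s n) (w (y n)) (s n) ∧
      0 ≤ J α (w (y n)) (s n) + K α 0 (s n) (w (y n)) (s n) + G (y n)
        (κ • ((smoothDist ((n : ℝ) + 1)⁻¹ (y n + (x₀ - y₀)) (x n))⁻¹ • (x n - (y n + (x₀ - y₀))))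
          + a • (x n - y n - h) - b • y n - (y n - y₀)) := fun n hsn => by
    -- The cone and the quadratic term are reread as functions of `y`, centred at `x n - (x₀ - y₀)`
    -- and `x n - h`.
    have hrev : ∀ y', smoothDist ((n : ℝ) + 1)⁻¹ (x n - (x₀ - y₀)) y' =
        smoothDist ((n : ℝ) + 1)⁻¹ (y' + (x₀ - y₀)) (x n) := fun y' => by
      simp only [smoothDist]
      rw [norm_sub_rev, show x n - (x₀ - y₀) - y' = x n - (y' + (x₀ - y₀)) by abel]
    have hrev2 : ∀ y', ‖y' - (x n - h)‖ = ‖x n - y' - h‖ := fun y' => by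
      rw [norm_sub_rev, show x n - h - y' = x n - y' - h by abel]
    have htest := penalty_continuousOn_contDiffOn (T := T) (g := fun _ => (0 : ℝ)) continuousOn_const contDiffOn_const
      ((n : ℝ) + 1) (t n) (s n)
    have htest' : ContinuousOn (fun r : ℝ => ((n : ℝ) + 1) / 2 * (t n - r) ^ 2) (Icc 0 T) := by
      fun_prop
    have htest'' : ContDiffOn ℝ 1 (fun r : ℝ => ((n : ℝ) + 1) / 2 * (t n - r) ^ 2) (Ioc 0 T) :=
      ContDiff.contDiffOn (by fun_prop)
    have key := hsup.neg.caputo_le hα hw.neg (contDiff_penalty (inv_pos.2 (hpos n)) κ a b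
      (x n - (x₀ - y₀)) (x n - h) 0 y₀) htest' htest'' (x₁ := y n) hsn ?_
    · rw [gradient_penalty_left (inv_pos.2 (hpos n)), J_neg, K_neg] at key
      refine ⟨?_, ?_⟩
      · have := IntervalIntegrable.neg key.1
        refine this.congr (fun τ _ => ?_)
        simp only [Pi.neg_apply]; ring
      · have e : -(κ • ((smoothDist ((n : ℝ) + 1)⁻¹ (x n - (x₀ - y₀)) (y n))⁻¹ •
            (y n - (x n - (x₀ - y₀)))) + a • (y n - (x n - h)) + b • (y n - 0) + (y n - y₀)) =
            κ • ((smoothDist ((n : ℝ) + 1)⁻¹ (y n + (x₀ - y₀)) (x n))⁻¹ •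
              (x n - (y n + (x₀ - y₀)))) + a • (x n - y n - h) - b • y n - (y n - y₀) := by
          rw [hrev]
          module
        have h2 := key.2
        rw [e] at h2
        linarith
    · intro y' s' hs'
      have := hΨ n (x n) y' (z n) (t n) (htm n) s' hs'
      simp only [doubled, hrev, hrev2, sub_zero] at this ⊢
      linarith
  -- Only `z` varies here: this is the condition under which `hFG` may be used.
  have hV' : ∀ n z', V (z n) + ((n : ℝ) + 1) / 2 * ‖x n - z n‖ ^ 2 ≤
      V z' + ((n : ℝ) + 1) / 2 * ‖x n - z'‖ ^ 2 := fun n z' => by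
    have := hΨ n (x n) (y n) z' (t n) (htm n) (s n) (hsm n)
    simp only [doubled] at this
    linarith
  refine caputo_sub_le hα hu huM hw hwM ht₀ hx hy ht hs htm hsm (B₀ := 2 * T) (by linarith)
    (fun n τ h0 h1 h2 => ?_) (htI.mono fun n h => (hsubn n h).1)
    (hsI.mono fun n h => (hsupn n h).1)
    (c := fun n => m + B₁ * (‖x n - x₀‖ + ‖y n - y₀‖ + ‖z n - x₀‖)
      + B₂ * ((κ + a * ‖x n - y n - (x₀ - y₀)‖ + ‖x n - x₀‖)
        + (κ + a * ‖x n - y n - (x₀ - y₀)‖ + b * ‖y n - y₀‖ + ‖y n - y₀‖))) ?_ ?_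
  -- Moving `t` and `s` back by the same `τ` changes neither `t - s` nor the space terms. The
  -- increment of `g` has the favourable sign by monotonicity, and the term `(t - t₀) ^ 2 / 2` costs
  -- at most `3 / 2 * T * τ`.
  · have ht' : t n - τ ∈ Icc 0 T := ⟨by linarith, by linarith [(htm n).2]⟩
    have hs' : s n - τ ∈ Icc 0 T := ⟨by linarith, by linarith [(hsm n).2]⟩
    have key := hΨ n (x n) (y n) (z n) (t n - τ) ht' (s n - τ) hs'
    have hgm := hgmono ht' (htm n) (by linarith)
    simp only [doubled, sub_sub_sub_cancel_right] at key
    have e1 : (t n - τ - t₀) ^ 2 = (t n - t₀) ^ 2 - 2 * τ * (t n - t₀) + τ ^ 2 := by ring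
    have e2 : -(τ * T) ≤ τ * (t n - t₀) := by
      have := mul_le_mul_of_nonneg_left (show -T ≤ t n - t₀ by linarith [(htm n).1, ht₀.2]) h0
      linarith
    have e3 : τ ^ 2 ≤ τ * T := by
      rw [sq]; exact mul_le_mul_of_nonneg_left (by linarith [(htm n).2]) h0
    have e4 : 0 ≤ τ * T := mul_nonneg h0 hT.le
    rw [e1] at key
    linarith
  · filter_upwards [htI, hsI] with n h1 h2
    have k1 := (hsubn n h1).2
    have k2 := (hsupn n h2).2
    set e := (smoothDist ((n : ℝ) + 1)⁻¹ (y n + (x₀ - y₀)) (x n))⁻¹ • (x n - (y n + (x₀ - y₀)))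
      with he
    have he1 : ‖κ • e‖ ≤ κ := by
      rw [norm_smul, Real.norm_eq_abs, abs_of_nonneg hκ]
      exact mul_le_of_le_one_right hκ (norm_inv_smoothDist_smul_le (inv_pos.2 (hpos n)) _ _)
    have hna : ∀ q : Space N, ‖a • q‖ = a * ‖q‖ := fun q => by
      rw [norm_smul, Real.norm_eq_abs, abs_of_nonneg ha]
    have hnb : ∀ q : Space N, ‖b • q‖ = b * ‖q‖ := fun q => by
      rw [norm_smul, Real.norm_eq_abs, abs_of_nonneg hb]
    have k3 := hFG ((n : ℝ) + 1) (hpos n) (x n) (y n) (z n)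
      (κ • e + a • (x n - y n - h) + (x n - x₀))
      (κ • e + a • (x n - y n - h) - b • y n - (y n - y₀)) (hV' n)
    -- The cone contributes a vector of length at most `κ` to each of the two gradients. This does
    -- not vanish in the limit and produces `2 * B₂ * κ`.
    have k4 : ‖κ • e + a • (x n - y n - h) + (x n - x₀) - P‖ ≤
        κ + a * ‖x n - y n - (x₀ - y₀)‖ + ‖x n - x₀‖ := by
      rw [show κ • e + a • (x n - y n - h) + (x n - x₀) - P =
        κ • e + a • (x n - y n - (x₀ - y₀)) + (x n - x₀) by rw [hP]; module, ← hna]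
      exact norm_add₃_le.trans (by linarith)
    have k5 : ‖κ • e + a • (x n - y n - h) - b • y n - (y n - y₀) - (P - b • y₀)‖ ≤
        κ + a * ‖x n - y n - (x₀ - y₀)‖ + b * ‖y n - y₀‖ + ‖y n - y₀‖ := by
      rw [show κ • e + a • (x n - y n - h) - b • y n - (y n - y₀) - (P - b • y₀) =
        κ • e + a • (x n - y n - (x₀ - y₀)) + (-(b • (y n - y₀)) + -(y n - y₀)) by
          rw [hP]; module, ← hna, ← hnb]
      refine norm_add₃_le.trans ?_
      have := norm_add_le (-(b • (y n - y₀))) (-(y n - y₀))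
      rw [norm_neg, norm_neg] at this
      linarith
    have k6 := mul_le_mul_of_nonneg_left (add_le_add k4 k5) hB₂
    linarith
  · have e1 : Tendsto (fun n => ‖x n - x₀‖) atTop (𝓝 0) := by
      simpa using (hx.sub_const x₀).norm
    have e2 : Tendsto (fun n => ‖y n - y₀‖) atTop (𝓝 0) := by
      simpa using (hy.sub_const y₀).norm
    have e3 : Tendsto (fun n => ‖z n - x₀‖) atTop (𝓝 0) := by
      simpa using (hz.sub_const x₀).norm
    have e4 : Tendsto (fun n => ‖x n - y n - (x₀ - y₀)‖) atTop (𝓝 0) := by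
      simpa using ((hx.sub hy).sub_const (x₀ - y₀)).norm
    have := (((e1.add e2).add e3).const_mul B₁).const_add m |>.add
      (((((e4.const_mul a).const_add κ).add e1).add
        ((((e4.const_mul a).const_add κ).add (e2.const_mul b)).add e2)).const_mul B₂)
    convert this using 2
    ring

/-! ### Comparison and a priori bounds for the time-fractional problem -/

/-- A value no smaller than the one at `(h, 0, 0)` forces the penalties to be at most `4 * M`. This
gives both bounds and compactness of the set of competitors. -/
lemma exists_max_quadratic {N : ℕ} {T M a b : ℝ} (hT : 0 ≤ T) (ha : 0 < a) (hb : 0 < b)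
    {u w : Space N → ℝ → ℝ} (h : Space N)
    (hu : ContinuousOn (Function.uncurry u) (univ ×ˢ Icc 0 T))
    (huM : ∀ x, ∀ t ∈ Icc 0 T, |u x t| ≤ M)
    (hw : ContinuousOn (Function.uncurry w) (univ ×ˢ Icc 0 T))
    (hwM : ∀ x, ∀ t ∈ Icc 0 T, |w x t| ≤ M) :
    ∃ x₀ y₀, ∃ t₀ ∈ Icc 0 T, (∀ x y, ∀ t ∈ Icc 0 T,
      u x t - w y t - a / 2 * ‖x - y - h‖ ^ 2 - b / 2 * ‖y‖ ^ 2 ≤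
        u x₀ t₀ - w y₀ t₀ - a / 2 * ‖x₀ - y₀ - h‖ ^ 2 - b / 2 * ‖y₀‖ ^ 2) ∧
      ‖x₀ - y₀ - h‖ ^ 2 ≤ 8 * M / a ∧ ‖y₀‖ ^ 2 ≤ 8 * M / b := by
  have h0T : (0 : ℝ) ∈ Icc 0 T := ⟨le_rfl, hT⟩
  have hM0 : 0 ≤ M := (abs_nonneg _).trans (huM 0 0 h0T)
  set ρ := √(8 * M / a) + √(8 * M / b) with hρ
  have hρ0 : 0 ≤ ρ := by positivity
  set S : Set (Space N × Space N × ℝ) :=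
    Metric.closedBall h ρ ×ˢ Metric.closedBall 0 ρ ×ˢ Icc 0 T with hS
  have hSc : IsCompact S := (isCompact_closedBall _ _).prod
    ((isCompact_closedBall _ _).prod isCompact_Icc)
  set f : Space N × Space N × ℝ → ℝ := fun ξ => u ξ.1 ξ.2.2 - w ξ.2.1 ξ.2.2
    - a / 2 * ‖ξ.1 - ξ.2.1 - h‖ ^ 2 - b / 2 * ‖ξ.2.1‖ ^ 2 with hf
  have hfc : ContinuousOn f S := by
    have h1 : ContinuousOn (fun ξ : Space N × Space N × ℝ => u ξ.1 ξ.2.2) S :=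
      hu.comp (f := fun ξ : Space N × Space N × ℝ => (ξ.1, ξ.2.2)) (by fun_prop)
        fun ξ hξ => ⟨mem_univ _, hξ.2.2⟩
    have h2 : ContinuousOn (fun ξ : Space N × Space N × ℝ => w ξ.2.1 ξ.2.2) S :=
      hw.comp (f := fun ξ : Space N × Space N × ℝ => (ξ.2.1, ξ.2.2)) (by fun_prop)
        fun ξ hξ => ⟨mem_univ _, hξ.2.2⟩
    refine ((h1.sub h2).sub ?_).sub ?_ <;> fun_prop
  have hbase : ∀ x y, ∀ t ∈ Icc 0 T, f (h, 0, 0) ≤ f (x, y, t) →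
      ‖x - y - h‖ ^ 2 ≤ 8 * M / a ∧ ‖y‖ ^ 2 ≤ 8 * M / b := fun x y t ht hle => by
    simp only [hf, sub_zero, sub_self, norm_zero] at hle
    have e1 := abs_le.1 (huM h 0 h0T)
    have e2 := abs_le.1 (hwM 0 0 h0T)
    have e3 := abs_le.1 (huM x t ht)
    have e4 := abs_le.1 (hwM y t ht)
    have g1 : 0 ≤ a / 2 * ‖x - y - h‖ ^ 2 := by positivity
    have g2 : 0 ≤ b / 2 * ‖y‖ ^ 2 := by positivity
    rw [le_div_iff₀ ha, le_div_iff₀ hb]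
    constructor <;> linarith
  obtain ⟨ξ, hξS, hξ⟩ := hSc.exists_isMaxOn
    ⟨(h, 0, 0), Metric.mem_closedBall_self hρ0, Metric.mem_closedBall_self hρ0, h0T⟩ hfc
  rw [isMaxOn_iff] at hξ
  have hξ0 := hξ (h, 0, 0) ⟨Metric.mem_closedBall_self hρ0, Metric.mem_closedBall_self hρ0, h0T⟩
  refine ⟨ξ.1, ξ.2.1, ξ.2.2, hξS.2.2, fun x y t ht => ?_, hbase _ _ _ hξS.2.2 hξ0⟩
  by_cases hcase : f (h, 0, 0) ≤ f (x, y, t)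
  · have h1 := hbase x y t ht hcase
    have h2 := Real.le_sqrt_of_sq_le h1.1
    have h3 := Real.le_sqrt_of_sq_le h1.2
    refine hξ (x, y, t) ⟨?_, ?_, ht⟩
    · rw [Metric.mem_closedBall, dist_eq_norm]
      have := norm_add_le (x - y - h) y
      rw [show x - y - h + y = x - h by abel] at this
      linarith
    · rw [Metric.mem_closedBall, dist_zero_right]
      have := Real.sqrt_nonneg (8 * M / a)
      linarith
  · exact (not_le.1 hcase).le.trans hξ0

/-- With penalty weights `k + 1` and its inverse, all errors in the comparison proofs have this
form. -/
lemma le_of_forall_nat_sqrt {X D E M : ℝ}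
    (h : ∀ k : ℕ, X ≤ D + E * √(M / ((k : ℝ) + 1)) + M * ((k : ℝ) + 1)⁻¹) : X ≤ D := by
  have hk : Tendsto (fun k : ℕ => (k : ℝ) + 1) atTop atTop :=
    tendsto_natCast_atTop_atTop.atTop_add tendsto_const_nhds
  have h1 : Tendsto (fun k : ℕ => √(M / ((k : ℝ) + 1))) atTop (𝓝 0) := by
    have := (Real.continuous_sqrt.tendsto 0).comp (tendsto_const_nhds (x := M).div_atTop hk)
    rwa [Real.sqrt_zero] at this
  have h2 := ((h1.const_mul E).const_add D).add ((tendsto_inv_atTop_zero.comp hk).const_mul M)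
  rw [mul_zero, mul_zero, add_zero, add_zero] at h2
  exact ge_of_tendsto' h2 h

/-- Comparison for the time-fractional problem, with a shift `h` in space. -/
theorem sub_le_of_testsSub_testsSuper {N : ℕ} {α T M C L d e : ℝ} (hα : α ∈ Ioo (0 : ℝ) 1)
    (hT : 0 < T) {u w : Space N → ℝ → ℝ} {F G : Space N → Space N → ℝ} (h : Space N)
    (hu : ContinuousOn (Function.uncurry u) (univ ×ˢ Icc 0 T))
    (huM : ∀ x, ∀ t ∈ Icc 0 T, |u x t| ≤ M)
    (hw : ContinuousOn (Function.uncurry w) (univ ×ˢ Icc 0 T))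
    (hwM : ∀ x, ∀ t ∈ Icc 0 T, |w x t| ≤ M)
    (hsub : TestsSub α T F u) (hsup : TestsSuper α T G w)
    (hC : 0 ≤ C) (hL : 0 ≤ L) (he : 0 ≤ e)
    (hFG : ∀ x y p q, G y p - F x q ≤ e + C * (‖x - y - h‖ + ‖p - q‖))
    (h0 : ∀ x y, u x 0 - w y 0 ≤ d + L * ‖x - y - h‖) (y : Space N) {t : ℝ} (ht : t ∈ Icc 0 T) :
    u (y + h) t - w y t ≤ d + T ^ α * Real.Gamma (1 - α) * e := by
  have hΓ : 0 < Real.Gamma (1 - α) := Real.Gamma_pos_of_pos (by linarith [hα.2])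
  have hM0 : 0 ≤ M := (abs_nonneg _).trans (huM 0 t ht)
  set A := T ^ α * Real.Gamma (1 - α) with hA
  have hA0 : 0 ≤ A := mul_nonneg (Real.rpow_nonneg hT.le _) hΓ.le
  -- One constant for both errors: `8 * M` controls the penalties at the maximum, `‖y‖ ^ 2` the
  -- penalty at the point where the estimate is wanted.
  set Q := 8 * M + ‖y‖ ^ 2 with hQ
  refine le_of_forall_nat_sqrt (E := L + A * (2 * C)) (M := Q) fun k => ?_
  have hk : 0 < (k : ℝ) + 1 := by positivity
  obtain ⟨x₀, y₀, t₀, ht₀, hmax, hx₀, hy₀⟩ :=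
    exists_max_quadratic hT.le hk (inv_pos.2 hk) h hu huM hw hwM
  set r := √(Q / ((k : ℝ) + 1)) with hr
  have hr1 : ‖x₀ - y₀ - h‖ ≤ r := by
    refine Real.le_sqrt_of_sq_le (hx₀.trans ?_)
    exact div_le_div_of_nonneg_right (by have := sq_nonneg ‖y‖; linarith) hk.le
  have hr2 : ((k : ℝ) + 1)⁻¹ * ‖y₀‖ ≤ r := by
    refine Real.le_sqrt_of_sq_le ?_
    rw [mul_pow]
    calc ((k : ℝ) + 1)⁻¹ ^ 2 * ‖y₀‖ ^ 2 ≤ ((k : ℝ) + 1)⁻¹ ^ 2 * (8 * M / ((k : ℝ) + 1)⁻¹) := by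
          gcongr
      _ = 8 * M / ((k : ℝ) + 1) := by field_simp
      _ ≤ Q / ((k : ℝ) + 1) :=
          div_le_div_of_nonneg_right (by have := sq_nonneg ‖y‖; linarith) hk.le
  have hr0 : 0 ≤ r := Real.sqrt_nonneg _
  have hval : u x₀ t₀ - w y₀ t₀ ≤ d + L * r + A * (e + 2 * C * r) := by
    rcases eq_or_lt_of_le ht₀.1 with h00 | h00
    · rw [← h00]
      have h1 : 0 ≤ A * (e + 2 * C * r) := by positivity
      have h2 := mul_le_mul_of_nonneg_left hr1 hL
      linarith [h0 x₀ y₀]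
    · have ht₀' : t₀ ∈ Ioc 0 T := ⟨h00, ht₀.2⟩
      set b := ((k : ℝ) + 1)⁻¹ with hb
      set P := ((k : ℝ) + 1) • (x₀ - y₀ - h) with hP
      have key := caputo_sub_le_of_max (M := M) (κ := 0) (a := (k : ℝ) + 1) (b := b) (h := h)
        (m := e + C * (‖x₀ - y₀ - h‖ + b * ‖y₀‖)) (B₁ := C) (B₂ := C) (x₀ := x₀) (y₀ := y₀)
        (V := fun _ => 0) (g := fun _ => 0) hα le_rfl hk.le (inv_pos.2 hk).le hC hu huM hw hwM
        continuous_const (fun _ => by simpa using hM0) continuousOn_const contDiffOn_const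
        (fun _ _ _ _ _ => le_rfl) (fun _ _ => by simpa using hM0) hsub hsup ht₀'
        (fun x y t ht => by simpa using hmax x y t ht) ?_
      -- In time, `u x₀ - w y₀` is maximal at `t₀`, so its `K` part is nonnegative and can be
      -- dropped. The `J` part then compares `t₀` directly with time `0`.
      · have hK : 0 ≤ K α 0 t₀ (fun r => u x₀ r - w y₀ r) t₀ := by
          refine mul_nonneg (div_pos hα.1 hΓ).le
            (intervalIntegral.integral_nonneg ht₀.1 fun τ hτ => ?_)
          refine div_nonneg ?_ (Real.rpow_nonneg hτ.1 _)
          have := hmax x₀ y₀ (t₀ - τ) ⟨by linarith [hτ.2], by linarith [hτ.1, ht₀.2]⟩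
          linarith
        have hJ : (u x₀ t₀ - w y₀ t₀ - (u x₀ 0 - w y₀ 0)) / (t₀ ^ α * Real.Gamma (1 - α)) ≤
            e + C * (‖x₀ - y₀ - h‖ + b * ‖y₀‖) := by
          have h1 := key.2
          simp only [J] at h1
          rw [show u x₀ t₀ - w y₀ t₀ - (u x₀ 0 - w y₀ 0) = u x₀ t₀ - u x₀ 0 - (w y₀ t₀ - w y₀ 0)
            by ring, sub_div]
          linarith
        rw [div_le_iff₀ (mul_pos (Real.rpow_pos_of_pos h00 _) hΓ)] at hJ
        have h2 : t₀ ^ α * Real.Gamma (1 - α) ≤ A :=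
          mul_le_mul_of_nonneg_right (Real.rpow_le_rpow ht₀.1 ht₀.2 hα.1.le) hΓ.le
        have h3 : e + C * (‖x₀ - y₀ - h‖ + b * ‖y₀‖) ≤ e + 2 * C * r := by
          have := mul_le_mul_of_nonneg_left (add_le_add hr1 hr2) hC
          linarith
        have h4 : (e + C * (‖x₀ - y₀ - h‖ + b * ‖y₀‖)) * (t₀ ^ α * Real.Gamma (1 - α)) ≤
            A * (e + 2 * C * r) := by
          rw [mul_comm A]
          exact mul_le_mul h3 h2 (mul_nonneg (Real.rpow_nonneg ht₀.1 _) hΓ.le) (by positivity)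
        have h5 := mul_le_mul_of_nonneg_left hr1 hL
        linarith [h0 x₀ y₀]
      -- With `V = 0` minimality forces `z = x`, and the extra variable disappears.
      · intro c hc x y z p p' hz
        have h1 := hz x
        rw [sub_self, norm_zero, zero_add] at h1
        have h2 : ‖x - z‖ ^ 2 = 0 := by
          have := sq_nonneg ‖x - z‖
          nlinarith
        have h3 : x - z = 0 := norm_eq_zero.1 (pow_eq_zero_iff two_ne_zero |>.1 h2)
        rw [h3, smul_zero, zero_add]
        refine (hFG x y p' p).trans ?_
        have h4 : ‖x - y - h‖ ≤ ‖x₀ - y₀ - h‖ + ‖x - x₀‖ + ‖y - y₀‖ := by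
          rw [show x - y - h = (x₀ - y₀ - h) + (x - x₀) + -(y - y₀) by abel, ← norm_neg (y - y₀)]
          exact norm_add₃_le
        have h5 : ‖p' - p‖ ≤ ‖p - P‖ + ‖p' - (P - b • y₀)‖ + b * ‖y₀‖ := by
          have hby : ‖-(b • y₀)‖ = b * ‖y₀‖ := by
            rw [norm_neg, norm_smul, Real.norm_eq_abs, abs_of_pos (show 0 < b from inv_pos.2 hk)]
          rw [show p' - p = -(p - P) + (p' - (P - b • y₀)) + -(b • y₀) by abel, ← norm_neg (p - P),
            ← hby]
          exact norm_add₃_le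
        have h6 := mul_le_mul_of_nonneg_left (add_le_add h4 h5) hC
        have h7 := mul_nonneg hC (norm_nonneg (z - x₀))
        linarith
  have hfin := hmax (y + h) y t ht
  rw [show y + h - y - h = 0 by abel, norm_zero] at hfin
  have g1 : 0 ≤ ((k : ℝ) + 1) / 2 * ‖x₀ - y₀ - h‖ ^ 2 := by positivity
  have g2 : 0 ≤ ((k : ℝ) + 1)⁻¹ / 2 * ‖y₀‖ ^ 2 := by positivity
  have g3 : ((k : ℝ) + 1)⁻¹ / 2 * ‖y‖ ^ 2 ≤ Q * ((k : ℝ) + 1)⁻¹ := by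
    have h1 : 0 ≤ ((k : ℝ) + 1)⁻¹ * ‖y‖ ^ 2 := by positivity
    have h2 : 0 ≤ 8 * M * ((k : ℝ) + 1)⁻¹ := by positivity
    rw [hQ, add_mul]
    linarith
  linarith

lemma gradient_eq_zero_of_isLocalMin {N : ℕ} {f : Space N → ℝ} {x : Space N}
    (h : IsLocalMin f x) : gradient f x = 0 := by
  rw [gradient, h.fderiv_eq_zero, map_zero]

lemma gradient_eq_zero_of_isLocalMax {N : ℕ} {f : Space N → ℝ} {x : Space N}
    (h : IsLocalMax f x) : gradient f x = 0 := by
  rw [gradient, h.fderiv_eq_zero, map_zero]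

/-- A test function touching the constant has a minimum at the contact point, so its gradient
vanishes and its `J` and `K` are nonpositive. -/
lemma testsSub_zero {N : ℕ} {α T : ℝ} (hα : α ∈ Ioo (0 : ℝ) 1) {F : Space N → Space N → ℝ}
    (hF : ∀ x, F x 0 ≤ 0) : TestsSub α T F (fun _ _ => 0) := by
  intro φ _ x₁ t₁ ht₁ hmax
  have hΓ : 0 < Real.Gamma (1 - α) := Real.Gamma_pos_of_pos (by linarith [hα.2])
  have hφ : ∀ x, ∀ t ∈ Icc 0 T, φ x₁ t₁ ≤ φ x t := fun x t ht => by linarith [hmax x t ht]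
  have hgr : gradient (fun x => φ x t₁) x₁ = 0 :=
    gradient_eq_zero_of_isLocalMin (Eventually.of_forall fun x => hφ x t₁ ⟨ht₁.1.le, ht₁.2⟩)
  have hJ : J α (φ x₁) t₁ ≤ 0 := div_nonpos_of_nonpos_of_nonneg
    (by linarith [hφ x₁ 0 ⟨le_rfl, ht₁.1.le.trans ht₁.2⟩])
    (mul_nonneg (Real.rpow_nonneg ht₁.1.le _) hΓ.le)
  have hK : 0 ≤ K α 0 t₁ (fun s => -φ x₁ s) t₁ := by
    refine mul_nonneg (div_pos hα.1 hΓ).le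
      (intervalIntegral.integral_nonneg ht₁.1.le fun τ hτ => ?_)
    refine div_nonneg ?_ (Real.rpow_nonneg hτ.1 _)
    linarith [hφ x₁ (t₁ - τ) ⟨by linarith [hτ.2], by linarith [hτ.1, ht₁.2]⟩]
  rw [K_neg] at hK
  rw [hgr]
  linarith [hF x₁]

lemma testsSuper_zero {N : ℕ} {α T : ℝ} (hα : α ∈ Ioo (0 : ℝ) 1) {F : Space N → Space N → ℝ}
    (hF : ∀ x, 0 ≤ F x 0) : TestsSuper α T F (fun _ _ => 0) := by
  intro φ hφ x₁ t₁ ht₁ hmin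
  have h := testsSub_zero (T := T) hα (F := fun x p => -F x (-p)) (fun x => by simpa using hF x)
    (fun x t => -φ x t) ⟨hφ.1.neg, hφ.2.neg⟩ x₁ t₁ ht₁ fun x t ht => by
      have := hmin x t ht
      simp only [] at this ⊢
      linarith
  rw [J_neg, K_neg, gradient_neg (fun x => φ x t₁)] at h
  simp only [neg_neg] at h
  linarith

lemma IsSolution.initial {N : ℕ} {α T : ℝ} {F : Space N → Space N → ℝ} {u₀ : Space N → ℝ}
    {u : Space N → ℝ → ℝ} (hu : IsSolution α T F u₀ u) (x : Space N) : u x 0 = u₀ x :=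
  le_antisymm (hu.2.2.1.2.1 x) (hu.2.2.2.2.1 x)

/-- Solutions are bounded in terms of the initial value and of `F(·, 0)`. -/
lemma IsSolution.abs_le {N : ℕ} {α T S M₀ C : ℝ} (hα : α ∈ Ioo (0 : ℝ) 1) (hT : 0 < T)
    {F : Space N → Space N → ℝ} {u₀ : Space N → ℝ} {u : Space N → ℝ → ℝ}
    (hu : IsSolution α T F u₀ u) (hC : 0 ≤ C)
    (hF : ∀ x y p q, |F x p - F y q| ≤ C * (‖x - y‖ + ‖p - q‖)) (hS : ∀ x, |F x 0| ≤ S)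
    (hM₀ : ∀ x, |u₀ x| ≤ M₀) (x : Space N) {t : ℝ} (ht : t ∈ Icc 0 T) :
    |u x t| ≤ M₀ + T ^ α * Real.Gamma (1 - α) * S := by
  obtain ⟨M, hM⟩ := hu.2.1
  have hM0 : 0 ≤ M := (abs_nonneg _).trans (hM x t ht)
  have hS0 : 0 ≤ S := (abs_nonneg _).trans (hS x)
  have hzM : ∀ x : Space N, ∀ t ∈ Icc 0 T, |(fun _ _ => (0 : ℝ)) x t| ≤ M :=
    fun _ _ _ => by simpa using hM0
  have hzc : ContinuousOn (Function.uncurry fun (_ : Space N) (_ : ℝ) => (0 : ℝ))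
      (univ ×ˢ Icc 0 T) := continuousOn_const
  -- The zero function is a supersolution for `F + S`, and below a subsolution for `F - S`. The
  -- Lipschitz constant `C` does not enter the bound, which matters when it grows like `ε⁻¹`.
  have h1 := sub_le_of_testsSub_testsSuper (d := M₀) (L := 0) hα hT 0 hu.1 hM hzc hzM
    hu.2.2.1.2.2 (testsSuper_zero hα (F := fun x p => F x p + S)
      fun x => by linarith [(_root_.abs_le.1 (hS x)).1]) hC le_rfl hS0 (fun x y p q => by
        have := (_root_.abs_le.1 (hF y x p q)).2
        rw [norm_sub_rev y x] at this
        simp only [sub_zero]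
        linarith) (fun x y => by
        have := (_root_.abs_le.1 (hM₀ x)).2
        rw [hu.initial]
        linarith) x ht
  have h2 := sub_le_of_testsSub_testsSuper (d := M₀) (L := 0) hα hT 0 hzc hzM hu.1 hM
    (testsSub_zero hα (F := fun x p => F x p - S)
      fun x => by linarith [(_root_.abs_le.1 (hS x)).2]) hu.2.2.2.2.2 hC le_rfl hS0
      (fun x y p q => by
        have := (_root_.abs_le.1 (hF y x p q)).2
        rw [norm_sub_rev y x] at this
        simp only [sub_zero]
        linarith) (fun x y => by
        have := (_root_.abs_le.1 (hM₀ y)).1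
        rw [hu.initial]
        linarith) x ht
  rw [add_zero, sub_zero] at h1
  rw [_root_.abs_le]
  constructor <;> linarith

/-- Solutions of problems with a Hamiltonian that does not depend on the position inherit the
Lipschitz constant of the initial value. -/
lemma IsSolution.sub_le_mul_norm {N : ℕ} {α T C L : ℝ} (hα : α ∈ Ioo (0 : ℝ) 1) (hT : 0 < T)
    {F : Space N → ℝ} {u₀ : Space N → ℝ} {u : Space N → ℝ → ℝ}
    (hu : IsSolution α T (fun _ p => F p) u₀ u) (hC : 0 ≤ C) (hL : 0 ≤ L)
    (hF : ∀ p q, |F p - F q| ≤ C * ‖p - q‖) (hu₀ : ∀ x y, u₀ x - u₀ y ≤ L * ‖x - y‖)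
    (x y : Space N) {t : ℝ} (ht : t ∈ Icc 0 T) : u x t - u y t ≤ L * ‖x - y‖ := by
  obtain ⟨M, hM⟩ := hu.2.1
  -- The solution is compared with its own translate by `x - y`; the equation is translation
  -- invariant, so only the initial discrepancy remains.
  have h1 := sub_le_of_testsSub_testsSuper (d := L * ‖x - y‖) (L := L) (e := 0) (C := C) hα hT
    (x - y) hu.1 hM hu.1 hM hu.2.2.1.2.2 hu.2.2.2.2.2 hC hL le_rfl (fun x' y' p q => by
      have := (_root_.abs_le.1 (hF p q)).2
      have h2 := mul_nonneg hC (norm_nonneg (x' - y' - (x - y)))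
      linarith) (fun x' y' => by
      rw [hu.initial, hu.initial]
      refine (hu₀ x' y').trans ?_
      rw [← mul_add]
      refine mul_le_mul_of_nonneg_left ?_ hL
      have := norm_add_le (x - y) (x' - y' - (x - y))
      rwa [add_sub_cancel] at this) y ht
  rw [add_sub_cancel, mul_zero, add_zero] at h1
  exact h1

/-! ### Stationary problems: comparison and Lipschitz bounds -/

/-- The subsolution clause of `IsStationarySolution`. -/
def StationarySub {N : ℕ} (G : Space N → ℝ → Space N → ℝ) (v : Space N → ℝ) : Prop :=
  ∀ φ : Space N → ℝ, ContDiff ℝ 1 φ → ∀ y, IsLocalMax (fun z => v z - φ z) y →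
    G y (v y) (gradient φ y) ≤ 0

/-- The supersolution clause of `IsStationarySolution`. -/
def StationarySuper {N : ℕ} (G : Space N → ℝ → Space N → ℝ) (v : Space N → ℝ) : Prop :=
  ∀ φ : Space N → ℝ, ContDiff ℝ 1 φ → ∀ y, IsLocalMin (fun z => v z - φ z) y →
    0 ≤ G y (v y) (gradient φ y)

lemma stationarySub_const {N : ℕ} {l c : ℝ} {H : Space N → Space N → ℝ}
    (h : ∀ y, l * c + H y 0 ≤ 0) : StationarySub (fun y r q => l * r + H y q) (fun _ => c) := by
  intro φ _ y hy
  have : IsLocalMin φ y := hy.mono fun z hz => by dsimp only at hz; linarith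
  rw [gradient_eq_zero_of_isLocalMin this]
  exact h y

lemma stationarySuper_const {N : ℕ} {l c : ℝ} {H : Space N → Space N → ℝ}
    (h : ∀ y, 0 ≤ l * c + H y 0) : StationarySuper (fun y r q => l * r + H y q) (fun _ => c) := by
  intro φ _ y hy
  have : IsLocalMax φ y := hy.mono fun z hz => by dsimp only at hz; linarith
  rw [gradient_eq_zero_of_isLocalMax this]
  exact h y

/-- Comparison for the discounted problem, with a shift `h`. -/
theorem mul_sub_le_of_stationarySub_stationarySuper {N : ℕ} {l C d M : ℝ} (hl : 0 < l)
    {v w : Space N → ℝ} {F G : Space N → Space N → ℝ} (h : Space N)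
    (hv : Continuous v) (hvM : ∀ x, |v x| ≤ M) (hw : Continuous w) (hwM : ∀ x, |w x| ≤ M)
    (hsub : StationarySub (fun y r q => l * r + F y q) v)
    (hsup : StationarySuper (fun y r q => l * r + G y q) w) (hC : 0 ≤ C)
    (hFG : ∀ x y p q, G y p - F x q ≤ d + C * (‖x - y - h‖ + ‖p - q‖)) (y : Space N) :
    l * (v (y + h) - w y) ≤ d := by
  have hM0 : 0 ≤ M := (abs_nonneg _).trans (hvM 0)
  set Q := 8 * M + l * ‖y‖ ^ 2 with hQ
  have hQ1 : 8 * M ≤ Q := by have : 0 ≤ l * ‖y‖ ^ 2 := by positivity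
                             linarith
  refine le_of_forall_nat_sqrt (E := 2 * C) (M := Q) fun k => ?_
  have hk : 0 < (k : ℝ) + 1 := by positivity
  -- The stationary functions are treated as constant in time on the degenerate interval `[0, 0]`.
  obtain ⟨x₀, y₀, t₀, -, hmax', hx₀, hy₀⟩ :=
    exists_max_quadratic (T := 0) (u := fun x _ => v x) (w := fun x _ => w x) (M := M)
      le_rfl hk (inv_pos.2 hk) h (hv.comp continuous_fst).continuousOn (fun x _ _ => hvM x)
      (hw.comp continuous_fst).continuousOn (fun x _ _ => hwM x)
  have hmax := fun x y => hmax' x y 0 ⟨le_rfl, le_rfl⟩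
  set r := √(Q / ((k : ℝ) + 1)) with hr
  have hr1 : ‖x₀ - y₀ - h‖ ≤ r :=
    Real.le_sqrt_of_sq_le (hx₀.trans (div_le_div_of_nonneg_right hQ1 hk.le))
  have hr2 : ((k : ℝ) + 1)⁻¹ * ‖y₀‖ ≤ r := by
    refine Real.le_sqrt_of_sq_le ?_
    rw [mul_pow]
    calc ((k : ℝ) + 1)⁻¹ ^ 2 * ‖y₀‖ ^ 2 ≤ ((k : ℝ) + 1)⁻¹ ^ 2 * (8 * M / ((k : ℝ) + 1)⁻¹) := by
          gcongr
      _ = 8 * M / ((k : ℝ) + 1) := by field_simp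
      _ ≤ Q / ((k : ℝ) + 1) := div_le_div_of_nonneg_right hQ1 hk.le
  set a := (k : ℝ) + 1 with ha
  have hsm : ∀ c : Space N, ContDiff ℝ 1 (fun x => ‖x - c‖ ^ 2) := fun c =>
    (contDiff_id.sub contDiff_const).norm_sq ℝ
  have h1 : l * v x₀ + F x₀ (a • (x₀ - y₀ - h)) ≤ 0 := by
    have hg := HasGradientAt.const_mul' (a / 2) (hasGradientAt_norm_sub_sq (y₀ + h) x₀)
    have := hsub (fun x => a / 2 * ‖x - (y₀ + h)‖ ^ 2) (contDiff_const.mul (hsm _)) x₀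
      (Eventually.of_forall fun x => by
        have := hmax x y₀
        simp only [sub_sub] at this ⊢
        linarith)
    rw [hg.gradient, smul_smul, show a / 2 * 2 = a by ring, ← sub_sub] at this
    exact this
  have h2 : 0 ≤ l * w y₀ + G y₀ (a • (x₀ - y₀ - h) - a⁻¹ • y₀) := by
    have hg := HasGradientAt.add'
      (HasGradientAt.const_mul' (-(a / 2)) (hasGradientAt_norm_sub_sq (x₀ - h) y₀))
      (HasGradientAt.const_mul' (-(a⁻¹ / 2)) (hasGradientAt_norm_sub_sq 0 y₀))
    have := hsup (fun y => -(a / 2) * ‖y - (x₀ - h)‖ ^ 2 + -(a⁻¹ / 2) * ‖y - 0‖ ^ 2)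
      ((contDiff_const.mul (hsm _)).add (contDiff_const.mul (hsm _))) y₀
      (Eventually.of_forall fun y => by
        have := hmax x₀ y
        have e : ∀ y, ‖y - (x₀ - h)‖ = ‖x₀ - y - h‖ := fun y => by
          rw [norm_sub_rev, show x₀ - h - y = x₀ - y - h by abel]
        simp only [e, sub_zero] at this ⊢
        linarith)
    rw [hg.gradient, smul_smul, smul_smul, show -(a / 2) * 2 = -a by ring,
      show -(a⁻¹ / 2) * 2 = -a⁻¹ by ring,
      show -a • (y₀ - (x₀ - h)) + -a⁻¹ • (y₀ - 0) = a • (x₀ - y₀ - h) - a⁻¹ • y₀ by module] at this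
    exact this
  have h3 := hFG x₀ y₀ (a • (x₀ - y₀ - h) - a⁻¹ • y₀) (a • (x₀ - y₀ - h))
  have h4 : ‖a • (x₀ - y₀ - h) - a⁻¹ • y₀ - a • (x₀ - y₀ - h)‖ ≤ r := by
    rw [sub_sub_cancel_left, norm_neg, norm_smul, Real.norm_eq_abs, abs_of_pos (inv_pos.2 hk)]
    exact hr2
  have h5 := mul_le_mul_of_nonneg_left (add_le_add hr1 h4) hC
  have h6 := hmax (y + h) y
  rw [show y + h - y - h = 0 by abel, norm_zero] at h6
  have g1 : 0 ≤ a / 2 * ‖x₀ - y₀ - h‖ ^ 2 := by positivity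
  have g2 : 0 ≤ a⁻¹ / 2 * ‖y₀‖ ^ 2 := by positivity
  have g3 : l * (a⁻¹ / 2 * ‖y‖ ^ 2) ≤ Q * a⁻¹ := by
    have e1 : 0 ≤ l * (a⁻¹ * ‖y‖ ^ 2) := by positivity
    have e2 : 0 ≤ 8 * M * a⁻¹ := by positivity
    rw [hQ, add_mul]
    linarith
  have h7 : l * (v (y + h) - w y) ≤ l * (v x₀ - w y₀ + a⁻¹ / 2 * ‖y‖ ^ 2) :=
    mul_le_mul_of_nonneg_left (by linarith) hl.le
  linarith

/-- A bounded continuous function whose test functions from above have bounded gradients is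
Lipschitz continuous. -/
lemma sub_le_mul_norm_of_gradient_le {N : ℕ} {L M : ℝ} (hL : 0 ≤ L) {v : Space N → ℝ}
    (hv : Continuous v) (hvM : ∀ x, |v x| ≤ M)
    (h : ∀ φ : Space N → ℝ, ContDiff ℝ 1 φ → ∀ y, IsLocalMax (fun z => v z - φ z) y →
      ‖gradient φ y‖ ≤ L) (x y : Space N) : v x - v y ≤ 2 * (L + 1) * ‖x - y‖ := by
  set A := 2 * (L + 1) with hA
  have hA0 : 0 < A := by positivity
  have hA1 : 1 ≤ A := by linarith
  have hM0 : 0 ≤ M := (abs_nonneg _).trans (hvM 0)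
  have hd : ∀ k : ℕ, 0 < ((k : ℝ) + 1)⁻¹ := fun k => by positivity
  have hstep : ∀ k : ℕ, ∃ z, ‖z - y‖ ≤ ((k : ℝ) + 1)⁻¹ ∧
      v x ≤ v z + A * smoothDist ((k : ℝ) + 1)⁻¹ y x := fun k => by
    set d := ((k : ℝ) + 1)⁻¹ with hdd
    have hd1 : d ≤ 1 := inv_le_one_of_one_le₀ (by linarith [k.cast_nonneg (α := ℝ)])
    have hcont : Continuous fun z => v z - A * smoothDist d y z :=
      hv.sub (continuous_const.mul (contDiff_smoothDist (hd k) y).continuous)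
    obtain ⟨z, hz, hzmax⟩ := (isCompact_closedBall y (2 * M + 1)).exists_isMaxOn
      ⟨y, Metric.mem_closedBall_self (by positivity)⟩ hcont.continuousOn
    rw [isMaxOn_iff] at hzmax
    have hzy := hzmax y (Metric.mem_closedBall_self (by positivity))
    -- Outside the ball of radius `2 * M + 1` the cone outweighs the oscillation of `v`, because `A
    -- ≥ 1`.
    have hglob : ∀ z', v z' - A * smoothDist d y z' ≤ v z - A * smoothDist d y z := fun z' => by
      by_cases hz' : z' ∈ Metric.closedBall y (2 * M + 1)
      · exact hzmax z' hz'
      · rw [Metric.mem_closedBall, dist_eq_norm, not_le] at hz'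
        refine le_trans ?_ hzy
        rw [smoothDist_self (hd k).le]
        have e1 := norm_sub_le_smoothDist d y z'
        have e2 : A * (2 * M + 1) ≤ A * smoothDist d y z' :=
          mul_le_mul_of_nonneg_left (hz'.le.trans e1) hA0.le
        have e3 : A * d ≤ A := mul_le_of_le_one_right hA0.le hd1
        have e4 : M ≤ A * M := le_mul_of_one_le_left hM0 hA1
        linarith [(abs_le.1 (hvM z')).2, (abs_le.1 (hvM y)).1]
    have hgr := h (fun z => A * smoothDist d y z)
      (contDiff_const.mul (contDiff_smoothDist (hd k) y)) z (Eventually.of_forall hglob)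
    rw [(HasGradientAt.const_mul' A (hasGradientAt_smoothDist (hd k) y z)).gradient, norm_smul,
      norm_smul, Real.norm_eq_abs, abs_of_pos hA0, norm_inv, Real.norm_eq_abs,
      abs_of_pos (smoothDist_pos (hd k) y z)] at hgr
    refine ⟨z, ?_, ?_⟩
    -- Beyond distance `d` from `y` the gradient of `A * smoothDist d y` has length at least `A / 2
    -- = L + 1`, against the bound `L`. So the maximum point stays within `d` of `y`, and `d → 0`
    -- gives the claim.
    · by_contra hlt
      rw [not_le] at hlt
      have hs := smoothDist_pos (hd k) y z
      have h1 : smoothDist d y z ≤ 2 * ‖z - y‖ := by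
        refine Real.sqrt_le_iff.2 ⟨by positivity, ?_⟩
        have : d ^ 2 ≤ ‖z - y‖ ^ 2 := pow_le_pow_left₀ (hd k).le hlt.le 2
        linarith [sq_nonneg ‖z - y‖]
      have h2 : 1 ≤ (smoothDist d y z)⁻¹ * (2 * ‖z - y‖) := by
        rw [← div_eq_inv_mul, le_div_iff₀ hs, one_mul]; exact h1
      have h3 := mul_le_mul_of_nonneg_left h2 (show 0 ≤ L + 1 by positivity)
      have h4 : A * ((smoothDist d y z)⁻¹ * ‖z - y‖) =
          (L + 1) * ((smoothDist d y z)⁻¹ * (2 * ‖z - y‖)) := by rw [hA]; ring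
      linarith
    · have := hglob x
      have := mul_pos hA0 (smoothDist_pos (hd k) y z)
      linarith
  choose z hz hvz using hstep
  have hdlim : Tendsto (fun k : ℕ => ((k : ℝ) + 1)⁻¹) atTop (𝓝 0) :=
    tendsto_inv_atTop_zero.comp (tendsto_natCast_atTop_atTop.atTop_add tendsto_const_nhds)
  have hzlim : Tendsto z atTop (𝓝 y) :=
    tendsto_iff_norm_sub_tendsto_zero.2 (squeeze_zero (fun _ => norm_nonneg _) hz hdlim)
  have hslim : Tendsto (fun k : ℕ => smoothDist ((k : ℝ) + 1)⁻¹ y x) atTop (𝓝 ‖x - y‖) := by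
    have : Tendsto (fun k : ℕ => √(‖x - y‖ ^ 2 + (((k : ℝ) + 1)⁻¹) ^ 2)) atTop
        (𝓝 √(‖x - y‖ ^ 2 + 0 ^ 2)) :=
      (Real.continuous_sqrt.tendsto _).comp ((hdlim.pow 2).const_add _)
    rwa [zero_pow two_ne_zero, add_zero, Real.sqrt_sq (norm_nonneg _)] at this
  have := ge_of_tendsto' (((hv.tendsto y).comp hzlim).add (hslim.const_mul A)) hvz
  linarith

/-! ### Stability and periodic functions -/

/-- Local maximum points of `w - φ` are limits of local maximum points of approximate functions. -/
lemma exists_tendsto_isLocalMax {N : ℕ} {Λ : ℝ} {U : Ultrafilter ℕ} {wn : ℕ → Space N → ℝ}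
    {w φ : Space N → ℝ} (hL : ∀ n x y, |wn n x - wn n y| ≤ Λ * ‖x - y‖)
    (hlim : ∀ y, Tendsto (fun n => wn n y) U (𝓝 (w y))) (hφ : Continuous φ) {y : Space N}
    (hy : IsLocalMax (fun z => w z - φ z) y) :
    ∃ yn : ℕ → Space N, Tendsto yn U (𝓝 y) ∧ Tendsto (fun n => wn n (yn n)) U (𝓝 (w y)) ∧
      ∀ᶠ n in (U : Filter ℕ), IsLocalMax (fun z => wn n z - (φ z + 1 * ‖z - y‖ ^ 2)) (yn n) := by
  obtain ⟨r, hr, hball⟩ := Metric.eventually_nhds_iff_ball.1 hy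
  have hwc : ∀ n, Continuous (wn n) := fun n => by
    have hΛ : LipschitzWith (Real.toNNReal Λ) (wn n) := LipschitzWith.of_dist_le_mul fun x y => by
      rw [Real.dist_eq, dist_eq_norm]
      exact (hL n x y).trans (mul_le_mul_of_nonneg_right (Real.le_coe_toNNReal Λ) (norm_nonneg _))
    exact hΛ.continuous
  have hex : ∀ n, ∃ z ∈ Metric.closedBall y (r / 2), ∀ z' ∈ Metric.closedBall y (r / 2),
      wn n z' - (φ z' + 1 * ‖z' - y‖ ^ 2) ≤ wn n z - (φ z + 1 * ‖z - y‖ ^ 2) := fun n => by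
    obtain ⟨z, hz, hzm⟩ := (isCompact_closedBall y (r / 2)).exists_isMaxOn
      (f := fun z => wn n z - (φ z + 1 * ‖z - y‖ ^ 2))
      ⟨y, Metric.mem_closedBall_self (by positivity)⟩ (by have := hwc n; fun_prop)
    exact ⟨z, hz, isMaxOn_iff.1 hzm⟩
  choose yn hyn hmax using hex
  obtain ⟨z, hz, hUz⟩ := (isCompact_closedBall y (r / 2)).ultrafilter_le_nhds (U.map yn)
    (tendsto_principal.2 (Eventually.of_forall hyn))
  have hyz : Tendsto yn U (𝓝 z) := hUz
  have hwz : Tendsto (fun n => wn n (yn n)) U (𝓝 (w z)) := by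
    have h1 : Tendsto (fun n => wn n (yn n) - wn n z) U (𝓝 0) := by
      refine squeeze_zero_norm (fun n => ?_) (a := fun n => Λ * ‖yn n - z‖) ?_
      · exact hL n _ _
      · have := (tendsto_iff_norm_sub_tendsto_zero.1 hyz).const_mul Λ
        rwa [mul_zero] at this
    have := h1.add (hlim z)
    simpa using this
  have hle : w y - φ y ≤ w z - (φ z + 1 * ‖z - y‖ ^ 2) := by
    refine le_of_tendsto_of_tendsto' ((hlim y).sub_const (φ y))
      (hwz.sub (((hφ.tendsto z).comp hyz).add (((hyz.sub_const y).norm.pow 2).const_mul 1)))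
      fun n => ?_
    have := hmax n y (Metric.mem_closedBall_self (by positivity))
    simpa using this
  -- The added square makes `y` a strict maximum of the limit function, so the maximizers can only
  -- converge to `y`; being eventually interior to the ball, they are local maxima.
  have hzy : z = y := by
    have h1 := hball z (Metric.closedBall_subset_ball (by linarith) hz)
    simp only [] at h1
    have h2 : ‖z - y‖ ^ 2 = 0 := le_antisymm (by linarith) (sq_nonneg _)
    exact sub_eq_zero.1 (norm_eq_zero.1 (pow_eq_zero_iff two_ne_zero |>.1 h2))
  rw [hzy] at hyz hwz
  refine ⟨yn, hyz, hwz, ?_⟩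
  filter_upwards [hyz.eventually (Metric.ball_mem_nhds y (by positivity : 0 < r / 2))] with n hn
  filter_upwards [Metric.isOpen_ball.mem_nhds hn] with z' hz'
  exact hmax n z' (Metric.ball_subset_closedBall hz')

/-- Taking fractional parts moves any point into the unit cube; a periodic function is thus
determined on one compact ball. -/
lemma exists_norm_add_latticeVec_le {N : ℕ} (y : Space N) :
    ∃ k : Fin N → ℤ, ‖y + latticeVec k‖ ≤ √N := by
  refine ⟨fun i => -⌊y i⌋, ?_⟩
  rw [EuclideanSpace.norm_eq]
  refine Real.sqrt_le_sqrt ?_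
  calc ∑ i, ‖(y + latticeVec fun i => -⌊y i⌋) i‖ ^ 2 ≤ ∑ _i : Fin N, (1 : ℝ) := by
        refine Finset.sum_le_sum fun i _ => ?_
        have h1 : (y + latticeVec fun i => -⌊y i⌋) i = Int.fract (y i) := by
          simp [latticeVec, Int.fract, sub_eq_add_neg]
        rw [h1, Real.norm_eq_abs, abs_of_nonneg (Int.fract_nonneg _)]
        exact pow_le_one₀ (Int.fract_nonneg _) (Int.fract_lt_one _).le
    _ = N := by simp

lemma exists_abs_le_of_periodic {N : ℕ} {v : Space N → ℝ} (hv : Continuous v)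
    (hper : ∀ y (k : Fin N → ℤ), v (y + latticeVec k) = v y) : ∃ M, ∀ y, |v y| ≤ M := by
  obtain ⟨M, hM⟩ := (isCompact_closedBall (0 : Space N) √N).exists_bound_of_continuousOn
    hv.continuousOn
  refine ⟨M, fun y => ?_⟩
  obtain ⟨k, hk⟩ := exists_norm_add_latticeVec_le y
  rw [← hper y k]
  exact hM _ (by rwa [Metric.mem_closedBall, dist_zero_right])

lemma exists_forall_le_of_periodic {N : ℕ} {v : Space N → ℝ} (hv : Continuous v)
    (hper : ∀ y (k : Fin N → ℤ), v (y + latticeVec k) = v y) : ∃ z, ∀ y, v z ≤ v y := by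
  obtain ⟨z, -, hz⟩ := (isCompact_closedBall (0 : Space N) √N).exists_isMinOn
    ⟨0, Metric.mem_closedBall_self (Real.sqrt_nonneg _)⟩ hv.continuousOn
  refine ⟨z, fun y => ?_⟩
  obtain ⟨k, hk⟩ := exists_norm_add_latticeVec_le y
  rw [← hper y k]
  exact isMinOn_iff.1 hz _ (by rwa [Metric.mem_closedBall, dist_zero_right])

lemma sub_le_of_periodic {N : ℕ} {v : Space N → ℝ} {Λ : ℝ} (hΛ : 0 ≤ Λ)
    (hper : ∀ y (k : Fin N → ℤ), v (y + latticeVec k) = v y)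
    (hL : ∀ x y, v x - v y ≤ Λ * ‖x - y‖) (x y : Space N) : v x - v y ≤ Λ * (2 * √N) := by
  obtain ⟨k, hk⟩ := exists_norm_add_latticeVec_le x
  obtain ⟨j, hj⟩ := exists_norm_add_latticeVec_le y
  rw [← hper x k, ← hper y j]
  refine (hL _ _).trans (mul_le_mul_of_nonneg_left ?_ hΛ)
  linarith [norm_sub_le (x + latticeVec k) (y + latticeVec j)]

/-! ### Discounted problem, cell problem and effective Hamiltonian -/

/-- The quantitative assumptions on the Hamiltonian, with named constants. -/
structure HamiltonianBounds {N : ℕ} (H : Space N → Space N → ℝ) (C c₀ S : ℝ) : Prop where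
  C_nonneg : 0 ≤ C
  c₀_pos : 0 < c₀
  S_nonneg : 0 ≤ S
  lipschitz : ∀ x y p q, |H x p - H y q| ≤ C * (‖x - y‖ + ‖p - q‖)
  growth : ∀ x p, c₀⁻¹ * ‖p‖ - c₀ ≤ H x p
  bound : ∀ x, |H x 0| ≤ S
  periodic : ∀ (y p : Space N) (k : Fin N → ℤ), H (y + latticeVec k) p = H y p

lemma Assumptions.exists_bounds {N : ℕ} {H : Space N → Space N → ℝ} {u₀ : Space N → ℝ}
    (hA : Assumptions H u₀) : ∃ C c₀ S, HamiltonianBounds H C c₀ S := by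
  obtain ⟨C, hC, hL⟩ := hA.lipschitz
  obtain ⟨c₀, hc₀, hG⟩ := hA.linear_growth
  obtain ⟨S, hS⟩ := exists_abs_le_of_periodic (v := fun y => H y 0)
    (hA.continuous.comp (f := fun y : Space N => (y, (0 : Space N))) (by fun_prop))
    fun y k => hA.periodic y 0 k
  exact ⟨C, c₀, S, hC.le, hc₀, (abs_nonneg _).trans (hS 0), hL, hG, hS, hA.periodic⟩

namespace HamiltonianBounds

variable {N : ℕ} {H : Space N → Space N → ℝ} {C c₀ S : ℝ}

lemma abs_le (hH : HamiltonianBounds H C c₀ S) (y p : Space N) : |H y p| ≤ S + C * ‖p‖ := by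
  have h1 := hH.lipschitz y y p 0
  rw [sub_self, norm_zero, zero_add, sub_zero] at h1
  have h2 := hH.bound y
  have := abs_sub_abs_le_abs_sub (H y p) (H y 0)
  linarith

/-- A bound for the gradients of solutions of the discounted and of the cell problem. -/
lemma norm_le_of_le (hH : HamiltonianBounds H C c₀ S) {y P q : Space N}
    (h : H y (P + q) ≤ S + C * ‖P‖) : ‖q‖ ≤ c₀ * (c₀ + S + C * ‖P‖) + ‖P‖ := by
  have h1 := (hH.growth y (P + q)).trans h
  have h2 : ‖P + q‖ ≤ c₀ * (c₀ + S + C * ‖P‖) := by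
    rw [← inv_mul_le_iff₀ hH.c₀_pos]
    linarith
  have h3 := norm_sub_le (P + q) P
  rw [add_sub_cancel_left] at h3
  linarith

lemma comparison_hyp (hH : HamiltonianBounds H C c₀ S) (P Q : Space N) {h : Space N}
    (hper : ∀ y p, H (y + h) p = H y p) (x y p q : Space N) :
    H y (Q + p) - H x (P + q) ≤ C * ‖P - Q‖ + C * (‖x - y - h‖ + ‖p - q‖) := by
  have h1 := (_root_.abs_le.1 (hH.lipschitz (y + h) x (Q + p) (P + q))).2
  rw [hper] at h1
  have h2 : ‖y + h - x‖ = ‖x - y - h‖ := by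
    rw [norm_sub_rev, show x - (y + h) = x - y - h by abel]
  have h3 : ‖Q + p - (P + q)‖ ≤ ‖P - Q‖ + ‖p - q‖ := by
    rw [show Q + p - (P + q) = -(P - Q) + (p - q) by abel, ← norm_neg (P - Q)]
    exact norm_add_le _ _
  have h4 := mul_le_mul_of_nonneg_left h3 hH.C_nonneg
  rw [h2] at h1
  linarith

/-- Two uses in one statement: `h = 0` gives the dependence on `P`, while `P = Q` with `h` a lattice
vector gives periodicity. -/
lemma discounted_sub (hH : HamiltonianBounds H C c₀ S) {l : ℝ} (hl : 0 < l) {P Q : Space N}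
    {v w : Space N → ℝ} (hv : IsDiscountedSolution H l P v) (hw : IsDiscountedSolution H l Q w)
    {h : Space N} (hper : ∀ y p, H (y + h) p = H y p) (y : Space N) :
    l * (v (y + h) - w y) ≤ C * ‖P - Q‖ := by
  obtain ⟨M₁, hM₁⟩ := hv.1
  obtain ⟨M₂, hM₂⟩ := hw.1
  exact mul_sub_le_of_stationarySub_stationarySuper (F := fun y q => H y (P + q))
    (G := fun y q => H y (Q + q)) (M := max M₁ M₂) hl h hv.2.1
    (fun x => (hM₁ x).trans (le_max_left _ _)) hw.2.1 (fun x => (hM₂ x).trans (le_max_right _ _))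
    hv.2.2.1 hw.2.2.2 hH.C_nonneg (hH.comparison_hyp P Q hper) y

lemma abs_discounted_sub (hH : HamiltonianBounds H C c₀ S) {l : ℝ} (hl : 0 < l) {P Q : Space N}
    {v w : Space N → ℝ} (hv : IsDiscountedSolution H l P v) (hw : IsDiscountedSolution H l Q w)
    (y : Space N) : l * |v y - w y| ≤ C * ‖P - Q‖ := by
  have h1 := hH.discounted_sub hl hv hw (h := 0) (by simp) y
  have h2 := hH.discounted_sub hl hw hv (h := 0) (by simp) y
  rw [add_zero] at h1 h2
  rw [norm_sub_rev] at h2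
  rcases abs_cases (v y - w y) with h | h <;> rw [h.1]
  · exact h1
  · rwa [neg_sub]

lemma discounted_periodic (hH : HamiltonianBounds H C c₀ S) {l : ℝ} (hl : 0 < l) {P : Space N}
    {v : Space N → ℝ} (hv : IsDiscountedSolution H l P v) (y : Space N) (k : Fin N → ℤ) :
    v (y + latticeVec k) = v y := by
  have h1 := hH.discounted_sub hl hv hv (h := latticeVec k) (fun y p => hH.periodic y p k) y
  have h2 := hH.discounted_sub hl hv hv (h := -latticeVec k) (fun y p => by
    rw [← hH.periodic _ p k, neg_add_cancel_right]) (y + latticeVec k)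
  rw [sub_self, norm_zero, mul_zero] at h1 h2
  rw [add_neg_cancel_right] at h2
  have h3 := nonpos_of_mul_nonpos_right h1 hl
  have h4 := nonpos_of_mul_nonpos_right h2 hl
  linarith

/-- The constants `±(S + C * ‖P‖) / l` are a supersolution and a subsolution. -/
lemma abs_mul_discounted_le (hH : HamiltonianBounds H C c₀ S) {l : ℝ} (hl : 0 < l) {P : Space N}
    {v : Space N → ℝ} (hv : IsDiscountedSolution H l P v) (y : Space N) :
    |l * v y| ≤ S + C * ‖P‖ := by
  obtain ⟨M, hM⟩ := hv.1
  set B := S + C * ‖P‖ with hB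
  have hB0 : 0 ≤ B := (abs_nonneg _).trans (hH.abs_le y P)
  set M' := max M (B / l)
  have hlB : l * (B / l) = B := mul_div_cancel₀ _ hl.ne'
  have hB' : ∀ s : ℝ, |s| = 1 → ∀ _ : Space N, |s * (B / l)| ≤ M' := fun s hs _ => by
    rw [abs_mul, hs, one_mul, abs_of_nonneg (div_nonneg hB0 hl.le)]
    exact le_max_right _ _
  have h1 := mul_sub_le_of_stationarySub_stationarySuper (F := fun y q => H y (P + q))
    (G := fun y q => H y (P + q)) (M := M') (w := fun _ => 1 * (B / l)) hl 0 hv.2.1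
    (fun x => (hM x).trans (le_max_left _ _)) continuous_const (hB' 1 (by simp)) hv.2.2.1
    (stationarySuper_const fun y => by
      rw [one_mul, hlB, add_zero]; linarith [(_root_.abs_le.1 (hH.abs_le y P)).1])
    hH.C_nonneg (hH.comparison_hyp P P (by simp)) y
  have h2 := mul_sub_le_of_stationarySub_stationarySuper (F := fun y q => H y (P + q))
    (G := fun y q => H y (P + q)) (M := M') (v := fun _ => -1 * (B / l)) hl 0 continuous_const
    (hB' (-1) (by simp)) hv.2.1 (fun x => (hM x).trans (le_max_left _ _))
    (stationarySub_const fun y => by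
      rw [neg_one_mul, mul_neg, hlB, add_zero]; linarith [(_root_.abs_le.1 (hH.abs_le y P)).2])
    hv.2.2.2 hH.C_nonneg (hH.comparison_hyp P P (by simp)) y
  rw [sub_self, norm_zero, mul_zero, mul_sub, add_zero, one_mul, hlB] at h1
  rw [sub_self, norm_zero, mul_zero, mul_sub, neg_one_mul, mul_neg, hlB] at h2
  rw [_root_.abs_le]
  constructor <;> linarith

/-- The Lipschitz constant of solutions of the discounted and of the cell problem. -/
noncomputable def lipConst (C c₀ S : ℝ) (P : Space N) : ℝ := 2 * (c₀ * (c₀ + S + C * ‖P‖) + ‖P‖ + 1)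

lemma gradient_bound_nonneg (hH : HamiltonianBounds H C c₀ S) (P : Space N) :
    0 ≤ c₀ * (c₀ + S + C * ‖P‖) + ‖P‖ := by
  have := hH.C_nonneg; have := hH.c₀_pos; have := hH.S_nonneg
  positivity

lemma lipConst_nonneg (hH : HamiltonianBounds H C c₀ S) (P : Space N) : 0 ≤ lipConst C c₀ S P := by
  have := hH.gradient_bound_nonneg P
  unfold lipConst; linarith

/-- At a test gradient `q` the subsolution inequality and the bound for `l * v` give `H y (P + q) ≤
S + C * ‖P‖`, and coercivity bounds `q` independently of `l`. -/
lemma discounted_sub_le (hH : HamiltonianBounds H C c₀ S) {l : ℝ} (hl : 0 < l) {P : Space N}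
    {v : Space N → ℝ} (hv : IsDiscountedSolution H l P v) (x y : Space N) :
    v x - v y ≤ lipConst C c₀ S P * ‖x - y‖ := by
  obtain ⟨M, hM⟩ := hv.1
  refine sub_le_mul_norm_of_gradient_le (hH.gradient_bound_nonneg P) hv.2.1 hM
    (fun φ hφ z hz => ?_) x y
  have h1 := hv.2.2.1 φ hφ z hz
  have h2 := (_root_.abs_le.1 (hH.abs_mul_discounted_le hl hv z)).1
  exact hH.norm_le_of_le (y := z) (by linarith)

/-- The cell problem is solvable: the discounted solutions converge along an ultrafilter. -/
theorem exists_cellSolvable (hH : HamiltonianBounds H C c₀ S) {P : Space N}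
    {v : ℝ → Space N → ℝ} (hv : ∀ l > 0, IsDiscountedSolution H l P (v l)) :
    ∃ c, CellSolvable H P c := by
  -- An ultrafilter finer than `atTop` replaces the extraction of subsequences: bounded sequences
  -- converge along it, and the common Lipschitz bound passes to the limit.
  set U : Ultrafilter ℕ := hyperfilter ℕ
  have hU : (U : Filter ℕ) ≤ atTop := Nat.hyperfilter_le_atTop
  set l : ℕ → ℝ := fun n => ((n : ℝ) + 1)⁻¹ with hl
  have hl0 : ∀ n, 0 < l n := fun n => by positivity
  have hllim : Tendsto l U (𝓝 0) := (tendsto_inv_atTop_zero.comp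
    (tendsto_natCast_atTop_atTop.atTop_add tendsto_const_nhds)).mono_left hU
  set Λ := lipConst C c₀ S P with hΛ
  set wn : ℕ → Space N → ℝ := fun n y => v (l n) y - v (l n) 0 with hwn
  have hwnL : ∀ n x y, |wn n x - wn n y| ≤ Λ * ‖x - y‖ := fun n x y => by
    have h1 := hH.discounted_sub_le (hl0 n) (hv _ (hl0 n)) x y
    have h2 := hH.discounted_sub_le (hl0 n) (hv _ (hl0 n)) y x
    rw [norm_sub_rev] at h2
    rw [_root_.abs_le]
    simp only [hwn]
    constructor <;> linarith
  have hcpt : ∀ (a : ℕ → ℝ) (B : ℝ), (∀ n, |a n| ≤ B) → ∃ b, Tendsto a U (𝓝 b) := fun a B hB => by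
    obtain ⟨b, -, hb⟩ := (isCompact_Icc (a := -B) (b := B)).ultrafilter_le_nhds (U.map a)
      (tendsto_principal.2 (Eventually.of_forall fun n => _root_.abs_le.1 (hB n)))
    exact ⟨b, hb⟩
  have hwlim : ∀ y, ∃ b, Tendsto (fun n => wn n y) U (𝓝 b) := fun y =>
    hcpt _ (Λ * ‖y - 0‖) fun n => by simpa [hwn] using hwnL n y 0
  choose w hw using hwlim
  obtain ⟨b, hb⟩ := hcpt (fun n => l n * v (l n) 0) _
    fun n => hH.abs_mul_discounted_le (hl0 n) (hv _ (hl0 n)) 0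
  have hwL : ∀ x y, |w x - w y| ≤ Λ * ‖x - y‖ := fun x y =>
    le_of_tendsto' ((hw x).sub (hw y)).abs fun n => hwnL n x y
  have hwc : Continuous w := by
    have : LipschitzWith (Real.toNNReal Λ) w := LipschitzWith.of_dist_le_mul fun x y => by
      rw [Real.dist_eq, dist_eq_norm]
      exact (hwL x y).trans (mul_le_mul_of_nonneg_right (Real.le_coe_toNNReal Λ) (norm_nonneg _))
    exact this.continuous
  have hHc : Continuous (Function.uncurry H) := by
    have : LipschitzWith (Real.toNNReal (2 * C)) (Function.uncurry H) :=
      LipschitzWith.of_dist_le_mul fun z z' => by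
        rw [Real.dist_eq, Prod.dist_eq, dist_eq_norm, dist_eq_norm,
          Real.coe_toNNReal _ (by have := hH.C_nonneg; linarith), mul_comm 2 C, mul_assoc]
        refine (hH.lipschitz _ _ _ _).trans (mul_le_mul_of_nonneg_left ?_ hH.C_nonneg)
        linarith [le_max_left ‖z.1 - z'.1‖ ‖z.2 - z'.2‖, le_max_right ‖z.1 - z'.1‖ ‖z.2 - z'.2‖]
    exact this.continuous
  have hgrad : ∀ (φ : Space N → ℝ), ContDiff ℝ 1 φ → ∀ y z, gradient (fun z => φ z
      + 1 * ‖z - y‖ ^ 2) z = gradient φ z + (2 : ℝ) • (z - y) := fun φ hφ y z => by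
    rw [(HasGradientAt.add' ((hφ.differentiable (by norm_num)) z).hasGradientAt
      (HasGradientAt.const_mul' 1 (hasGradientAt_norm_sub_sq y z))).gradient, one_smul]
  have hsm : ∀ (φ : Space N → ℝ), ContDiff ℝ 1 φ → ∀ y,
      ContDiff ℝ 1 (fun z => φ z + 1 * ‖z - y‖ ^ 2) := fun φ hφ y =>
    hφ.add (contDiff_const.mul ((contDiff_id.sub contDiff_const).norm_sq ℝ))
  have hlimH : ∀ (φ : Space N → ℝ), ContDiff ℝ 1 φ → ∀ (y : Space N) (yn : ℕ → Space N),
      Tendsto yn U (𝓝 y) → Tendsto (fun n => wn n (yn n)) U (𝓝 (w y)) →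
      Tendsto (fun n => l n * v (l n) (yn n) +
        H (yn n) (P + (gradient φ (yn n) + (2 : ℝ) • (yn n - y)))) U
        (𝓝 (b + H y (P + gradient φ y))) := fun φ hφ y yn hyn hwyn => by
    have hgc : Continuous (gradient φ) := by
      have := hφ.continuous_fderiv (by norm_num)
      exact (LinearIsometryEquiv.continuous _).comp this
    have h1 : Tendsto (fun n => P + (gradient φ (yn n) + (2 : ℝ) • (yn n - y))) U
        (𝓝 (P + (gradient φ y + (2 : ℝ) • (y - y)))) :=
      ((((hgc.tendsto y).comp hyn)).add ((hyn.sub_const y).const_smul (2 : ℝ))).const_add P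
    rw [sub_self, smul_zero, add_zero] at h1
    have h2 := (hHc.tendsto (y, P + gradient φ y)).comp (hyn.prodMk_nhds h1)
    have h3 := hb.add (hllim.mul hwyn)
    rw [zero_mul, add_zero] at h3
    refine Tendsto.add (h3.congr fun n => ?_) h2
    simp only [hwn]; ring
  refine ⟨-b, w, fun y k => ?_, hwc, fun φ hφ y hy => ?_, fun φ hφ y hy => ?_⟩
  · refine tendsto_nhds_unique (hw _) ((hw y).congr fun n => ?_)
    simp only [hwn]
    rw [hH.discounted_periodic (hl0 n) (hv _ (hl0 n))]
  · obtain ⟨yn, hyn, hwyn, hmax⟩ := exists_tendsto_isLocalMax hwnL hw hφ.continuous hy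
    have h1 : b + H y (P + gradient φ y) ≤ 0 := by
      refine le_of_tendsto (hlimH φ hφ y yn hyn hwyn) (hmax.mono fun n hn => ?_)
      have hn' : IsLocalMax (fun z => v (l n) z - (φ z + 1 * ‖z - y‖ ^ 2)) (yn n) :=
        hn.mono fun z hz => by simp only [hwn] at hz; linarith
      have := (hv _ (hl0 n)).2.2.1 _ (hsm φ hφ y) (yn n) hn'
      rwa [hgrad φ hφ] at this
    linarith
  · have hy' : IsLocalMax (fun z => -w z - -φ z) y := hy.mono fun z hz => by
      dsimp only at hz; linarith
    obtain ⟨yn, hyn, hwyn, hmax⟩ := exists_tendsto_isLocalMax (wn := fun n z => -wn n z)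
      (fun n x y => by rw [← neg_sub', abs_neg]; exact hwnL n x y) (fun z => (hw z).neg)
      hφ.neg.continuous hy'
    have hwyn' : Tendsto (fun n => wn n (yn n)) U (𝓝 (w y)) := by simpa using hwyn.neg
    -- For `-w` the strictness penalty enters the gradient with the opposite sign; Lipschitz
    -- continuity of `H` shows that this does not affect the limit.
    have hl2 : Tendsto (fun n => l n * v (l n) (yn n) +
        H (yn n) (P + (gradient φ (yn n) + -((2 : ℝ) • (yn n - y))))) U
        (𝓝 (b + H y (P + gradient φ y))) := by
      have h1 := hlimH φ hφ y yn hyn hwyn'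
      have h2 : Tendsto (fun n => C * (2 * (2 * ‖yn n - y‖))) U (𝓝 0) := by
        have := (((tendsto_iff_norm_sub_tendsto_zero.1 hyn).const_mul 2).const_mul 2).const_mul C
        rwa [mul_zero, mul_zero, mul_zero] at this
      have h3 : Tendsto (fun n => H (yn n) (P + (gradient φ (yn n) + -((2 : ℝ) • (yn n - y)))) -
          H (yn n) (P + (gradient φ (yn n) + (2 : ℝ) • (yn n - y)))) U (𝓝 0) := by
        refine squeeze_zero_norm (fun n => ?_) h2
        refine (hH.lipschitz _ _ _ _).trans (mul_le_mul_of_nonneg_left ?_ hH.C_nonneg)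
        rw [sub_self, norm_zero, zero_add, show P + (gradient φ (yn n) + -((2 : ℝ) • (yn n - y))) -
          (P + (gradient φ (yn n) + (2 : ℝ) • (yn n - y))) = (-(2 * 2 : ℝ)) • (yn n - y) by module,
          norm_smul]
        norm_num
        linarith [norm_nonneg (yn n - y)]
      have h4 := h1.add h3
      rw [add_zero] at h4
      exact h4.congr fun n => by ring
    have h1 : 0 ≤ b + H y (P + gradient φ y) := by
      refine ge_of_tendsto hl2 (hmax.mono fun n hn => ?_)
      have hn' : IsLocalMin (fun z => v (l n) z - -(-φ z + 1 * ‖z - y‖ ^ 2)) (yn n) :=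
        hn.mono fun z hz => by simp only [hwn] at hz; linarith
      have := (hv _ (hl0 n)).2.2.2 _ (hsm (fun z => -φ z) hφ.neg y).neg (yn n) hn'
      rw [gradient_neg (fun z => -φ z + 1 * ‖z - y‖ ^ 2), hgrad (fun z => -φ z) hφ.neg,
        gradient_neg φ, neg_add, neg_neg] at this
      exact this
    linarith

/-- The discounted solutions approximate the effective Hamiltonian. -/
theorem abs_discounted_add_le (hH : HamiltonianBounds H C c₀ S) {l c : ℝ} (hl : 0 < l)
    {P : Space N} {v : Space N → ℝ} (hv : IsDiscountedSolution H l P v)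
    (hc : CellSolvable H P c) (y : Space N) :
    |l * v y + c| ≤ l * (2 * (lipConst C c₀ S P * (2 * √N))) := by
  obtain ⟨w, hper, hw⟩ := hc
  obtain ⟨Mw, hMw⟩ := exists_abs_le_of_periodic hw.1 hper
  obtain ⟨Mv, hMv⟩ := hv.1
  -- A constant touches the corrector from below at its minimum, so `c ≤ H z P`. Hence the corrector
  -- has the same gradient bound as the discounted solutions.
  have hcB : c ≤ S + C * ‖P‖ := by
    obtain ⟨z, hz⟩ := exists_forall_le_of_periodic hw.1 hper
    have h1 := hw.2.2 (fun _ => 0) contDiff_const z (Eventually.of_forall fun y => by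
      simpa using hz y)
    rw [(hasGradientAt_const z (0 : ℝ)).gradient] at h1
    dsimp only at h1
    rw [add_zero] at h1
    linarith [(_root_.abs_le.1 (hH.abs_le z P)).2]
  have hwL := sub_le_mul_norm_of_gradient_le (hH.gradient_bound_nonneg P) hw.1 hMw
    fun φ hφ z hz => hH.norm_le_of_le (y := z) (by linarith [hw.2.1 φ hφ z hz])
  set O := lipConst C c₀ S P * (2 * √N) with hO
  have hosc : ∀ x y, w x - w y ≤ O := sub_le_of_periodic (hH.lipConst_nonneg P) hper hwL
  set M := max Mv (Mw + |w 0| + |O| + |c / l|) with hM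
  have hshift : ∀ s : ℝ, |s| ≤ |O| → ∀ x, |w x - w 0 + s - c / l| ≤ M := fun s hs x => by
    refine le_trans ?_ (le_max_right _ _)
    have e1 := abs_sub (w x - w 0 + s) (c / l)
    have e2 := abs_add_le (w x - w 0) s
    have e3 := abs_sub (w x) (w 0)
    linarith [hMw x]
  have hcont : ∀ s : ℝ, Continuous fun x => w x - w 0 + s - c / l := fun s => by
    have := hw.1; fun_prop
  have hlc : l * (c / l) = c := mul_div_cancel₀ _ hl.ne'
  -- The corrector, normalized at `0`, lowered by its oscillation bound `O` and shifted by `-c / l`,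
  -- is a discounted subsolution; raised by `O` it is a supersolution. Trapping `v` between them
  -- costs `2 * O`.
  have h1 := mul_sub_le_of_stationarySub_stationarySuper (F := fun y q => H y (P + q))
    (G := fun y q => H y (P + q)) (M := M) (v := fun x => w x - w 0 + -O - c / l) hl 0
    (hcont _) (hshift _ (by rw [abs_neg])) hv.2.1 (fun x => (hMv x).trans (le_max_left _ _))
    (fun φ hφ z hz => by
      have e1 := hw.2.1 φ hφ z (hz.mono fun x hx => by dsimp only at hx; linarith)
      have e2 : l * (w z - w 0 + -O) ≤ 0 :=
        mul_nonpos_of_nonneg_of_nonpos hl.le (by linarith [hosc z 0])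
      dsimp only at e1 ⊢
      rw [mul_sub, hlc]
      linarith)
    hv.2.2.2 hH.C_nonneg (hH.comparison_hyp P P (by simp)) y
  have h2 := mul_sub_le_of_stationarySub_stationarySuper (F := fun y q => H y (P + q))
    (G := fun y q => H y (P + q)) (M := M) (w := fun x => w x - w 0 + O - c / l) hl 0
    hv.2.1 (fun x => (hMv x).trans (le_max_left _ _)) (hcont _) (hshift _ le_rfl)
    hv.2.2.1 (fun φ hφ z hz => by
      have e1 := hw.2.2 φ hφ z (hz.mono fun x hx => by dsimp only at hx; linarith)
      have e2 : 0 ≤ l * (w z - w 0 + O) := mul_nonneg hl.le (by linarith [hosc 0 z])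
      dsimp only at e1 ⊢
      rw [mul_sub, hlc]
      linarith)
    hH.C_nonneg (hH.comparison_hyp P P (by simp)) y
  rw [sub_self, norm_zero, mul_zero, add_zero, mul_sub, mul_sub, hlc] at h1
  rw [sub_self, norm_zero, mul_zero, add_zero, mul_sub, mul_sub, hlc] at h2
  have e1 : l * (w y - w 0 + O) ≤ l * (2 * O) :=
    mul_le_mul_of_nonneg_left (by linarith [hosc y 0]) hl.le
  have e2 : l * (-(2 * O)) ≤ l * (w y - w 0 + -O) :=
    mul_le_mul_of_nonneg_left (by linarith [hosc 0 y]) hl.le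
  rw [mul_neg] at e2
  rw [_root_.abs_le]
  constructor <;> linarith

/-- The effective Hamiltonian is Lipschitz continuous. -/
theorem abs_cell_sub_le (hH : HamiltonianBounds H C c₀ S) {P Q : Space N} {c d : ℝ}
    {v : ℝ → Space N → Space N → ℝ} (hv : ∀ l > 0, ∀ P, IsDiscountedSolution H l P (fun y => v l y P))
    (hc : CellSolvable H P c) (hd : CellSolvable H Q d) : |c - d| ≤ C * ‖P - Q‖ := by
  set E := 2 * (lipConst C c₀ S P * (2 * √N)) + 2 * (lipConst C c₀ S Q * (2 * √N)) with hE
  -- The discounted estimate in `P` has the same constant `C` for every `l`, so it survives the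
  -- limit `l → 0`.
  have hkey : ∀ n : ℕ, |c - d| ≤ C * ‖P - Q‖ + ((n : ℝ) + 1)⁻¹ * E := fun n => by
    have hl : 0 < ((n : ℝ) + 1)⁻¹ := by positivity
    set l := ((n : ℝ) + 1)⁻¹
    have h1 := hH.abs_discounted_add_le hl (hv l hl P) hc 0
    have h2 := hH.abs_discounted_add_le hl (hv l hl Q) hd 0
    have h3 := hH.abs_discounted_sub hl (hv l hl P) (hv l hl Q) 0
    have h4 : c - d = (l * v l 0 P + c) - (l * v l 0 Q + d) - l * (v l 0 P - v l 0 Q) := by ring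
    have h5 := abs_sub ((l * v l 0 P + c) - (l * v l 0 Q + d)) (l * (v l 0 P - v l 0 Q))
    have h6 := abs_sub (l * v l 0 P + c) (l * v l 0 Q + d)
    rw [← h4, abs_mul, abs_of_pos hl] at h5
    rw [hE, mul_add]
    linarith
  have hlim : Tendsto (fun n : ℕ => C * ‖P - Q‖ + ((n : ℝ) + 1)⁻¹ * E) atTop
      (𝓝 (C * ‖P - Q‖ + 0 * E)) :=
    ((tendsto_inv_atTop_zero.comp
      (tendsto_natCast_atTop_atTop.atTop_add tendsto_const_nhds)).mul_const E).const_add _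
  rw [zero_mul, add_zero] at hlim
  exact ge_of_tendsto' hlim hkey

end HamiltonianBounds

/-! ### Tools for the maximum point of the auxiliary function -/

/-- First order condition at a minimum point of a quadratic function perturbed by a Lipschitz
function. -/
lemma norm_smul_sub_sub_smul_le {N : ℕ} {a b Λ : ℝ} {x y : Space N} (hΛ : 0 ≤ Λ)
    (h : ∀ z, a / 2 * ‖x - y‖ ^ 2 + b / 2 * ‖y‖ ^ 2 ≤
      a / 2 * ‖x - z‖ ^ 2 + b / 2 * ‖z‖ ^ 2 + Λ * ‖z - y‖) :
    ‖a • (x - y) - b • y‖ ≤ Λ := by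
  set G := a • (x - y) - b • y with hG
  rcases eq_or_ne G 0 with h0 | h0
  · rwa [h0, norm_zero]
  have hpos : 0 < ‖G‖ := norm_pos_iff.2 h0
  have hGG : ‖G‖ ^ 2 = a * inner ℝ (x - y) G - b * inner ℝ y G := by
    rw [← real_inner_self_eq_norm_sq]
    nth_rewrite 1 [hG]
    rw [inner_sub_left, real_inner_smul_left, real_inner_smul_left]
  have key : ‖G‖ ^ 2 ≤ Λ * ‖G‖ := by
    -- The minimum is tested in the direction of `G` itself, at `y + s • G` with `s → 0`.
    refine le_of_forall_nat_sqrt (E := 0) (M := (a + b) / 2 * ‖G‖ ^ 2) fun k => ?_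
    have hs : 0 < ((k : ℝ) + 1)⁻¹ := by positivity
    set s := ((k : ℝ) + 1)⁻¹
    have h1 := h (y + s • G)
    have e1 : ‖x - (y + s • G)‖ ^ 2 =
        ‖x - y‖ ^ 2 - 2 * (s * inner ℝ (x - y) G) + s ^ 2 * ‖G‖ ^ 2 := by
      rw [← sub_sub, norm_sub_sq_real, real_inner_smul_right, norm_smul, Real.norm_eq_abs,
        abs_of_pos hs, mul_pow]
    have e2 : ‖y + s • G‖ ^ 2 = ‖y‖ ^ 2 + 2 * (s * inner ℝ y G) + s ^ 2 * ‖G‖ ^ 2 := by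
      rw [norm_add_sq_real, real_inner_smul_right, norm_smul, Real.norm_eq_abs,
        abs_of_pos hs, mul_pow]
    rw [e1, e2, add_sub_cancel_left, norm_smul, Real.norm_eq_abs, abs_of_pos hs] at h1
    have h2 : s * ‖G‖ ^ 2 ≤ s * (Λ * ‖G‖ + (a + b) / 2 * ‖G‖ ^ 2 * s) := by
      rw [hGG]
      rw [hGG] at h1
      linarith
    have h3 := le_of_mul_le_mul_left h2 hs
    linarith
  rw [sq] at key
  exact le_of_mul_le_mul_right key hpos

/-- The supersolution inequality for the rescaled discounted solution. -/
lemma IsDiscountedSolution.nonneg_of_min {N : ℕ} {H : Space N → Space N → ℝ} {l ε c : ℝ}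
    (hε : 0 < ε) {P x z : Space N} {v : Space N → ℝ} (hv : IsDiscountedSolution H l P v)
    (hz : ∀ z', ε * v (ε⁻¹ • z) + c / 2 * ‖x - z‖ ^ 2 ≤
      ε * v (ε⁻¹ • z') + c / 2 * ‖x - z'‖ ^ 2) :
    0 ≤ l * v (ε⁻¹ • z) + H (ε⁻¹ • z) (P + c • (x - z)) := by
  -- Substituting `z' = ε • ζ` and dividing by `ε` turns `c / 2 * ‖x - z'‖ ^ 2` into `c * ε / 2 * ‖ζ
  -- - ε⁻¹ • x‖ ^ 2`, whose negative touches `v` from below.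
  have hg := HasGradientAt.const_mul' (-(c * ε / 2))
    (hasGradientAt_norm_sub_sq (ε⁻¹ • x) (ε⁻¹ • z))
  have h := hv.2.2.2 (fun ζ => -(c * ε / 2) * ‖ζ - ε⁻¹ • x‖ ^ 2)
    (contDiff_const.mul ((contDiff_id.sub contDiff_const).norm_sq ℝ)) (ε⁻¹ • z)
    (Eventually.of_forall fun ζ => by
      have e : ∀ ζ : Space N, ‖x - ε • ζ‖ ^ 2 = ε ^ 2 * ‖ζ - ε⁻¹ • x‖ ^ 2 := fun ζ => by
        rw [show x - ε • ζ = (-ε) • (ζ - ε⁻¹ • x) by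
          rw [smul_sub, smul_smul, neg_mul, mul_inv_cancel₀ hε.ne']; module, norm_smul, mul_pow,
          norm_neg, Real.norm_eq_abs, sq_abs]
      have h1 := hz (ε • ζ)
      have h2 := e (ε⁻¹ • z)
      rw [smul_smul, mul_inv_cancel₀ hε.ne', one_smul] at h2
      rw [h2, e ζ, smul_smul, inv_mul_cancel₀ hε.ne', one_smul] at h1
      have h3 : ε * (v (ε⁻¹ • z) + c * ε / 2 * ‖ε⁻¹ • z - ε⁻¹ • x‖ ^ 2) ≤
          ε * (v ζ + c * ε / 2 * ‖ζ - ε⁻¹ • x‖ ^ 2) := by linarith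
      have h4 := le_of_mul_le_mul_left h3 hε
      linarith)
  rw [hg.gradient, smul_smul, ← smul_sub, smul_smul,
    show -(c * ε / 2) * 2 * ε⁻¹ = -c by field_simp, neg_smul, ← smul_neg, neg_sub] at h
  exact h

lemma lipConst_le {N : ℕ} {C c₀ S : ℝ} (hC : 0 ≤ C) (hc₀ : 0 ≤ c₀) (hS : 0 ≤ S) (P : Space N) :
    2 * (HamiltonianBounds.lipConst C c₀ S P * (2 * √N)) ≤
      8 * √N * (c₀ * (c₀ + S + C) + 2) * (1 + ‖P‖) := by
  have h1 : HamiltonianBounds.lipConst C c₀ S P ≤ 2 * (c₀ * (c₀ + S + C) + 2) * (1 + ‖P‖) := by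
    have e1 : 0 ≤ c₀ * C := by positivity
    have e2 : 0 ≤ c₀ * (c₀ + S) * ‖P‖ := by positivity
    have e3 := norm_nonneg P
    simp only [HamiltonianBounds.lipConst]
    linarith
  have h2 := mul_le_mul_of_nonneg_right h1 (show 0 ≤ 4 * √(N : ℝ) by positivity)
  linarith

end TFHJ

/-! ### The estimate at the maximum point -/

theorem lemma5p2 {N : ℕ} (α T : ℝ) (hα : α ∈ Set.Ioo (0 : ℝ) 1) (hT : 0 < T)
    (H : TFHJ.Space N → TFHJ.Space N → ℝ) (u₀ : TFHJ.Space N → ℝ)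
    (hA : TFHJ.Assumptions H u₀)
    (u : ℝ → TFHJ.Space N → ℝ → ℝ)
    (hu : ∀ ε > 0, TFHJ.IsSolution α T (fun x p => H (ε⁻¹ • x) p) u₀ (u ε))
    (ubar : TFHJ.Space N → ℝ → ℝ)
    (hubar : TFHJ.IsSolution α T (fun _ p => TFHJ.effectiveHamiltonian H p) u₀ ubar)
    (v : ℝ → TFHJ.Space N → TFHJ.Space N → ℝ)
    (hv : ∀ l > 0, ∀ P, TFHJ.IsDiscountedSolution H l P (fun y => v l y P))
    (θ β : ℝ) (hθ : θ ∈ Set.Ioo (0 : ℝ) 1) (hβ : β ∈ Set.Ioo (0 : ℝ) 1) :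
    ∃ ε₀ ∈ Set.Ioo (0 : ℝ) 1, ∀ ν ∈ Set.Ioo (0 : ℝ) 1, ∃ C > 0,
      ∀ ε ∈ Set.Ioo (0 : ℝ) ε₀, ∀ δ ∈ Set.Ioo (0 : ℝ) 1, ∀ R > 0,
        δ ^ (1 / 2 : ℝ) < ε ^ θ →
        ∀ (x₁ y₁ : TFHJ.Space N), ∀ t₁ ∈ Set.Ioc 0 T,
          (∀ (x y : TFHJ.Space N), ∀ t ∈ Set.Icc 0 T,
            TFHJ.Phi α ε β δ R (u ε) ubar (v (ε ^ θ)) x y t ≤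
              TFHJ.Phi α ε β δ R (u ε) ubar (v (ε ^ θ)) x₁ y₁ t₁) →
          TFHJ.KExists α 0 t₁ (fun s => u ε x₁ s - ubar y₁ s) t₁ ∧
          TFHJ.J α (u ε x₁) t₁ - TFHJ.J α (ubar y₁) t₁
              + TFHJ.K α 0 t₁ (fun s => u ε x₁ s - ubar y₁ s) t₁
            ≤ C * (ε ^ (θ - β * (1 - ν) / (2 - ν)) + ε ^ (1 - θ - β)) ∧
          (TFHJ.KExists α 0 t₁ (u ε x₁) t₁ → TFHJ.KExists α 0 t₁ (ubar y₁) t₁ →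
            TFHJ.J α (u ε x₁) t₁ - TFHJ.J α (ubar y₁) t₁
                + TFHJ.K α 0 t₁ (u ε x₁) t₁ - TFHJ.K α 0 t₁ (ubar y₁) t₁
              ≤ C * (ε ^ (θ - β * (1 - ν) / (2 - ν)) + ε ^ (1 - θ - β))) := by
  obtain ⟨C, c₀, S, hH⟩ := hA.exists_bounds
  obtain ⟨M₀, hM₀⟩ := hA.initial_bounded
  obtain ⟨L', hL'⟩ := hA.initial_lipschitz
  obtain ⟨Mb, hMb⟩ := hubar.2.1
  have hC := hH.C_nonneg
  have hS := hH.S_nonneg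
  have hT0 : (0 : ℝ) ∈ Icc 0 T := ⟨le_rfl, hT.le⟩
  have hMb0 : 0 ≤ Mb := (abs_nonneg _).trans (hMb 0 0 hT0)
  set L := (L' : ℝ) with hL
  have hL0 : 0 ≤ L := L'.2
  have hu₀L : ∀ x y, u₀ x - u₀ y ≤ L * ‖x - y‖ := fun x y => by
    have := hL'.dist_le_mul x y
    rw [Real.dist_eq, dist_eq_norm] at this
    exact (le_abs_self _).trans this
  set Hb := TFHJ.effectiveHamiltonian H with hHb
  -- `Classical.epsilon` meets its specification only once some solvable constant exists, whence the
  -- existence theorem.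
  have hcell : ∀ P, TFHJ.CellSolvable H P (Hb P) := fun P =>
    Classical.epsilon_spec (hH.exists_cellSolvable (P := P) (v := fun l y => v l y P)
      fun l hl => hv l hl P)
  have hHbL : ∀ P Q, |Hb P - Hb Q| ≤ C * ‖P - Q‖ := fun P Q =>
    hH.abs_cell_sub_le hv (hcell P) (hcell Q)
  have hubarL : ∀ x y, ∀ t ∈ Icc 0 T, ubar x t - ubar y t ≤ L * ‖x - y‖ := fun x y t ht =>
    hubar.sub_le_mul_norm hα hT hC hL0 hHbL hu₀L x y ht
  set Mu := M₀ + T ^ α * Real.Gamma (1 - α) * S with hMu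
  have huM : ∀ ε > 0, ∀ x, ∀ t ∈ Icc 0 T, |u ε x t| ≤ Mu := fun ε hε x t ht => by
    refine (hu ε hε).abs_le hα hT (C := C * (ε⁻¹ + 1)) (by positivity) (fun x y p q => ?_)
      (fun x => hH.bound _) hM₀ x ht
    refine (hH.lipschitz _ _ _ _).trans ?_
    rw [mul_assoc, ← smul_sub, norm_smul, norm_inv, Real.norm_eq_abs, abs_of_pos hε]
    refine mul_le_mul_of_nonneg_left ?_ hC
    have e1 := norm_nonneg (x - y)
    have e2 : 0 ≤ ε⁻¹ * ‖p - q‖ := by positivity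
    linarith
  have hMu0 : 0 ≤ Mu := (abs_nonneg _).trans (huM 1 one_pos 0 0 hT0)
  set E := 8 * √N * (c₀ * (c₀ + S + C) + 2) with hE
  have hE0 : 0 ≤ E := by have := hH.c₀_pos; positivity
  set D := √(4 * (Mu + Mb + S)) with hD
  have hD0 : 0 ≤ D := Real.sqrt_nonneg _
  have hD2 : D ^ 2 = 4 * (Mu + Mb + S) := Real.sq_sqrt (by positivity)
  -- The threshold serves only to ensure `ε < 1`, and the constant is the same for all `ν`. Its last
  -- summand `1` makes it positive.
  refine ⟨1 / 2, by norm_num, fun ν hν =>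
    ⟨C * D + E * (1 + L + D) + (3 * C ^ 2 + 2 * (E * C)) + 1, by positivity, ?_⟩⟩
  intro ε hε δ hδ R hR hδε x₁ y₁ t₁ ht₁ hmax
  have hε0 : 0 < ε := hε.1
  have hε1 : ε < 1 := hε.2.trans (by norm_num)
  have ht₁' : t₁ ∈ Icc 0 T := ⟨ht₁.1.le, ht₁.2⟩
  set X := ε ^ θ with hX
  set Y := ε ^ (1 - θ - β) with hY
  set q := ε ^ β with hq
  have hX0 : 0 < X := Real.rpow_pos_of_pos hε0 _
  have hY0 : 0 < Y := Real.rpow_pos_of_pos hε0 _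
  have hq0 : 0 < q := Real.rpow_pos_of_pos hε0 _
  have hX1 : X ≤ 1 := Real.rpow_le_one hε0.le hε1.le hθ.1.le
  have hq1 : q ≤ 1 := Real.rpow_le_one hε0.le hε1.le hβ.1.le
  have hεXYq : ε = Y * q * X := by
    rw [hX, hY, hq, ← Real.rpow_add hε0, ← Real.rpow_add hε0,
      show 1 - θ - β + β + θ = 1 by ring, Real.rpow_one]
  have hδX : δ ≤ X ^ 2 := by
    have h1 : (δ ^ (1 / 2 : ℝ)) ^ 2 = δ := by
      rw [← Real.sqrt_eq_rpow, Real.sq_sqrt hδ.1.le]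
    rw [← h1]
    exact pow_le_pow_left₀ (Real.rpow_nonneg hδ.1.le _) hδε.le 2
  have hvX : ∀ P, TFHJ.IsDiscountedSolution H X P (fun y => v X y P) := hv X hX0
  set P := q⁻¹ • (x₁ - y₁) with hP
  set g : ℝ → ℝ := fun t => R * t ^ α / Real.Gamma (1 + α) with hg
  have hΓ : 0 < Real.Gamma (1 + α) := Real.Gamma_pos_of_pos (by linarith [hα.1])
  have hεv : ∀ P Q ζ, ε * (v X ζ P - v X ζ Q) ≤ C * Y * (q * ‖P - Q‖) := fun P Q ζ => by
    have h1 := hH.abs_discounted_sub hX0 (hvX P) (hvX Q) ζ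
    have h2 := mul_le_mul_of_nonneg_left
      ((mul_le_mul_of_nonneg_left (le_abs_self (v X ζ P - v X ζ Q)) hX0.le).trans h1)
      (mul_pos hY0 hq0).le
    rw [hεXYq]
    linarith
  have hqP : ∀ x y, q * ‖q⁻¹ • (x - y) - P‖ = ‖x - y - (x₁ - y₁)‖ := fun x y => by
    rw [hP, ← smul_sub, norm_smul, norm_inv, Real.norm_eq_abs, abs_of_pos hq0, ← mul_assoc,
      mul_inv_cancel₀ hq0.ne', one_mul]
  -- The corrector is frozen at `P`; by `hεv` and `hqP` the error is at most the cone, which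
  -- vanishes at `(x₁, y₁)`, so the maximum is kept.
  have hmax2 : ∀ x y, ∀ t ∈ Icc 0 T,
      u ε x t - ubar y t - ε * v X (ε⁻¹ • x) P - C * Y * ‖x - y - (x₁ - y₁)‖
        - q⁻¹ / 2 * ‖x - y - 0‖ ^ 2 - δ / 2 * ‖y‖ ^ 2 - g t ≤
      u ε x₁ t₁ - ubar y₁ t₁ - ε * v X (ε⁻¹ • x₁) P
        - q⁻¹ / 2 * ‖x₁ - y₁ - 0‖ ^ 2 - δ / 2 * ‖y₁‖ ^ 2 - g t₁ := fun x y t ht => by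
    have h1 := hmax x y t ht
    have h2 := hεv (q⁻¹ • (x - y)) P (ε⁻¹ • x)
    rw [hqP] at h2
    simp only [TFHJ.Phi] at h1
    have h3 : ∀ r : ℝ, r / (2 * q) = q⁻¹ / 2 * r := fun r => by field_simp
    rw [h3, h3] at h1
    rw [sub_zero, sub_zero]
    simp only [hg]
    linarith
  -- the bound for `δ ‖y₁‖`
  have hδy : δ * ‖y₁‖ ≤ D * X + C * Y := by
    have h1 := hmax 0 0 t₁ ht₁'
    have hεv' : ∀ Q ζ, |ε * v X ζ Q| ≤ Y * q * (S + C * ‖Q‖) := fun Q ζ => by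
      rw [hεXYq, mul_assoc, abs_mul, abs_of_pos (mul_pos hY0 hq0)]
      exact mul_le_mul_of_nonneg_left (hH.abs_mul_discounted_le hX0 (hvX Q) ζ)
        (mul_pos hY0 hq0).le
    have h2 := (abs_le.1 (hεv' P (ε⁻¹ • x₁))).1
    have h3 := (abs_le.1 (hεv' 0 (ε⁻¹ • (0 : TFHJ.Space N)))).2
    simp only [TFHJ.Phi, sub_zero, smul_zero, norm_zero] at h1
    rw [smul_zero, norm_zero, mul_zero, add_zero] at h3
    have h4 : ‖x₁ - y₁‖ ^ 2 / (2 * q) = q * ‖P‖ ^ 2 / 2 := by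
      rw [hP, norm_smul, norm_inv, Real.norm_eq_abs, abs_of_pos hq0]
      field_simp
    -- The corrector is not bounded uniformly in `P`; its linear growth is absorbed by the penalty
    -- `q * ‖P‖ ^ 2 / 2`.
    have h5 : Y * q * (C * ‖P‖) ≤ q * ‖P‖ ^ 2 / 2 + q * (C * Y) ^ 2 / 2 := by
      have := mul_nonneg hq0.le (sq_nonneg (‖P‖ - C * Y))
      linarith
    have h6 : Y * q * S ≤ S := by
      have : Y * q ≤ 1 := by
        rw [hY, hq, ← Real.rpow_add hε0]
        exact Real.rpow_le_one hε0.le hε1.le (by linarith [hθ.2])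
      exact mul_le_of_le_one_left hS this
    have h7 : q * (C * Y) ^ 2 ≤ (C * Y) ^ 2 := mul_le_of_le_one_left (sq_nonneg _) hq1
    have a1 := abs_le.1 (huM ε hε0 0 t₁ ht₁')
    have a2 := abs_le.1 (huM ε hε0 x₁ t₁ ht₁')
    have a3 := abs_le.1 (hMb 0 t₁ ht₁')
    have a4 := abs_le.1 (hMb y₁ t₁ ht₁')
    rw [h4] at h1
    simp only [zero_pow two_ne_zero, mul_zero, zero_div, sub_zero] at h1
    have h8 : δ * ‖y₁‖ ^ 2 ≤ D ^ 2 + (C * Y) ^ 2 := by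
      rw [hD2]
      linarith
    -- Here the smallness condition on `δ` enters, in the form `δ ≤ X ^ 2`.
    have h9 : (δ * ‖y₁‖) ^ 2 ≤ (D * X + C * Y) ^ 2 := by
      have e1 : (δ * ‖y₁‖) ^ 2 = δ * (δ * ‖y₁‖ ^ 2) := by ring
      have e2 : δ * (δ * ‖y₁‖ ^ 2) ≤ X ^ 2 * (D ^ 2 + (C * Y) ^ 2) :=
        mul_le_mul hδX h8 (mul_nonneg hδ.1.le (sq_nonneg _)) (sq_nonneg _)
      have e3 : X ^ 2 * (C * Y) ^ 2 ≤ (C * Y) ^ 2 :=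
        mul_le_of_le_one_left (sq_nonneg _) (pow_le_one₀ hX0.le hX1)
      have e4 : 0 ≤ D * X * (C * Y) := by positivity
      rw [e1]
      linarith
    exact (sq_le_sq₀ (mul_nonneg hδ.1.le (norm_nonneg _)) (by positivity)).1 h9
  -- the bound for `P`
  have hPn : ‖P‖ ≤ L + C * Y + δ * ‖y₁‖ := by
    -- Only `y` varies, and the frozen corrector does not depend on it: the perturbation of the
    -- quadratic terms has slope `L` from `ubar` and `C * Y` from the cone.
    have h1 : ‖q⁻¹ • (x₁ - y₁) - δ • y₁‖ ≤ L + C * Y :=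
      TFHJ.norm_smul_sub_sub_smul_le (by positivity) fun z => by
        have h2 := hmax2 x₁ z t₁ ht₁'
        have h3 := hubarL z y₁ t₁ ht₁'
        rw [sub_zero, sub_zero, show x₁ - z - (x₁ - y₁) = -(z - y₁) by abel, norm_neg] at h2
        linarith
    have h2 := norm_add_le (P - δ • y₁) (δ • y₁)
    rw [sub_add_cancel, norm_smul δ, Real.norm_eq_abs, abs_of_pos hδ.1] at h2
    linarith
  have hvHb : ∀ ζ, |X * v X ζ P + Hb P| ≤ X * (E * (1 + ‖P‖)) := fun ζ =>
    (hH.abs_discounted_add_le hX0 (hvX P) (hcell P) ζ).trans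
      (mul_le_mul_of_nonneg_left (TFHJ.lipConst_le hC hH.c₀_pos.le hS P) hX0.le)
  obtain ⟨Mv, hMv⟩ := (hvX P).1
  have hgc : ContinuousOn g (Icc 0 T) :=
    ((continuousOn_const.mul (continuousOn_id.rpow_const fun t _ => Or.inr hα.1.le)).div_const _)
  have hg1 : ContDiffOn ℝ 1 g (Ioc 0 T) := by
    refine (contDiffOn_const.mul fun t ht => ?_).div_const _
    exact (Real.contDiffAt_rpow_const_of_ne ht.1.ne').contDiffWithinAt
  have hgm : MonotoneOn g (Icc 0 T) := fun s hs t _ hst =>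
    div_le_div_of_nonneg_right
      (mul_le_mul_of_nonneg_left (Real.rpow_le_rpow hs.1 hst hα.1.le) hR.le) hΓ.le
  have hg0 : ∀ t ∈ Icc 0 T, 0 ≤ g t := fun t ht =>
    div_nonneg (mul_nonneg hR.le (Real.rpow_nonneg ht.1 _)) hΓ.le
  have hgT := hg0 T ⟨hT.le, le_rfl⟩
  set M := Mu + Mb + ε * |Mv| + g T with hM
  have hεMv : 0 ≤ ε * |Mv| := by positivity
  -- The factor `ε⁻¹` in `B₁` is harmless: it multiplies distances that vanish in the doubling
  -- limit, taken with `ε` fixed.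
  have hmain := TFHJ.caputo_sub_le_of_max (M := M) (κ := C * Y) (a := q⁻¹) (b := δ) (h := 0)
    (m := C * (δ * ‖y₁‖) + X * (E * (1 + ‖P‖))) (B₁ := C * ε⁻¹) (B₂ := C)
    (V := fun z => ε * v X (ε⁻¹ • z) P) (g := g)
    (F := fun x p => H (ε⁻¹ • x) p) (G := fun _ p => Hb p) hα (by positivity)
    (inv_pos.2 hq0).le hδ.1.le hC (hu ε hε0).1
    (fun x t ht => (huM ε hε0 x t ht).trans (by linarith)) hubar.1
    (fun x t ht => (hMb x t ht).trans (by linarith))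
    (continuous_const.mul ((hvX P).2.1.comp (continuous_const_smul ε⁻¹)))
    (fun x => by
      rw [abs_mul, abs_of_pos hε0]
      have := mul_le_mul_of_nonneg_left ((hMv (ε⁻¹ • x)).trans (le_abs_self Mv)) hε0.le
      linarith) hgc hg1 hgm
    (fun t ht => by
      rw [abs_of_nonneg (hg0 t ht)]
      linarith [hgm ht ⟨hT.le, le_rfl⟩ ht.2])
    (hu ε hε0).2.2.1.2.2 hubar.2.2.2.2.2 ht₁ hmax2 (fun c hc x y z p p' hz => by
      rw [sub_zero]
      -- The chain runs from `Hb p'` to `Hb P`, then to `-X * v` by the discounted approximation, to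
      -- `H` at `ε⁻¹ • z` by the corrector inequality, and to `H` at `ε⁻¹ • x`. The large gradient
      -- `c • (x - z)` cancels in the last step.
      have h1 := (hvX P).nonneg_of_min (v := fun y => v X y P) hε0 hz
      have h2 := (abs_le.1 (hvHb (ε⁻¹ • z))).2
      have h3 := (abs_le.1 (hHbL p' P)).2
      have h4 : ‖p' - P‖ ≤ ‖p' - (P - δ • y₁)‖ + δ * ‖y₁‖ := by
        have := norm_sub_le (p' - (P - δ • y₁)) (δ • y₁)
        rwa [show p' - (P - δ • y₁) - δ • y₁ = p' - P by abel, norm_smul, Real.norm_eq_abs,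
          abs_of_pos hδ.1] at this
      have h5 := (abs_le.1 (hH.lipschitz (ε⁻¹ • z) (ε⁻¹ • x) (P + c • (x - z))
        (c • (x - z) + p))).2
      rw [← smul_sub, norm_smul, norm_inv, Real.norm_eq_abs, abs_of_pos hε0,
        show P + c • (x - z) - (c • (x - z) + p) = -(p - P) by abel, norm_neg] at h5
      have h6 : ‖z - x‖ ≤ ‖x - x₁‖ + ‖y - y₁‖ + ‖z - x₁‖ := by
        have := norm_sub_le_norm_sub_add_norm_sub z x₁ x
        rw [norm_sub_rev x₁ x] at this
        linarith [norm_nonneg (y - y₁)]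
      have h7 := mul_le_mul_of_nonneg_left h6 (show 0 ≤ C * ε⁻¹ by positivity)
      have h8 := mul_le_mul_of_nonneg_left h4 hC
      linarith)
  set Z := ε ^ (θ - β * (1 - ν) / (2 - ν)) with hZ
  -- The nonnegative quantity subtracted from `θ` only enlarges a power of `ε < 1`; this is the sole
  -- role of `ν`.
  have hZX : X ≤ Z := by
    refine Real.rpow_le_rpow_of_exponent_ge hε0 hε1.le ?_
    have : 0 ≤ β * (1 - ν) / (2 - ν) :=
      div_nonneg (mul_nonneg hβ.1.le (by linarith [hν.2])) (by linarith [hν.2])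
    linarith
  -- After the bounds for `δ * ‖y₁‖` and `P`, the products `X * Y` and `X * X` are reduced to `Y`
  -- and `X` by `X ≤ 1`.
  have hfinal : C * (δ * ‖y₁‖) + X * (E * (1 + ‖P‖)) + 2 * C * (C * Y) ≤
      (C * D + E * (1 + L + D) + (3 * C ^ 2 + 2 * (E * C)) + 1) * (Z + Y) := by
    have k1 := mul_le_mul_of_nonneg_left hδy hC
    have k2 : ‖P‖ ≤ L + 2 * (C * Y) + D * X := by linarith
    have k3 : X * (E * (1 + ‖P‖)) ≤ X * (E * (1 + (L + 2 * (C * Y) + D * X))) := by gcongr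
    have k4 : X * (E * (2 * (C * Y))) ≤ E * (2 * (C * Y)) :=
      mul_le_of_le_one_left (by positivity) hX1
    have k5 : X * (E * (D * X)) ≤ E * D * X := by
      have := mul_le_of_le_one_left (show 0 ≤ E * D * X by positivity) hX1
      linarith
    have k6 : (C * D + E * (1 + L + D)) * X ≤ (C * D + E * (1 + L + D)) * Z :=
      mul_le_mul_of_nonneg_left hZX (by positivity)
    have k7 : 0 ≤ (C * D + E * (1 + L + D)) * Y := by positivity
    have k8 : 0 ≤ (3 * C ^ 2 + 2 * (E * C)) * Z :=
      mul_nonneg (by positivity) (hX0.le.trans hZX)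
    have k9 : 0 ≤ Z + Y := by linarith
    linarith
  have hbound := hmain.2.trans hfinal
  refine ⟨hmain.1, hbound, fun hKu hKub => ?_⟩
  have hsplit : TFHJ.K α 0 t₁ (fun s => u ε x₁ s - ubar y₁ s) t₁ =
      TFHJ.K α 0 t₁ (u ε x₁) t₁ - TFHJ.K α 0 t₁ (ubar y₁) t₁ := by
    rw [TFHJ.K, TFHJ.K, TFHJ.K, ← mul_sub, ← intervalIntegral.integral_sub hKu hKub]
    congr 2
    ext τ
    ring
  rw [hsplit] at hbound
  linarith
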